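/- **Setting.** Let $K$ be a field. All Hopf algebras, comodules and tensor products are over $K$; no assumption is made on the antipodes. Write $\Delta(h)=\sum h_1\otimes h_2$. *Couples.* A couple $(H,M)$ consists of a Hopf algebra $H$ and an $H$-Hopf bimodule $M$, i.e. an $H$-bimodule and $H$-bicomodule with coactions $\rho_l:M\to H\otimes M$, $\rho_l(m)=\sum m_{-1}\otimes m_0$, and $\rho_r:M\to M\otimes H$, $\rho_r(m)=\sum m_0\otimes m_1$, such that for all $h,h'\in H$, $m\in M$ $$\rho_l(h.m.h')=\sum h_1m_{-1}h'_1\otimes h_2.m_0.h'_2,\qquad \rho_r(h.m.h')=\sum h_1.m_0.h'_1\otimes h_2m_1h'_2 .$$ *The quantum symmetric algebra.* Let $\mathrm{Cot}_H(M)=H\oplus M\oplus (M\,\square_H M)\oplus (M\,\square_H M\,\square_H M)\oplus\cdots$ be the cotensor coalgebra, graded with $H$ in degree $0$ and the $n$-fold cotensor power $M^{\square n}$ in degree $n$. It is a graded Hopf algebra: its multiplication is the unique graded coalgebra morphism $\mathrm{Cot}_H(M)\otimes \mathrm{Cot}_H(M)\to \mathrm{Cot}_H(M)$ which on $H\otimes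 H$ is the multiplication of $H$ and which sends $h\otimes m+m'\otimes h'$ to $h.m+m'.h'$ for $h,h'\in H$ and $m,m'\in M$; its unit is that of $H$. The quantum symmetric algebra $S_H(M)$ is the subalgebra of $\mathrm{Cot}_H(M)$ generated by $H$ and $M$; it is a Hopf subalgebra, graded by $S_H(M)_n=S_H(M)\cap M^{\square n}$ for $n\ge 1$ and $S_H(M)_0=H$. *Pairings.* A Hopf pairing of Hopf algebras $A$ and $C$ is a bilinear map $\phi:A\times C\to K$ such that for all $a,a'\in A$ and $c,c'\in C$ $$\phi(1,c)=\varepsilon(c),\quad \phi(a,1)=\varepsilon(a),\quad \phi(a,cc')=\sum\phi(a_1,c)\phi(a_2,c'),\quad \phi(aa',c)=\sum\phi(a,c_1)\phi(a',c_2),\quad \phi(S(a),c)=\phi(a,S(c)),$$ where $S$ denotes the antipodes. If $A$ and $C$ are graded, $\phi$ is called graded if $\phi(A_i,C_j)=0$ for $i\ne j$. A bilinear map $\phi:V\times W\to K$ is two-sided non-degenerate if for each $w\neq 0$ in $W$ there is $v\in V$ with $\phi(v,w)\ne 0$, and for each $v\ne 0$ in $V$ there is $w\in W$ with $\phi(v,w)\neq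 0$. A pairing of couples $(\phi_0,\phi_1):(H,M)\times(B,N)\to K$ consists of a Hopf pairing $\phi_0:H\times B\to K$ and a bilinear map $\phi_1:M\times N\to K$ such that for all $h,g\in H$, $b,c\in B$, $m\in M$, $n\in N$ $$\phi_1(h.m.g,n)=\sum\phi_0(h,n_{-1})\,\phi_1(m,n_0)\,\phi_0(g,n_1),\qquad \phi_1(m,b.n.c)=\sum\phi_0(m_{-1},b)\,\phi_1(m_0,n)\,\phi_0(m_1,c),$$ where $\sum m_{-1}\otimes m_0\otimes m_1=(\mathrm{id}\otimes\rho_r)\rho_l(m)$, and likewise for $n$. **Theorem 3.1.** Let $(\phi_0,\phi_1):(H,M)\times(B,N)\to K$ be a pairing of couples. Then there is a unique graded Hopf pairing $$\phi:S_H(M)\times S_B(N)\to K$$ which restricts to $\phi_0$ on $H\times B$ and to $\phi_1$ on $M\times N$. Moreover, $\phi$ is two-sided non-degenerate if and only if both $\phi_0$ and $\phi_1$ are two-sided non-degenerate. -/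

import Mathlib

open scoped TensorProduct DirectSum
open Coalgebra

noncomputable section

namespace QSym

/-! ### Shortcuts for the instance search -/

section Shortcuts

variable {K V W : Type*} [Field K] [AddCommMonoid V] [Module K V] [AddCommMonoid W] [Module K W]

theorem linearMap_zeroHomClass : ZeroHomClass (V →ₗ[K] W) V W := inferInstance
theorem linearMap_addHomClass : AddHomClass (V →ₗ[K] W) V W := inferInstance
theorem linearMap_addMonoidHomClass : AddMonoidHomClass (V →ₗ[K] W) V W := inferInstance
theorem linearEquiv_zeroHomClass : ZeroHomClass (V ≃ₗ[K] W) V W := inferInstance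
theorem linearEquiv_addHomClass : AddHomClass (V ≃ₗ[K] W) V W := inferInstance
theorem linearEquiv_addMonoidHomClass : AddMonoidHomClass (V ≃ₗ[K] W) V W := inferInstance

end Shortcuts

attribute [local instance] linearMap_zeroHomClass linearMap_addHomClass
  linearMap_addMonoidHomClass linearEquiv_zeroHomClass linearEquiv_addHomClass
  linearEquiv_addMonoidHomClass SMulZeroClass.toSMul DistribSMul.toSMulZeroClass
  DistribMulAction.toDistribSMul Module.toDistribMulAction AddMonoid.toAddZeroClass
  AddCommMonoid.toAddMonoid AddCommGroup.toAddCommMonoid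

section Linear

variable {K : Type*} [Field K] {V W Y : Type*} [AddCommGroup V] [Module K V]
  [AddCommGroup W] [Module K W] [AddCommGroup Y] [Module K Y]

/-- A chosen linear retraction of a vector space onto a subspace. -/
def retraction (p : Submodule K V) : V →ₗ[K] p := p.subtype.leftInverse

lemma retraction_comp_subtype (p : Submodule K V) :
    retraction p ∘ₗ p.subtype = LinearMap.id := by
  ext x
  have := LinearMap.leftInverse_apply_of_inj (f := p.subtype) p.ker_subtype x
  simpa [retraction] using congrArg Subtype.val this

lemma exists_factor (D : V →ₗ[K] W) (f : V →ₗ[K] Y) (h : LinearMap.ker D ≤ LinearMap.ker f) :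
    ∃ D' : W →ₗ[K] Y, f = D' ∘ₗ D := by
  obtain ⟨s, hs⟩ := D.rangeRestrict.exists_rightInverse_of_surjective D.range_rangeRestrict
  obtain ⟨g, hg⟩ := LinearMap.exists_extend (p := LinearMap.range D) (f ∘ₗ s)
  refine ⟨g, LinearMap.ext fun v => ?_⟩
  have h1 : g (D v) = f (s (D.rangeRestrict v)) := congr($hg (D.rangeRestrict v))
  have h2 : D (s (D.rangeRestrict v)) = D v :=
    congrArg Subtype.val (congr($hs (D.rangeRestrict v)) : _ = _)
  have h3 : v - s (D.rangeRestrict v) ∈ LinearMap.ker D := by simp [h2]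
  have h4 := h h3
  simp only [LinearMap.mem_ker, map_sub, sub_eq_zero] at h4
  simp [h1, h4]

lemma exists_retraction_factor (D : V →ₗ[K] W) :
    ∃ D' : W →ₗ[K] V, (LinearMap.ker D).subtype ∘ₗ retraction (LinearMap.ker D)
      = LinearMap.id - D' ∘ₗ D := by
  obtain ⟨D', h⟩ := exists_factor D
    (LinearMap.id - (LinearMap.ker D).subtype ∘ₗ retraction (LinearMap.ker D)) (by
      intro v hv
      have := congr($(retraction_comp_subtype (LinearMap.ker D)) ⟨v, hv⟩)
      have := congrArg Subtype.val this
      simp at this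
      simp [this])
  exact ⟨D', by rw [← h]; abel⟩

end Linear

universe u v

section Actions

/-- The left action `h ↦ (m ↦ h.m)` as a `K`-bilinear map. -/
def actL (K : Type*) (H : Type u) (M : Type v) [Field K] [Ring H] [Algebra K H]
    [AddCommGroup M] [Module K M] [Module H M] [IsScalarTower K H M] :
    H →ₗ[K] M →ₗ[K] M := (Algebra.lsmul K K M).toLinearMap

/-- The right action `h ↦ (m ↦ m.h)` as a `K`-bilinear map. -/
def actR (K : Type*) (H : Type u) (M : Type v) [Field K] [Ring H] [Algebra K H]
    [AddCommGroup M] [Module K M] [Module Hᵐᵒᵖ M] [IsScalarTower K Hᵐᵒᵖ M] :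
    H →ₗ[K] M →ₗ[K] M :=
  (Algebra.lsmul K K M).toLinearMap ∘ₗ (MulOpposite.opLinearEquiv K).toLinearMap

variable {K : Type*} {H : Type u} {M : Type v} [Field K] [Ring H] [Algebra K H]
    [AddCommGroup M] [Module K M]

@[simp] lemma actL_apply [Module H M] [IsScalarTower K H M] (h : H) (m : M) :
    actL K H M h m = h • m := rfl

@[simp] lemma actR_apply [Module Hᵐᵒᵖ M] [IsScalarTower K Hᵐᵒᵖ M] (h : H) (m : M) :
    actR K H M h m = MulOpposite.op h • m := rfl

end Actions

/-- A Hopf bimodule over the Hopf algebra `H`: an `H`-bimodule `M` (as usual in Mathlib, the right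
action is an action of `Hᵐᵒᵖ`) which is an `H`-bicomodule, such that the two coactions are
compatible with the two actions. -/
class HopfBimodule (K : Type*) (H : Type u) (M : Type v) [Field K] [Ring H] [HopfAlgebra K H]
    [AddCommGroup M] [Module K M] [Module H M] [Module Hᵐᵒᵖ M] [IsScalarTower K H M]
    [IsScalarTower K Hᵐᵒᵖ M] [SMulCommClass H Hᵐᵒᵖ M] where
  /-- the left coaction `m ↦ ∑ m₋₁ ⊗ m₀` -/
  coactL : M →ₗ[K] H ⊗[K] M
  /-- the right coaction `m ↦ ∑ m₀ ⊗ m₁` -/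
  coactR : M →ₗ[K] M ⊗[K] H
  coassocL : (TensorProduct.assoc K H H M).toLinearMap ∘ₗ (comul (R := K)).rTensor M ∘ₗ coactL
    = coactL.lTensor H ∘ₗ coactL
  counitL : (TensorProduct.lid K M).toLinearMap ∘ₗ (counit (R := K)).rTensor M ∘ₗ coactL
    = LinearMap.id
  coassocR : (TensorProduct.assoc K M H H).toLinearMap ∘ₗ coactR.rTensor H ∘ₗ coactR
    = (comul (R := K)).lTensor M ∘ₗ coactR
  counitR : (TensorProduct.rid K M).toLinearMap ∘ₗ (counit (R := K)).lTensor M ∘ₗ coactR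
    = LinearMap.id
  coact_comm : (TensorProduct.assoc K H M H).toLinearMap ∘ₗ coactL.rTensor H ∘ₗ coactR
    = coactR.lTensor H ∘ₗ coactL
  /-- `ρₗ(h.m) = ∑ h₁m₋₁ ⊗ h₂.m₀` -/
  coactL_smul (h : H) (m : M) : coactL (h • m)
    = TensorProduct.map₂ (LinearMap.mul K H) (actL K H M)
        (comul (R := K) h) (coactL m)
  /-- `ρₗ(m.h) = ∑ m₋₁h₁ ⊗ m₀.h₂` -/
  coactL_op_smul (h : H) (m : M) : coactL (MulOpposite.op h • m)
    = TensorProduct.map₂ (LinearMap.mul K H).flip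
        (actR K H M)
        (comul (R := K) h) (coactL m)
  /-- `ρᵣ(h.m) = ∑ h₁.m₀ ⊗ h₂m₁` -/
  coactR_smul (h : H) (m : M) : coactR (h • m)
    = TensorProduct.map₂ (actL K H M) (LinearMap.mul K H)
        (comul (R := K) h) (coactR m)
  /-- `ρᵣ(m.h) = ∑ m₀.h₁ ⊗ m₁h₂` -/
  coactR_op_smul (h : H) (m : M) : coactR (MulOpposite.op h • m)
    = TensorProduct.map₂
        (actR K H M)
        (LinearMap.mul K H).flip
        (comul (R := K) h) (coactR m)

/-- A left comodule over the coalgebra `H`. -/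
structure LeftComod (K : Type*) (H : Type u) [Field K] [Ring H] [HopfAlgebra K H] where
  carrier : Type v
  [addCommGroup : AddCommGroup carrier]
  [module : Module K carrier]
  coact : carrier →ₗ[K] H ⊗[K] carrier
  coassoc : (TensorProduct.assoc K H H carrier).toLinearMap ∘ₗ (comul (R := K)).rTensor carrier ∘ₗ coact
    = coact.lTensor H ∘ₗ coact
  counit : (TensorProduct.lid K carrier).toLinearMap ∘ₗ (counit (R := K)).rTensor carrier ∘ₗ coact
    = LinearMap.id

attribute [instance] LeftComod.addCommGroup LeftComod.module

section Cotensor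

variable (K : Type*) (H : Type u) (M : Type v) [Field K] [Ring H] [HopfAlgebra K H]
    [AddCommGroup M] [Module K M] [Module H M] [Module Hᵐᵒᵖ M] [IsScalarTower K H M]
    [IsScalarTower K Hᵐᵒᵖ M] [SMulCommClass H Hᵐᵒᵖ M] [HopfBimodule K H M]

open HopfBimodule

/-- For a left `H`-coaction `lam` on `X`, the map `ρᵣ ⊗ id - id ⊗ lam : M ⊗ X → M ⊗ (H ⊗ X)`,
whose kernel is the cotensor product `M □_H X`. -/
def cotensorMap {X : Type*} [AddCommGroup X] [Module K X] (lam : X →ₗ[K] H ⊗[K] X) :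
    M ⊗[K] X →ₗ[K] M ⊗[K] (H ⊗[K] X) :=
  (TensorProduct.assoc K M H X).toLinearMap ∘ₗ (coactR (K := K) (H := H) (M := M)).rTensor X
    - lam.lTensor M

variable {K H M}

lemma lTensor_factor {V W Y : Type*} [AddCommGroup V] [Module K V]
    [AddCommGroup W] [Module K W] [AddCommGroup Y] [Module K Y] (D : V →ₗ[K] W) (w : Y ⊗[K] V)
    (hw : D.lTensor Y w = 0) :
    ((LinearMap.ker D).subtype ∘ₗ retraction (LinearMap.ker D)).lTensor Y w = w := by
  obtain ⟨D', h⟩ := exists_retraction_factor D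
  rw [h, LinearMap.lTensor_sub, LinearMap.lTensor_comp]
  simp [hw]

/-- The left coaction on `M ⊗ X` induced by that of `M`. -/
def tensorCoact (X : Type*) [AddCommGroup X] [Module K X] : M ⊗[K] X →ₗ[K] H ⊗[K] (M ⊗[K] X) :=
  (TensorProduct.assoc K H M X).toLinearMap ∘ₗ (coactL (K := K) (H := H) (M := M)).rTensor X

@[simp] lemma tensorCoact_tmul {X : Type*} [AddCommGroup X] [Module K X] (m : M) (x : X) :
    tensorCoact X (m ⊗ₜ[K] x) = TensorProduct.assoc K H M X (coactL m ⊗ₜ x) := rfl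

lemma cotensorMap_tensorCoact {X : Type*} [AddCommGroup X] [Module K X] (lam : X →ₗ[K] H ⊗[K] X) :
    (cotensorMap K H M lam).lTensor H ∘ₗ tensorCoact X
      = tensorCoact (H ⊗[K] X) ∘ₗ cotensorMap K H M lam := by
  have h1 : ((TensorProduct.assoc K M H X).toLinearMap ∘ₗ
      (coactR (K := K) (H := H) (M := M)).rTensor X).lTensor H ∘ₗ tensorCoact X
      = tensorCoact (H ⊗[K] X) ∘ₗ (TensorProduct.assoc K M H X).toLinearMap ∘ₗ
      (coactR (K := K) (H := H) (M := M)).rTensor X := by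
    refine TensorProduct.ext' fun m x => ?_
    have e1 : ∀ z : H ⊗[K] M, ((TensorProduct.assoc K M H X).toLinearMap ∘ₗ
        (coactR (K := K) (H := H) (M := M)).rTensor X).lTensor H (TensorProduct.assoc K H M X (z ⊗ₜ x))
        = ((TensorProduct.assoc K M H X).toLinearMap ∘ₗ ((TensorProduct.mk K _ X).flip x)).lTensor H
           (coactR.lTensor H z) := by
      intro z
      induction z with
      | zero => simp
      | add a b ha hb => simp only [TensorProduct.add_tmul, map_add, ha, hb]
      | tmul a b => simp
    have e2 : ∀ z : M ⊗[K] H, tensorCoact (H ⊗[K] X) (TensorProduct.assoc K M H X (z ⊗ₜ x))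
        = ((TensorProduct.assoc K M H X).toLinearMap ∘ₗ ((TensorProduct.mk K _ X).flip x)).lTensor H
           (TensorProduct.assoc K H M H (coactL.rTensor H z)) := by
      intro z
      induction z with
      | zero => simp
      | add a b ha hb => simp only [TensorProduct.add_tmul, map_add, ha, hb]
      | tmul a b =>
        simp only [TensorProduct.assoc_tmul, tensorCoact_tmul, LinearMap.rTensor_tmul]
        induction coactL (K := K) (H := H) a with
        | zero => simp
        | add a b ha hb => simp only [TensorProduct.add_tmul, map_add, ha, hb]
        | tmul a b => simp
    have := congr($(coact_comm (K := K) (H := H) (M := M)) m)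
    simp only [LinearMap.comp_apply, LinearEquiv.coe_coe, LinearMap.rTensor_tmul, tensorCoact_tmul] at this ⊢
    rw [e1, e2, this]
  have h2 : (lam.lTensor M).lTensor H ∘ₗ tensorCoact X = tensorCoact (H ⊗[K] X) ∘ₗ lam.lTensor M := by
    refine TensorProduct.ext' fun m x => ?_
    simp only [LinearMap.comp_apply, tensorCoact_tmul, LinearMap.lTensor_tmul]
    induction coactL (K := K) (H := H) m with
    | zero => simp
    | add a b ha hb => simp only [TensorProduct.add_tmul, map_add, ha, hb]
    | tmul a b => simp
  rw [cotensorMap, LinearMap.lTensor_sub, LinearMap.sub_comp, h1, h2, LinearMap.comp_sub]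

lemma tensorCoact_coassoc (X : Type*) [AddCommGroup X] [Module K X] :
    (TensorProduct.assoc K H H (M ⊗[K] X)).toLinearMap ∘ₗ
      (comul (R := K)).rTensor (M ⊗[K] X) ∘ₗ tensorCoact X
    = (tensorCoact X).lTensor H ∘ₗ tensorCoact (H := H) (M := M) X := by
  refine TensorProduct.ext' fun m x => ?_
  have e1 : ∀ z : H ⊗[K] M, TensorProduct.assoc K H H (M ⊗[K] X)
      ((comul (R := K)).rTensor (M ⊗[K] X) (TensorProduct.assoc K H M X (z ⊗ₜ x)))
      = (((TensorProduct.assoc K H M X).toLinearMap ∘ₗ ((TensorProduct.mk K _ X).flip x)).lTensor H)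
        (TensorProduct.assoc K H H M ((comul (R := K)).rTensor M z)) := by
    intro z
    induction z with
    | zero => simp
    | add a b ha hb => simp only [TensorProduct.add_tmul, map_add, ha, hb]
    | tmul a b =>
      simp only [TensorProduct.assoc_tmul, LinearMap.rTensor_tmul]
      induction comul (R := K) a with
      | zero => simp
      | add a b ha hb => simp only [TensorProduct.add_tmul, map_add, ha, hb]
      | tmul a b => simp
  have e2 : ∀ z : H ⊗[K] M, (tensorCoact X).lTensor H (TensorProduct.assoc K H M X (z ⊗ₜ x))
      = (((TensorProduct.assoc K H M X).toLinearMap ∘ₗ ((TensorProduct.mk K _ X).flip x)).lTensor H)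
        (coactL.lTensor H z) := by
    intro z
    induction z with
    | zero => simp
    | add a b ha hb => simp only [TensorProduct.add_tmul, map_add, ha, hb]
    | tmul a b => simp
  have := congr($(coassocL (K := K) (H := H) (M := M)) m)
  simp only [LinearMap.comp_apply, LinearEquiv.coe_coe, tensorCoact_tmul] at this ⊢
  rw [e1, e2, this]

lemma tensorCoact_counit (X : Type*) [AddCommGroup X] [Module K X] :
    (TensorProduct.lid K (M ⊗[K] X)).toLinearMap ∘ₗ
      (counit (R := K)).rTensor (M ⊗[K] X) ∘ₗ tensorCoact (H := H) X = LinearMap.id := by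
  refine TensorProduct.ext' fun m x => ?_
  have e1 : ∀ z : H ⊗[K] M, TensorProduct.lid K (M ⊗[K] X)
      ((counit (R := K)).rTensor (M ⊗[K] X) (TensorProduct.assoc K H M X (z ⊗ₜ x)))
      = (TensorProduct.lid K M ((counit (R := K)).rTensor M z)) ⊗ₜ x := by
    intro z
    induction z with
    | zero => simp
    | add a b ha hb => simp only [TensorProduct.add_tmul, map_add, ha, hb]
    | tmul a b => simp [TensorProduct.smul_tmul']
  have := congr($(counitL (K := K) (H := H) (M := M)) m)
  simp only [LinearMap.comp_apply, LinearEquiv.coe_coe, tensorCoact_tmul, LinearMap.id_apply] at this ⊢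
  rw [e1, this]

/-- The left coaction on the cotensor product `M □_H X`, the restriction of that of `M ⊗ X`
(see `subtype_cotensorCoact`). -/
def cotensorCoact {X : Type*} [AddCommGroup X] [Module K X] (lam : X →ₗ[K] H ⊗[K] X) :
    LinearMap.ker (cotensorMap K H M lam) →ₗ[K] H ⊗[K] LinearMap.ker (cotensorMap K H M lam) :=
  (retraction _).lTensor H ∘ₗ tensorCoact X ∘ₗ Submodule.subtype _

lemma subtype_cotensorCoact {X : Type*} [AddCommGroup X] [Module K X] (lam : X →ₗ[K] H ⊗[K] X) :
    (LinearMap.ker (cotensorMap K H M lam)).subtype.lTensor H ∘ₗ cotensorCoact lam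
      = tensorCoact X ∘ₗ Submodule.subtype _ := by
  ext x
  have h := lTensor_factor (Y := H) (cotensorMap K H M lam) (tensorCoact X x.1) (by
    have := congr($(cotensorMap_tensorCoact lam) x.1)
    simp only [LinearMap.comp_apply] at this
    rw [this, x.2, map_zero])
  rw [LinearMap.lTensor_comp] at h
  exact h

variable (M) in
/-- The cotensor product `M □_H X` of the bicomodule `M` with the left comodule `X`. -/
def cotensor (X : LeftComod.{u, v} K H) : LeftComod.{u, v} K H where
  carrier := LinearMap.ker (cotensorMap K H M X.coact)
  coact := cotensorCoact X.coact
  coassoc := by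
    set r := retraction (LinearMap.ker (cotensorMap K H M X.coact)) with hr
    ext x
    have h1 := congr($(subtype_cotensorCoact (M := M) X.coact) x)
    have h2 := congr(((r.lTensor H).lTensor H)
      ($(tensorCoact_coassoc (K := K) (H := H) (M := M) X.carrier) x.1))
    have nat : ∀ w : H ⊗[K] (M ⊗[K] X.carrier),
        TensorProduct.assoc K H H _ ((comul (R := K)).rTensor _ (r.lTensor H w))
        = (r.lTensor H).lTensor H
          (TensorProduct.assoc K H H _ ((comul (R := K)).rTensor _ w)) := by
      intro w
      induction w with
      | zero => simp
      | add a b ha hb => simp only [map_add, ha, hb]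
      | tmul a b =>
        simp only [LinearMap.lTensor_tmul, LinearMap.rTensor_tmul]
        induction comul (R := K) a with
        | zero => simp
        | add a b ha hb => simp only [TensorProduct.add_tmul, map_add, ha, hb]
        | tmul a b => simp
    simp only [LinearMap.comp_apply, LinearEquiv.coe_coe, Submodule.subtype_apply] at h1 h2 ⊢
    have e3 : cotensorCoact X.coact x = r.lTensor H (tensorCoact X.carrier x.1) := rfl
    conv_lhs => rw [e3]
    rw [nat, h2, ← h1]
    have e4 : cotensorCoact X.coact = r.lTensor H ∘ₗ tensorCoact X.carrier ∘ₗ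
      (LinearMap.ker (cotensorMap K H M X.coact)).subtype := rfl
    conv_rhs => enter [1]; rw [e4]
    rw [LinearMap.lTensor_comp, LinearMap.lTensor_comp]
    rfl
  counit := by
    set r := retraction (LinearMap.ker (cotensorMap K H M X.coact)) with hr
    ext x
    have h2 := congr(r ($(tensorCoact_counit (K := K) (H := H) (M := M) X.carrier) x.1))
    have nat : ∀ w : H ⊗[K] (M ⊗[K] X.carrier),
        TensorProduct.lid K _ ((counit (R := K)).rTensor _ (r.lTensor H w))
        = r (TensorProduct.lid K _ ((counit (R := K)).rTensor _ w)) := by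
      intro w
      induction w with
      | zero => simp
      | add a b ha hb => simp only [map_add, ha, hb]
      | tmul a b => simp
    have h3 : r x.1 = x := congr($(retraction_comp_subtype _) x)
    simp only [LinearMap.comp_apply, LinearEquiv.coe_coe, LinearMap.id_apply] at h2 ⊢
    have e3 : cotensorCoact X.coact x = r.lTensor H (tensorCoact X.carrier x.1) := rfl
    rw [e3, nat, h2, h3]

variable (K H M)

/-- `cotPow K H M n` is the iterated cotensor product `M □_H (M □_H (⋯ □_H M))` with `n + 1`
factors. -/
def cotPow : ℕ → LeftComod.{u, v} K H
  | 0 => ⟨M, coactL, coassocL, counitL⟩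
  | n + 1 => cotensor M (cotPow n)

/-- The space of elements of degree `n + 1` of the cotensor coalgebra. -/
abbrev CotPow (n : ℕ) : Type v := (cotPow K H M n).carrier

/-- The inclusion `M^{□(n+2)} ⊆ M ⊗ M^{□(n+1)}`. -/
def cotIncl (n : ℕ) : CotPow K H M (n + 1) →ₗ[K] M ⊗[K] CotPow K H M n :=
  (LinearMap.ker (cotensorMap K H M (cotPow K H M n).coact)).subtype

/-- The identification `M = M^{□1}`. -/
def cotOne : M ≃ₗ[K] CotPow K H M 0 := LinearEquiv.refl K M

/-- A linear retraction of `cotIncl`. -/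
def cotRetr (n : ℕ) : M ⊗[K] CotPow K H M n →ₗ[K] CotPow K H M (n + 1) :=
  retraction (LinearMap.ker (cotensorMap K H M (cotPow K H M n).coact))

/-- The underlying space `H ⊕ M ⊕ (M □_H M) ⊕ ⋯` of the cotensor Hopf algebra `Cot_H(M)`. -/
def Cot : Type (max u v) := H × ⨁ n, CotPow K H M n

instance : AddCommGroup (Cot K H M) := inferInstanceAs (AddCommGroup (H × ⨁ n, CotPow K H M n))
instance : Module K (Cot K H M) := inferInstanceAs (Module K (H × ⨁ n, CotPow K H M n))

namespace Cot

/-- The decomposition of `Cot` as a product, as a linear equivalence. -/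
def equiv : Cot K H M ≃ₗ[K] H × ⨁ n, CotPow K H M n := LinearEquiv.refl K _

/-- The inclusion of the degree zero part `H`. -/
def inH : H →ₗ[K] Cot K H M :=
  (equiv K H M).symm.toLinearMap ∘ₗ LinearMap.inl K H (⨁ n, CotPow K H M n)

/-- The inclusion of the part `M^{□(n+1)}` of degree `n + 1`. -/
def inP (n : ℕ) : CotPow K H M n →ₗ[K] Cot K H M :=
  (equiv K H M).symm.toLinearMap ∘ₗ LinearMap.inr K H (⨁ n, CotPow K H M n) ∘ₗ
    DirectSum.lof K ℕ (fun n => CotPow K H M n) n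

/-- The inclusion of the degree one part `M`. -/
def inM : M →ₗ[K] Cot K H M := inP K H M 0 ∘ₗ (cotOne K H M).toLinearMap

/-- The projection to the degree zero part. -/
def prH : Cot K H M →ₗ[K] H :=
  LinearMap.fst K H (⨁ n, CotPow K H M n) ∘ₗ (equiv K H M).toLinearMap

/-- The projection to the part of degree `n + 1`. -/
def prP (n : ℕ) : Cot K H M →ₗ[K] CotPow K H M n :=
  DirectSum.component K ℕ (fun n => CotPow K H M n) n ∘ₗ
    LinearMap.snd K H (⨁ n, CotPow K H M n) ∘ₗ (equiv K H M).toLinearMap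

/-- The projection to the degree one part. -/
def prM : Cot K H M →ₗ[K] M := (cotOne K H M).symm.toLinearMap ∘ₗ prP K H M 0

/-- A linear map out of `Cot` from its values on the homogeneous components. -/
def desc {Y : Type*} [AddCommGroup Y] [Module K Y] (f : H →ₗ[K] Y)
    (g : ∀ n, CotPow K H M n →ₗ[K] Y) : Cot K H M →ₗ[K] Y :=
  LinearMap.coprod f (DirectSum.toModule K ℕ Y g) ∘ₗ (equiv K H M).toLinearMap

variable {K H M}
variable {Y : Type*} [AddCommGroup Y] [Module K Y]

@[simp] lemma desc_inH (f : H →ₗ[K] Y) (g : ∀ n, CotPow K H M n →ₗ[K] Y) (h : H) :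
    desc K H M f g (inH K H M h) = f h := by
  simp [desc, inH]

@[simp] lemma desc_inP (f : H →ₗ[K] Y) (g : ∀ n, CotPow K H M n →ₗ[K] Y) (n : ℕ)
    (x : CotPow K H M n) :
    desc K H M f g (inP K H M n x) = g n x := by
  simp [desc, inP]

lemma desc_comp_inH (f : H →ₗ[K] Y) (g : ∀ n, CotPow K H M n →ₗ[K] Y) :
    desc K H M f g ∘ₗ inH K H M = f := LinearMap.ext fun h => desc_inH f g h

lemma desc_comp_inP (f : H →ₗ[K] Y) (g : ∀ n, CotPow K H M n →ₗ[K] Y) (n : ℕ) :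
    desc K H M f g ∘ₗ inP K H M n = g n := LinearMap.ext fun h => desc_inP f g n h

@[simp] lemma prH_inH (h : H) : prH K H M (inH K H M h) = h := by simp [prH, inH]
@[simp] lemma prH_inP (n : ℕ) (x : CotPow K H M n) : prH K H M (inP K H M n x) = 0 := by
  simp [prH, inP]
@[simp] lemma prP_inH (n : ℕ) (h : H) : prP K H M n (inH K H M h) = 0 := by simp [prP, inH]
@[simp] lemma prP_inP (n : ℕ) (x : CotPow K H M n) : prP K H M n (inP K H M n x) = x := by
  simp only [prP, inP, LinearMap.comp_apply, LinearEquiv.coe_coe, LinearEquiv.apply_symm_apply,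
    LinearMap.inr_apply, LinearMap.snd_apply]
  exact DirectSum.component.lof_self ..
lemma prP_inP_ne {m n : ℕ} (h : m ≠ n) (x : CotPow K H M n) :
    prP K H M m (inP K H M n x) = 0 := by
  simp only [prP, inP, LinearMap.comp_apply, LinearEquiv.coe_coe, LinearEquiv.apply_symm_apply,
    LinearMap.inr_apply, LinearMap.snd_apply]
  rw [DirectSum.component.of, dif_neg h.symm]

lemma ext' {x y : Cot K H M} (h : prH K H M x = prH K H M y)
    (hn : ∀ n, prP K H M n x = prP K H M n y) : x = y := by
  refine (equiv K H M).injective (Prod.ext h ?_)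
  exact DirectSum.ext_component K hn

/-- Every element is the sum of its components of sufficiently small degree. -/
lemma exists_sum (x : Cot K H M) : ∃ N, ∀ n, N ≤ n →
    x = inH K H M (prH K H M x) + ∑ k ∈ Finset.range n, inP K H M k (prP K H M k x) := by
  classical
  obtain ⟨N, hN⟩ : ∃ N, ∀ n, N ≤ n → prP K H M n x = 0 := by
    refine ⟨(DFinsupp.support (equiv K H M x).2).sup id + 1, fun n hn => ?_⟩
    by_contra h
    have : n ∈ DFinsupp.support (equiv K H M x).2 := by
      rw [DFinsupp.mem_support_iff]; exact h
    have := Finset.le_sup (f := id) this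
    simp at this
    omega
  refine ⟨N, fun n hn => ext' (by simp) fun k => ?_⟩
  simp only [map_add, prP_inH, zero_add, map_sum]
  by_cases hk : k < n
  · rw [Finset.sum_eq_single k (fun j _ hj => prP_inP_ne hj.symm _)
      (fun h => absurd (Finset.mem_range.2 hk) h)]
    simp
  · rw [Finset.sum_eq_zero fun j hj => prP_inP_ne (by rw [Finset.mem_range] at hj; omega) _]
    exact hN k (by omega)

lemma hom_ext {F G : Cot K H M →ₗ[K] Y} (h : ∀ x, F (inH K H M x) = G (inH K H M x))
    (hn : ∀ n x, F (inP K H M n x) = G (inP K H M n x)) : F = G := by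
  ext x
  obtain ⟨N, hN⟩ := exists_sum x
  rw [hN N le_rfl]
  simp [h, hn]

end Cot

end Cotensor

section Cotensor
variable {K : Type*} {H : Type u} {M : Type v} [Field K] [Ring H] [HopfAlgebra K H]
    [AddCommGroup M] [Module K M] [Module H M] [Module Hᵐᵒᵖ M] [IsScalarTower K H M]
    [IsScalarTower K Hᵐᵒᵖ M] [SMulCommClass H Hᵐᵒᵖ M] [HopfBimodule K H M]
open HopfBimodule

/-! ### Structure maps of the cotensor coalgebra -/

section Naturality

variable {X Y : Type*} [AddCommGroup X] [Module K X] [AddCommGroup Y] [Module K Y]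

lemma tensorCoact_lTensor (f : X →ₗ[K] Y) (z : M ⊗[K] X) :
    tensorCoact Y (f.lTensor M z) = (f.lTensor M).lTensor H (tensorCoact X z) := by
  induction z with
  | zero => simp
  | add a b ha hb => simp only [map_add, ha, hb]
  | tmul m x =>
    simp only [tensorCoact_tmul, LinearMap.lTensor_tmul]
    induction coactL (K := K) (H := H) m with
    | zero => simp
    | add a b ha hb => simp only [TensorProduct.add_tmul, map_add, ha, hb]
    | tmul a b => simp

lemma cotensorMap_lTensor {lX : X →ₗ[K] H ⊗[K] X} {lY : Y →ₗ[K] H ⊗[K] Y} (f : X →ₗ[K] Y)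
    (hf : ∀ x, lY (f x) = f.lTensor H (lX x)) (z : M ⊗[K] X) :
    cotensorMap K H M lY (f.lTensor M z) = (f.lTensor H).lTensor M (cotensorMap K H M lX z) := by
  induction z with
  | zero => simp
  | add a b ha hb => simp only [map_add, ha, hb]
  | tmul m x =>
    simp only [cotensorMap, LinearMap.sub_apply, LinearMap.comp_apply, LinearMap.lTensor_tmul,
      LinearMap.rTensor_tmul, LinearEquiv.coe_coe, hf, map_sub]
    congr 1
    induction coactR (K := K) (H := H) m with
    | zero => simp
    | add a b ha hb => simp only [TensorProduct.add_tmul, map_add, ha, hb]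
    | tmul a b => simp

lemma assoc_rTensor_lTensor {A B C : Type*} [AddCommMonoid A] [Module K A] [AddCommMonoid B]
    [Module K B] [AddCommMonoid C] [Module K C] (d : A →ₗ[K] B ⊗[K] C) (f : X →ₗ[K] Y)
    (w : A ⊗[K] X) : TensorProduct.assoc K B C Y (d.rTensor Y (f.lTensor A w))
      = (f.lTensor C).lTensor B (TensorProduct.assoc K B C X (d.rTensor X w)) := by
  induction w with
  | zero => simp
  | add a b ha hb => simp only [map_add, ha, hb]
  | tmul a x =>
    simp only [LinearMap.lTensor_tmul, LinearMap.rTensor_tmul]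
    induction d a with
    | zero => simp
    | add a b ha hb => simp only [TensorProduct.add_tmul, map_add, ha, hb]
    | tmul a b => simp

end Naturality

namespace Cot

variable (K H M)

/-- The left coaction of `H` on `Cot`. -/
def lam : Cot K H M →ₗ[K] H ⊗[K] Cot K H M :=
  desc K H M ((inH K H M).lTensor H ∘ₗ comul)
    (fun n => (inP K H M n).lTensor H ∘ₗ (cotPow K H M n).coact)

/-- Splitting off the first tensor factor: this map is zero on `H`, the right coaction
`M → M ⊗ H` on `M` and the inclusion `M^{□(n+2)} → M ⊗ M^{□(n+1)}` in higher degrees. -/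
def unc : Cot K H M →ₗ[K] M ⊗[K] Cot K H M :=
  desc K H M 0 fun n => match n with
    | 0 => (inH K H M).lTensor M ∘ₗ coactR ∘ₗ (cotOne K H M).symm.toLinearMap
    | n + 1 => (inP K H M n).lTensor M ∘ₗ cotIncl K H M n

/-- A linear map `M ⊗ Cot → Cot` which is inverse to `unc` on `M □_H Cot`. -/
def ret : M ⊗[K] Cot K H M →ₗ[K] Cot K H M :=
  TensorProduct.lift (desc K H M
    (TensorProduct.curry (inM K H M ∘ₗ (TensorProduct.rid K M).toLinearMap ∘ₗ
      (counit (R := K)).lTensor M)).flip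
    (fun n => (TensorProduct.curry (inP K H M (n + 1) ∘ₗ cotRetr K H M n)).flip)).flip

variable {K H M}

@[simp] lemma lam_inH (h : H) : lam K H M (inH K H M h) = (inH K H M).lTensor H (comul h) :=
  desc_inH ..
@[simp] lemma lam_inP (n : ℕ) (x : CotPow K H M n) :
    lam K H M (inP K H M n x) = (inP K H M n).lTensor H ((cotPow K H M n).coact x) := desc_inP ..
@[simp] lemma unc_inH (h : H) : unc K H M (inH K H M h) = 0 := desc_inH ..
@[simp] lemma unc_inP_zero (x : CotPow K H M 0) :
    unc K H M (inP K H M 0 x) = (inH K H M).lTensor M (coactR ((cotOne K H M).symm x)) :=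
  desc_inP ..
@[simp] lemma unc_inP_succ (n : ℕ) (x : CotPow K H M (n + 1)) :
    unc K H M (inP K H M (n + 1) x) = (inP K H M n).lTensor M (cotIncl K H M n x) := desc_inP ..

lemma ret_inH (z : M ⊗[K] H) : ret K H M ((inH K H M).lTensor M z)
    = inM K H M (TensorProduct.rid K M ((counit (R := K)).lTensor M z)) := by
  induction z with
  | zero => simp
  | add a b ha hb => simp only [map_add, ha, hb]
  | tmul m x => simp [ret]

lemma ret_inP (n : ℕ) (z : M ⊗[K] CotPow K H M n) : ret K H M ((inP K H M n).lTensor M z)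
    = inP K H M (n + 1) (cotRetr K H M n z) := by
  induction z with
  | zero => simp
  | add a b ha hb => simp only [map_add, ha, hb]
  | tmul m x => simp [ret]

/-- Every element of `V ⊗ Cot` is the sum of its components. -/
lemma lTensor_exists_sum {V : Type*} [AddCommGroup V] [Module K V] (z : V ⊗[K] Cot K H M) :
    ∃ N, ∀ n, N ≤ n → z = (inH K H M).lTensor V ((prH K H M).lTensor V z)
      + ∑ k ∈ Finset.range n, (inP K H M k).lTensor V ((prP K H M k).lTensor V z) := by
  induction z with
  | zero => exact ⟨0, by simp⟩
  | add a b ha hb =>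
    obtain ⟨N, hN⟩ := ha
    obtain ⟨N', hN'⟩ := hb
    refine ⟨max N N', fun n hn => ?_⟩
    conv_lhs => rw [hN n (le_trans (le_max_left _ _) hn), hN' n (le_trans (le_max_right _ _) hn)]
    simp only [map_add, Finset.sum_add_distrib]
    abel
  | tmul v x =>
    obtain ⟨N, hN⟩ := exists_sum x
    refine ⟨N, fun n hn => ?_⟩
    conv_lhs => rw [hN n hn]
    simp [TensorProduct.tmul_add, TensorProduct.tmul_sum]

lemma rTensor_exists_sum {V : Type*} [AddCommGroup V] [Module K V] (z : Cot K H M ⊗[K] V) :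
    ∃ N, ∀ n, N ≤ n → z = (inH K H M).rTensor V ((prH K H M).rTensor V z)
      + ∑ k ∈ Finset.range n, (inP K H M k).rTensor V ((prP K H M k).rTensor V z) := by
  induction z with
  | zero => exact ⟨0, by simp⟩
  | add a b ha hb =>
    obtain ⟨N, hN⟩ := ha
    obtain ⟨N', hN'⟩ := hb
    refine ⟨max N N', fun n hn => ?_⟩
    conv_lhs => rw [hN n (le_trans (le_max_left _ _) hn), hN' n (le_trans (le_max_right _ _) hn)]
    simp only [map_add, Finset.sum_add_distrib]
    abel
  | tmul x v =>
    obtain ⟨N, hN⟩ := exists_sum x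
    refine ⟨N, fun n hn => ?_⟩
    conv_lhs => rw [hN n hn]
    simp [TensorProduct.add_tmul, TensorProduct.sum_tmul]

lemma lTensor_ext {V : Type*} [AddCommGroup V] [Module K V] {z w : V ⊗[K] Cot K H M}
    (h : (prH K H M).lTensor V z = (prH K H M).lTensor V w)
    (hn : ∀ n, (prP K H M n).lTensor V z = (prP K H M n).lTensor V w) : z = w := by
  obtain ⟨N, hN⟩ := lTensor_exists_sum z
  obtain ⟨N', hN'⟩ := lTensor_exists_sum w
  rw [hN (max N N') (le_max_left _ _), hN' (max N N') (le_max_right _ _)]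
  simp only [h, hn]

lemma rTensor_ext {V : Type*} [AddCommGroup V] [Module K V] {z w : Cot K H M ⊗[K] V}
    (h : (prH K H M).rTensor V z = (prH K H M).rTensor V w)
    (hn : ∀ n, (prP K H M n).rTensor V z = (prP K H M n).rTensor V w) : z = w := by
  obtain ⟨N, hN⟩ := rTensor_exists_sum z
  obtain ⟨N', hN'⟩ := rTensor_exists_sum w
  rw [hN (max N N') (le_max_left _ _), hN' (max N N') (le_max_right _ _)]
  simp only [h, hn]

lemma prH_comp_inH : prH K H M ∘ₗ inH K H M = LinearMap.id := LinearMap.ext prH_inH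
lemma prH_comp_inP (n : ℕ) : prH K H M ∘ₗ inP K H M n = 0 := LinearMap.ext (prH_inP n)
lemma prP_comp_inH (n : ℕ) : prP K H M n ∘ₗ inH K H M = 0 := LinearMap.ext (prP_inH n)
lemma prP_comp_inP (n : ℕ) : prP K H M n ∘ₗ inP K H M n = LinearMap.id := LinearMap.ext (prP_inP n)
lemma prP_comp_inP_ne {m n : ℕ} (h : m ≠ n) : prP K H M m ∘ₗ inP K H M n = 0 :=
  LinearMap.ext (prP_inP_ne h)

lemma lTensor_lTensor {V A B C : Type*} [AddCommGroup V] [Module K V] [AddCommGroup A] [Module K A]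
    [AddCommGroup B] [Module K B] [AddCommGroup C] [Module K C] (g : B →ₗ[K] C) (f : A →ₗ[K] B)
    (z : V ⊗[K] A) : g.lTensor V (f.lTensor V z) = (g ∘ₗ f).lTensor V z := by
  rw [LinearMap.lTensor_comp]; rfl

lemma lTensor_prH_lam (x : Cot K H M) :
    (prH K H M).lTensor H (lam K H M x) = comul (prH K H M x) := by
  refine congr($(hom_ext (F := (prH K H M).lTensor H ∘ₗ lam K H M) (G := comul ∘ₗ prH K H M) ?_ ?_) x)
  · intro h; simp [lTensor_lTensor, prH_comp_inH]
  · intro n h; simp [lTensor_lTensor, prH_comp_inP]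

lemma lTensor_prP_lam (n : ℕ) (x : Cot K H M) :
    (prP K H M n).lTensor H (lam K H M x) = (cotPow K H M n).coact (prP K H M n x) := by
  refine congr($(hom_ext (F := (prP K H M n).lTensor H ∘ₗ lam K H M)
    (G := (cotPow K H M n).coact ∘ₗ prP K H M n) ?_ ?_) x)
  · intro h; simp [lTensor_lTensor, prP_comp_inH]
  · intro m h
    by_cases hm : n = m
    · subst hm; simp [lTensor_lTensor, prP_comp_inP]
    · simp [lTensor_lTensor, prP_comp_inP_ne hm, prP_inP_ne hm]

lemma lTensor_prH_unc (x : Cot K H M) : (prH K H M).lTensor M (unc K H M x)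
    = coactR (prM K H M x) := by
  refine congr($(hom_ext (F := (prH K H M).lTensor M ∘ₗ unc K H M)
    (G := coactR ∘ₗ prM K H M) ?_ ?_) x)
  · intro h; simp [prM]
  · intro m h
    cases m with
    | zero => simp [lTensor_lTensor, prH_comp_inH, prM]
    | succ m => simp [lTensor_lTensor, prH_comp_inP, prP_inP_ne, prM]

lemma lTensor_prP_unc (n : ℕ) (x : Cot K H M) : (prP K H M n).lTensor M (unc K H M x)
    = cotIncl K H M n (prP K H M (n + 1) x) := by
  refine congr($(hom_ext (F := (prP K H M n).lTensor M ∘ₗ unc K H M)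
    (G := cotIncl K H M n ∘ₗ prP K H M (n + 1)) ?_ ?_) x)
  · intro h; simp
  · intro m h
    cases m with
    | zero => simp [lTensor_lTensor, prP_comp_inH, prP_inP_ne]
    | succ m =>
      by_cases hm : n = m
      · subst hm; simp [lTensor_lTensor, prP_comp_inP]
      · simp [lTensor_lTensor, prP_comp_inP_ne hm, prP_inP_ne (show n + 1 ≠ m + 1 by omega)]

lemma lTensor_lTensor_comp {V A B C : Type*} [AddCommMonoid V] [Module K V] [AddCommMonoid A]
    [Module K A] [AddCommMonoid B] [Module K B] [AddCommMonoid C] [Module K C] {g : B →ₗ[K] C}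
    {f : A →ₗ[K] B} {h : A →ₗ[K] C} (e : ∀ a, g (f a) = h a) (z : V ⊗[K] A) :
    g.lTensor V (f.lTensor V z) = h.lTensor V z := by
  rw [← LinearMap.comp_apply, ← LinearMap.lTensor_comp, show g ∘ₗ f = h from LinearMap.ext e]

lemma lTensor_lTensor_comm {V A B B' C : Type*} [AddCommMonoid V] [Module K V] [AddCommMonoid A]
    [Module K A] [AddCommMonoid B] [Module K B] [AddCommMonoid B'] [Module K B'] [AddCommMonoid C]
    [Module K C] {g : B →ₗ[K] C} {f : A →ₗ[K] B} {g' : B' →ₗ[K] C} {f' : A →ₗ[K] B'}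
    (e : ∀ a, g (f a) = g' (f' a)) (z : V ⊗[K] A) :
    g.lTensor V (f.lTensor V z) = g'.lTensor V (f'.lTensor V z) := by
  rw [lTensor_lTensor_comp (h := g ∘ₗ f) (fun _ => rfl),
    lTensor_lTensor_comp (h := g ∘ₗ f) (fun a => (e a).symm)]

lemma lam_coassoc (x : Cot K H M) :
    TensorProduct.assoc K H H _ ((comul (R := K)).rTensor _ (lam K H M x))
      = (lam K H M).lTensor H (lam K H M x) := by
  refine congr($(hom_ext (F := (TensorProduct.assoc K H H _).toLinearMap ∘ₗ
    (comul (R := K)).rTensor _ ∘ₗ lam K H M) (G := (lam K H M).lTensor H ∘ₗ lam K H M) ?_ ?_) x)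
  · intro h
    simp only [LinearMap.comp_apply, LinearEquiv.coe_coe, lam_inH]
    rw [assoc_rTensor_lTensor, Coalgebra.coassoc_apply,
      lTensor_lTensor_comm (g' := (inH K H M).lTensor H) (f' := comul) (fun _ => lam_inH _)]
  · intro n h
    simp only [LinearMap.comp_apply, LinearEquiv.coe_coe, lam_inP]
    have := congr($((cotPow K H M n).coassoc) h)
    simp only [LinearMap.comp_apply, LinearEquiv.coe_coe] at this
    rw [assoc_rTensor_lTensor, this,
      lTensor_lTensor_comm (g' := (inP K H M n).lTensor H) (fun _ => lam_inP n _)]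

lemma lid_rTensor_lTensor {A X Y : Type*} [AddCommMonoid A] [Module K A] [AddCommMonoid X]
    [Module K X] [AddCommMonoid Y] [Module K Y] (e : A →ₗ[K] K) (f : X →ₗ[K] Y) (w : A ⊗[K] X) :
    TensorProduct.lid K Y (e.rTensor Y (f.lTensor A w))
      = f (TensorProduct.lid K X (e.rTensor X w)) := by
  induction w with
  | zero => simp
  | add a b ha hb => simp only [map_add, ha, hb]
  | tmul a b => simp

lemma lam_counit (x : Cot K H M) :
    TensorProduct.lid K _ ((counit (R := K)).rTensor _ (lam K H M x)) = x := by
  refine congr($(hom_ext (F := (TensorProduct.lid K _).toLinearMap ∘ₗ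
    (counit (R := K)).rTensor _ ∘ₗ lam K H M) (G := LinearMap.id) ?_ ?_) x)
  · intro h
    simp only [LinearMap.comp_apply, LinearEquiv.coe_coe, lam_inH]
    rw [lid_rTensor_lTensor]
    simp
  · intro n h
    simp only [LinearMap.comp_apply, LinearEquiv.coe_coe, lam_inP]
    rw [lid_rTensor_lTensor]
    have := congr($((cotPow K H M n).counit) h)
    simp only [LinearMap.comp_apply, LinearEquiv.coe_coe] at this
    rw [this]
    rfl

lemma cotensorMap_unc (x : Cot K H M) : cotensorMap K H M (lam K H M) (unc K H M x) = 0 := by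
  refine congr($(hom_ext (F := cotensorMap K H M (lam K H M) ∘ₗ unc K H M) (G := 0) ?_ ?_) x)
  · intro h; simp
  · intro n h
    cases n with
    | zero =>
      simp only [LinearMap.comp_apply, unc_inP_zero, LinearMap.zero_apply]
      rw [cotensorMap_lTensor (lX := comul) _ (fun _ => lam_inH _)]
      have := congr($(coassocR (K := K) (H := H) (M := M)) ((cotOne K H M).symm h))
      simp only [LinearMap.comp_apply, LinearEquiv.coe_coe] at this
      simp [cotensorMap, this]
    | succ n =>
      simp only [LinearMap.comp_apply, unc_inP_succ, LinearMap.zero_apply]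
      rw [cotensorMap_lTensor (lX := (cotPow K H M n).coact) _ (fun _ => lam_inP n _)]
      have : cotensorMap K H M (cotPow K H M n).coact (cotIncl K H M n h) = 0 := h.2
      rw [this, map_zero]

lemma lTensor_unc_lam (x : Cot K H M) :
    (unc K H M).lTensor H (lam K H M x) = tensorCoact _ (unc K H M x) := by
  refine congr($(hom_ext (F := (unc K H M).lTensor H ∘ₗ lam K H M)
    (G := tensorCoact _ ∘ₗ unc K H M) ?_ ?_) x)
  · intro h
    simp only [LinearMap.comp_apply, lam_inH, unc_inH, map_zero]
    rw [lTensor_lTensor_comp (h := 0) (fun _ => unc_inH _)]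
    simp
  · intro n h
    cases n with
    | zero =>
      simp only [LinearMap.comp_apply, lam_inP, unc_inP_zero]
      rw [tensorCoact_lTensor, lTensor_lTensor_comm
        (g' := (inH K H M).lTensor M) (f' := coactR ∘ₗ (cotOne K H M).symm.toLinearMap)
        (fun a => unc_inP_zero a)]
      have := congr($(coact_comm (K := K) (H := H) (M := M)) ((cotOne K H M).symm h))
      simp only [LinearMap.comp_apply, LinearEquiv.coe_coe] at this
      congr 1
      exact this.symm
    | succ n =>
      simp only [LinearMap.comp_apply, lam_inP, unc_inP_succ]
      rw [tensorCoact_lTensor, lTensor_lTensor_comm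
        (g' := (inP K H M n).lTensor M) (f' := cotIncl K H M n)
        (fun a => unc_inP_succ n a)]
      congr 1
      exact congr($(subtype_cotensorCoact (cotPow K H M n).coact) h)

lemma cotRetr_cotIncl (n : ℕ) (x : CotPow K H M (n + 1)) :
    cotRetr K H M n (cotIncl K H M n x) = x := congr($(retraction_comp_subtype _) x)

lemma rid_coactR (m : M) : TensorProduct.rid K M ((counit (R := K)).lTensor M
    (coactR (K := K) (H := H) m)) = m := congr($(counitR (K := K) (H := H)) m)

@[simp] lemma prH_ret (z : M ⊗[K] Cot K H M) : prH K H M (ret K H M z) = 0 := by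
  obtain ⟨N, hN⟩ := lTensor_exists_sum z
  rw [hN N le_rfl]
  simp [ret_inH, ret_inP, inM]

lemma ret_unc (x : Cot K H M) : inH K H M (prH K H M x) + ret K H M (unc K H M x) = x := by
  refine congr($(hom_ext (F := inH K H M ∘ₗ prH K H M + ret K H M ∘ₗ unc K H M)
    (G := LinearMap.id) ?_ ?_) x)
  · intro h; simp
  · intro n h
    cases n with
    | zero => simp [ret_inH, rid_coactR, inM]
    | succ n => simp [ret_inP, cotRetr_cotIncl]

lemma unc_ret_of_mem (z : M ⊗[K] Cot K H M) (hz : cotensorMap K H M (lam K H M) z = 0) :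
    unc K H M (ret K H M z) = z := by
  have h0 := cotensorMap_lTensor (lX := lam K H M) (lY := comul) (prH K H M)
    (fun x => (lTensor_prH_lam x).symm) z
  have hn := fun n => cotensorMap_lTensor (lX := lam K H M) (lY := (cotPow K H M n).coact)
    (prP K H M n) (fun x => (lTensor_prP_lam n x).symm) z
  simp only [hz, map_zero] at h0 hn
  refine lTensor_ext ?_ fun n => ?_
  · rw [lTensor_prH_unc]
    have e : prM K H M (ret K H M z)
        = TensorProduct.rid K M ((counit (R := K)).lTensor M ((prH K H M).lTensor M z)) := by
      obtain ⟨N, hN⟩ := lTensor_exists_sum z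
      conv_lhs => rw [hN N le_rfl]
      simp [ret_inH, ret_inP, inM, prM, prP_inP_ne]
    rw [e]
    generalize (prH K H M).lTensor M z = w at h0
    have h1 := congrArg (((TensorProduct.rid K H).toLinearMap ∘ₗ (counit (R := K)).lTensor H).lTensor M) h0
    simp only [cotensorMap, LinearMap.sub_apply, LinearMap.comp_apply, map_sub, map_zero,
      sub_eq_zero, LinearEquiv.coe_coe] at h1
    rw [lTensor_lTensor_comp (h := LinearMap.id) (fun a => by simp)] at h1
    rw [LinearMap.lTensor_id, LinearMap.id_apply] at h1
    refine Eq.trans ?_ h1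
    clear h1 h0
    induction w with
    | zero => simp
    | add a b ha hb => simp only [map_add, ha, hb]
    | tmul m x =>
      simp only [LinearMap.lTensor_tmul, LinearMap.rTensor_tmul, TensorProduct.rid_tmul, map_smul]
      induction coactR (K := K) (H := H) m with
      | zero => simp
      | add a b ha hb => simp only [TensorProduct.add_tmul, map_add, smul_add, ha, hb]
      | tmul a b => simp
  · rw [lTensor_prP_unc]
    have e : prP K H M (n + 1) (ret K H M z) = cotRetr K H M n ((prP K H M n).lTensor M z) := by
      obtain ⟨N, hN⟩ := lTensor_exists_sum z
      conv_lhs => rw [hN (max N (n + 1)) (le_max_left _ _)]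
      simp only [map_add, map_sum, ret_inH, ret_inP, inM, LinearMap.comp_apply]
      rw [Finset.sum_eq_single n (fun j _ hj => prP_inP_ne (by omega) _)
        (fun h => absurd (Finset.mem_range.2 (by omega)) h)]
      simp [prP_inP_ne]
    rw [e]
    have h1 : cotRetr K H M n ((prP K H M n).lTensor M z) = ⟨(prP K H M n).lTensor M z, hn n⟩ :=
      cotRetr_cotIncl n ⟨(prP K H M n).lTensor M z, hn n⟩
    rw [h1]
    rfl

/-- The image of `unc` is `M □_H Cot`, in a form stable under tensoring. -/
lemma exists_unc_ret : ∃ D' : M ⊗[K] (H ⊗[K] Cot K H M) →ₗ[K] M ⊗[K] Cot K H M,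
    ∀ z, unc K H M (ret K H M z) = z - D' (cotensorMap K H M (lam K H M) z) := by
  obtain ⟨D', h⟩ := exists_factor (cotensorMap K H M (lam K H M))
    (LinearMap.id - unc K H M ∘ₗ ret K H M) (fun z hz => by
      simp [unc_ret_of_mem z hz])
  exact ⟨D', fun z => by
    have := congr($h z)
    simp only [LinearMap.sub_apply, LinearMap.id_apply, LinearMap.comp_apply] at this
    rw [← this]; abel⟩

end Cot

/-! ### The comultiplication -/

namespace Cot

variable (K H M)

/-- The comultiplication on `M^{□(n+1)}`: writing an element as `m ⊗ x`, it is the sum of its left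
coaction and of `∑ (m ⊗ x₁) ⊗ x₂`, where `m ⊗ h` with `h ∈ H` stands for `ε(h) m`
(cf. `rTensor_prH_dlt` and `rTensor_unc_dlt`). -/
def dltP : ∀ n, CotPow K H M n →ₗ[K] Cot K H M ⊗[K] Cot K H M
  | 0 => (TensorProduct.map (inH K H M) (inM K H M) ∘ₗ coactL
        + TensorProduct.map (inM K H M) (inH K H M) ∘ₗ coactR) ∘ₗ (cotOne K H M).symm.toLinearMap
  | n + 1 => TensorProduct.map (inH K H M) (inP K H M (n + 1)) ∘ₗ (cotPow K H M (n + 1)).coact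
        + (ret K H M).rTensor (Cot K H M)
          ∘ₗ (TensorProduct.assoc K M (Cot K H M) (Cot K H M)).symm.toLinearMap
          ∘ₗ (dltP n).lTensor M ∘ₗ cotIncl K H M n

/-- The comultiplication of the cotensor coalgebra. -/
def dlt : Cot K H M →ₗ[K] Cot K H M ⊗[K] Cot K H M :=
  desc K H M (TensorProduct.map (inH K H M) (inH K H M) ∘ₗ comul) (dltP K H M)

/-- The counit of the cotensor coalgebra. -/
def eps : Cot K H M →ₗ[K] K := counit ∘ₗ prH K H M

variable {K H M}

lemma map_eq_rTensor_lTensor {A B C D : Type*} [AddCommMonoid A] [Module K A] [AddCommMonoid B]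
    [Module K B] [AddCommMonoid C] [Module K C] [AddCommMonoid D] [Module K D] (f : A →ₗ[K] B)
    (g : C →ₗ[K] D) (z : A ⊗[K] C) :
    TensorProduct.map f g z = f.rTensor D (g.lTensor A z) := by
  rw [← LinearMap.rTensor_comp_lTensor]; rfl

lemma assoc_symm_lTensor {A B C B' C' : Type*} [AddCommMonoid A] [Module K A] [AddCommMonoid B]
    [Module K B] [AddCommMonoid C] [Module K C] [AddCommMonoid B'] [Module K B'] [AddCommMonoid C']
    [Module K C'] (f : B →ₗ[K] B') (g : C →ₗ[K] C') (z : A ⊗[K] (B ⊗[K] C)) :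
    (TensorProduct.assoc K A B' C').symm ((TensorProduct.map f g).lTensor A z)
     = TensorProduct.map (f.lTensor A) g ((TensorProduct.assoc K A B C).symm z) := by
  refine congr($(show (TensorProduct.assoc K A B' C').symm.toLinearMap ∘ₗ
    (TensorProduct.map f g).lTensor A = TensorProduct.map (f.lTensor A) g ∘ₗ
      (TensorProduct.assoc K A B C).symm.toLinearMap by ext; simp) z)

lemma dlt_inH (h : H) : dlt K H M (inH K H M h)
    = TensorProduct.map (inH K H M) (inH K H M) (comul h) := desc_inH ..

lemma dlt_inP_zero (x : CotPow K H M 0) : dlt K H M (inP K H M 0 x)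
    = TensorProduct.map (inH K H M) (inM K H M) (coactL ((cotOne K H M).symm x))
      + TensorProduct.map (inM K H M) (inH K H M) (coactR ((cotOne K H M).symm x)) := desc_inP ..

lemma dlt_inM (m : M) : dlt K H M (inM K H M m)
    = TensorProduct.map (inH K H M) (inM K H M) (coactL m)
      + TensorProduct.map (inM K H M) (inH K H M) (coactR m) := dlt_inP_zero ..

lemma dlt_inP_succ (n : ℕ) (x : CotPow K H M (n + 1)) : dlt K H M (inP K H M (n + 1) x)
    = TensorProduct.map (inH K H M) (inP K H M (n + 1)) ((cotPow K H M (n + 1)).coact x)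
      + (ret K H M).rTensor (Cot K H M) ((TensorProduct.assoc K M (Cot K H M) (Cot K H M)).symm
        ((dltP K H M n).lTensor M (cotIncl K H M n x))) := desc_inP ..

lemma dlt_eq (x : Cot K H M) : dlt K H M x = (inH K H M).rTensor _ (lam K H M x)
    + (ret K H M).rTensor _ ((TensorProduct.assoc K M (Cot K H M) (Cot K H M)).symm
        ((dlt K H M).lTensor M (unc K H M x))) := by
  refine congr($(hom_ext (F := dlt K H M) (G := (inH K H M).rTensor _ ∘ₗ lam K H M
    + (ret K H M).rTensor _ ∘ₗ (TensorProduct.assoc K M (Cot K H M) (Cot K H M)).symm.toLinearMap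
      ∘ₗ (dlt K H M).lTensor M ∘ₗ unc K H M) ?_ ?_) x)
  · intro h
    simp [dlt_inH, map_eq_rTensor_lTensor]
  · intro n h
    cases n with
    | zero =>
      simp only [dlt_inP_zero, LinearMap.add_apply, LinearMap.comp_apply, lam_inP, unc_inP_zero,
        LinearEquiv.coe_coe]
      congr 1
      · rw [map_eq_rTensor_lTensor]
        rfl
      · have h1 : ∀ w : M ⊗[K] H, (dlt K H M).lTensor M ((inH K H M).lTensor M w)
          = (TensorProduct.map (inH K H M) (inH K H M)).lTensor M ((comul (R := K)).lTensor M w) :=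
          lTensor_lTensor_comm fun _ => dlt_inH _
        rw [h1, assoc_symm_lTensor]
        have h2 := congr($(coassocR (K := K) (H := H) (M := M)) ((cotOne K H M).symm h))
        simp only [LinearMap.comp_apply, LinearEquiv.coe_coe] at h2
        rw [← h2, LinearEquiv.symm_apply_apply]
        have h3 : ∀ w : M ⊗[K] H, (ret K H M).rTensor _ (TensorProduct.map ((inH K H M).lTensor M)
            (inH K H M) (coactR.rTensor H w)) = TensorProduct.map (inM K H M) (inH K H M) w := by
          intro w
          induction w with
          | zero => simp
          | add a b ha hb => simp only [map_add, ha, hb]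
          | tmul m h => simp [ret_inH, rid_coactR]
        exact (h3 _).symm
    | succ n =>
      simp only [dlt_inP_succ, LinearMap.add_apply, LinearMap.comp_apply, lam_inP, unc_inP_succ,
        LinearEquiv.coe_coe, map_eq_rTensor_lTensor]
      rw [lTensor_lTensor_comp (g := dlt K H M) (h := dltP K H M n) (fun _ => desc_inP ..)]

lemma rTensor_rTensor_comp {V A B C : Type*} [AddCommMonoid V] [Module K V] [AddCommMonoid A]
    [Module K A] [AddCommMonoid B] [Module K B] [AddCommMonoid C] [Module K C] {g : B →ₗ[K] C}
    {f : A →ₗ[K] B} {h : A →ₗ[K] C} (e : ∀ a, g (f a) = h a) (z : A ⊗[K] V) :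
    g.rTensor V (f.rTensor V z) = h.rTensor V z := by
  rw [← LinearMap.comp_apply, ← LinearMap.rTensor_comp, show g ∘ₗ f = h from LinearMap.ext e]

lemma rTensor_ret_unc {V : Type*} [AddCommGroup V] [Module K V] (z : Cot K H M ⊗[K] V) :
    (inH K H M).rTensor V ((prH K H M).rTensor V z)
      + (ret K H M).rTensor V ((unc K H M).rTensor V z) = z := by
  rw [rTensor_rTensor_comp (h := inH K H M ∘ₗ prH K H M) (fun _ => rfl),
    rTensor_rTensor_comp (h := ret K H M ∘ₗ unc K H M) (fun _ => rfl), ← LinearMap.add_apply,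
    ← LinearMap.rTensor_add, show inH K H M ∘ₗ prH K H M + ret K H M ∘ₗ unc K H M = LinearMap.id
      from LinearMap.ext ret_unc]
  simp

/-- The degree zero part of the comultiplication in the first factor is the left coaction. -/
lemma rTensor_prH_dlt (x : Cot K H M) : (prH K H M).rTensor _ (dlt K H M x) = lam K H M x := by
  rw [dlt_eq, map_add, rTensor_rTensor_comp (h := LinearMap.id) (fun _ => prH_inH _),
    rTensor_rTensor_comp (h := 0) (fun _ => prH_ret _)]
  simp

/-- `F` vanishes on the elements of degree at most `n`. -/
def Kills {Y : Type*} [AddCommGroup Y] [Module K Y] (n : ℕ) (F : Cot K H M →ₗ[K] Y) : Prop :=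
  (∀ h, F (inH K H M h) = 0) ∧ ∀ k < n, ∀ x, F (inP K H M k x) = 0

section Kills

variable {Y Z : Type*} [AddCommGroup Y] [Module K Y] [AddCommGroup Z] [Module K Z]

lemma Kills.comp {n : ℕ} {F : Cot K H M →ₗ[K] Y} (h : Kills n F) (G : Y →ₗ[K] Z) :
    Kills n (G ∘ₗ F) :=
  ⟨fun x => by simp [h.1], fun k hk x => by simp [h.2 k hk]⟩

lemma Kills.sub {n : ℕ} {F G : Cot K H M →ₗ[K] Y} (h : Kills n F) (h' : Kills n G) :
    Kills n (F - G) :=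
  ⟨fun x => by simp [h.1, h'.1], fun k hk x => by simp [h.2 k hk, h'.2 k hk]⟩

lemma Kills.unc {n : ℕ} {F : Cot K H M →ₗ[K] Y} (h : Kills n F) :
    Kills (n + 1) (F.lTensor M ∘ₗ unc K H M) := by
  refine ⟨fun x => by simp, fun k hk x => ?_⟩
  cases k with
  | zero =>
    simp only [LinearMap.comp_apply, unc_inP_zero]
    rw [lTensor_lTensor_comp (h := 0) (fun _ => h.1 _)]
    simp
  | succ k =>
    simp only [LinearMap.comp_apply, unc_inP_succ]
    rw [lTensor_lTensor_comp (h := 0) (fun _ => h.2 k (by omega) _)]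
    simp

lemma Kills.lam {n : ℕ} {F : Cot K H M →ₗ[K] Y} (h : Kills n F) :
    Kills n (F.lTensor H ∘ₗ lam K H M) := by
  refine ⟨fun x => ?_, fun k hk x => ?_⟩
  · simp only [LinearMap.comp_apply, lam_inH]
    rw [lTensor_lTensor_comp (h := 0) (fun _ => h.1 _)]
    simp
  · simp only [LinearMap.comp_apply, lam_inP]
    rw [lTensor_lTensor_comp (h := 0) (fun _ => h.2 k hk _)]
    simp

lemma kills_zero_unc (F : M ⊗[K] Cot K H M →ₗ[K] Y) : Kills 0 (F ∘ₗ unc K H M) :=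
  ⟨fun x => by simp, fun k hk => by omega⟩

lemma eq_zero_of_kills {F : Cot K H M →ₗ[K] Y} (h : ∀ n, Kills n F) : F = 0 :=
  hom_ext (fun x => (h 0).1 x) (fun n x => (h (n + 1)).2 n (by omega) x)

lemma eq_zero_of_fix {F : Cot K H M →ₗ[K] Y} (G : M ⊗[K] Y →ₗ[K] Y)
    (h : ∀ x, F x = G (F.lTensor M (Cot.unc K H M x))) : F = 0 := by
  have e : F = G ∘ₗ F.lTensor M ∘ₗ Cot.unc K H M := LinearMap.ext h
  refine eq_zero_of_kills fun n => ?_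
  induction n with
  | zero => rw [e, ← LinearMap.comp_assoc]; exact kills_zero_unc _
  | succ n ih => rw [e]; exact ih.unc.comp G

end Kills

variable (K H M) in
/-- The defect of `dlt` being left colinear; it vanishes. -/
def colDef : Cot K H M →ₗ[K] H ⊗[K] (Cot K H M ⊗[K] Cot K H M) :=
  (TensorProduct.assoc K H _ _).toLinearMap ∘ₗ (lam K H M).rTensor _ ∘ₗ dlt K H M
    - (dlt K H M).lTensor H ∘ₗ lam K H M

variable (K H M) in
/-- The defect of the compatibility of `dlt` and `unc`; it vanishes. -/
def uncDef : Cot K H M →ₗ[K] M ⊗[K] (Cot K H M ⊗[K] Cot K H M) :=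
  (TensorProduct.assoc K M _ _).toLinearMap ∘ₗ (unc K H M).rTensor _ ∘ₗ dlt K H M
    - (dlt K H M).lTensor M ∘ₗ unc K H M

lemma uncDef_eq : ∃ G : M ⊗[K] (H ⊗[K] (Cot K H M ⊗[K] Cot K H M)) →ₗ[K]
      M ⊗[K] (Cot K H M ⊗[K] Cot K H M),
    uncDef K H M = G ∘ₗ (colDef K H M).lTensor M ∘ₗ unc K H M := by
  obtain ⟨D', hD⟩ := exists_unc_ret (K := K) (H := H) (M := M)
  let a : (M ⊗[K] (H ⊗[K] Cot K H M)) ⊗[K] Cot K H M ≃ₗ[K]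
      M ⊗[K] (H ⊗[K] (Cot K H M ⊗[K] Cot K H M)) :=
    TensorProduct.assoc K M (H ⊗[K] Cot K H M) (Cot K H M) ≪≫ₗ
      (TensorProduct.assoc K H (Cot K H M) (Cot K H M)).lTensor M
  have key : ∀ z : M ⊗[K] Cot K H M, a ((cotensorMap K H M (lam K H M)).rTensor _
      ((TensorProduct.assoc K M _ _).symm ((dlt K H M).lTensor M z)))
      = ((dlt K H M).lTensor H).lTensor M (cotensorMap K H M (lam K H M) z)
        - (colDef K H M).lTensor M z := by
    intro z
    induction z with
    | zero => simp
    | add a b ha hb => simp only [map_add, ha, hb]; abel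
    | tmul m x =>
      have h1 : ∀ w : Cot K H M ⊗[K] Cot K H M, a ((cotensorMap K H M (lam K H M)).rTensor _
          ((TensorProduct.assoc K M _ _).symm (m ⊗ₜ[K] w)))
          = TensorProduct.assoc K M H _ (coactR m ⊗ₜ[K] w)
            - m ⊗ₜ TensorProduct.assoc K H _ _ ((lam K H M).rTensor _ w) := by
        intro w
        induction w with
        | zero => simp
        | add a b ha hb => simp only [TensorProduct.tmul_add, map_add, ha, hb]; abel
        | tmul x y =>
          simp only [TensorProduct.assoc_symm_tmul, LinearMap.rTensor_tmul, cotensorMap,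
            LinearMap.sub_apply, TensorProduct.sub_tmul, map_sub, LinearMap.comp_apply,
            LinearEquiv.coe_coe, LinearMap.lTensor_tmul]
          congr 1
          induction coactR (K := K) (H := H) m with
          | zero => simp
          | add a b ha hb => simp only [TensorProduct.add_tmul, map_add, ha, hb]
          | tmul p q => simp [a]
      have h2 : ∀ v : M ⊗[K] H, ((dlt K H M).lTensor H).lTensor M
          (TensorProduct.assoc K M H _ (v ⊗ₜ x)) = TensorProduct.assoc K M H _ (v ⊗ₜ dlt K H M x) := by
        intro v
        induction v with
        | zero => simp
        | add a b ha hb => simp only [TensorProduct.add_tmul, map_add, ha, hb]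
        | tmul p q => simp
      rw [LinearMap.lTensor_tmul, h1]
      simp only [cotensorMap, LinearMap.sub_apply, LinearMap.comp_apply, LinearMap.rTensor_tmul,
        LinearEquiv.coe_coe, LinearMap.lTensor_tmul, map_sub, h2, colDef, TensorProduct.tmul_sub]
      abel
  refine ⟨(TensorProduct.assoc K M _ _).toLinearMap ∘ₗ D'.rTensor _ ∘ₗ a.symm.toLinearMap,
    LinearMap.ext fun x => ?_⟩
  have h0 := key (unc K H M x)
  rw [cotensorMap_unc, map_zero, zero_sub, ← LinearEquiv.eq_symm_apply, map_neg] at h0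
  have h1 : ∀ w : (M ⊗[K] Cot K H M) ⊗[K] Cot K H M,
      (unc K H M).rTensor _ ((ret K H M).rTensor _ w)
      = w - D'.rTensor _ ((cotensorMap K H M (lam K H M)).rTensor _ w) := by
    intro w
    rw [rTensor_rTensor_comp (h := LinearMap.id - D' ∘ₗ cotensorMap K H M (lam K H M))
      (fun z => by simp [hD]), LinearMap.rTensor_sub, LinearMap.rTensor_comp]
    simp
  simp only [uncDef, LinearMap.sub_apply, LinearMap.comp_apply, LinearEquiv.coe_coe]
  rw [dlt_eq, map_add, h1, rTensor_rTensor_comp (h := 0) (fun _ => unc_inH _)]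
  simp only [LinearMap.rTensor_zero, LinearMap.zero_apply, zero_add, map_sub,
    LinearEquiv.apply_symm_apply, h0, map_neg]
  abel

lemma assoc_unc_lam (y : Cot K H M ⊗[K] Cot K H M) :
    (TensorProduct.assoc K M _ _).toLinearMap.lTensor H (((unc K H M).rTensor _).lTensor H
      (TensorProduct.assoc K H _ _ ((lam K H M).rTensor _ y)))
    = tensorCoact _ (TensorProduct.assoc K M _ _ ((unc K H M).rTensor _ y)) := by
  induction y with
  | zero => simp
  | add a b ha hb => simp only [map_add, ha, hb]
  | tmul x y =>
    have h1 : ∀ v : H ⊗[K] Cot K H M, ((unc K H M).rTensor _).lTensor H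
        (TensorProduct.assoc K H _ (Cot K H M) (v ⊗ₜ y))
        = TensorProduct.assoc K H _ _ ((unc K H M).lTensor H v ⊗ₜ y) := by
      intro v
      induction v with
      | zero => simp
      | add a b ha hb => simp only [TensorProduct.add_tmul, map_add, ha, hb]
      | tmul p q => simp
    have h2 : ∀ z : M ⊗[K] Cot K H M, (TensorProduct.assoc K M _ _).toLinearMap.lTensor H
        (TensorProduct.assoc K H _ _ (tensorCoact (H := H) _ z ⊗ₜ y))
        = tensorCoact _ (TensorProduct.assoc K M _ _ (z ⊗ₜ y)) := by
      intro z
      induction z with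
      | zero => simp
      | add a b ha hb => simp only [TensorProduct.add_tmul, map_add, ha, hb]
      | tmul m x =>
        simp only [tensorCoact_tmul, TensorProduct.assoc_tmul]
        induction coactL (K := K) (H := H) m with
        | zero => simp
        | add a b ha hb => simp only [TensorProduct.add_tmul, map_add, ha, hb]
        | tmul p q => simp
    simp only [LinearMap.rTensor_tmul]
    rw [h1, lTensor_unc_lam, h2]

lemma assoc_prH_lam (y : Cot K H M ⊗[K] Cot K H M) :
    ((prH K H M).rTensor _).lTensor H (TensorProduct.assoc K H _ _ ((lam K H M).rTensor _ y))
    = TensorProduct.assoc K H H _ ((comul (R := K)).rTensor _ ((prH K H M).rTensor _ y)) := by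
  induction y with
  | zero => simp
  | add a b ha hb => simp only [map_add, ha, hb]
  | tmul x y =>
    simp only [LinearMap.rTensor_tmul, ← lTensor_prH_lam]
    induction lam K H M x with
    | zero => simp
    | add a b ha hb => simp only [TensorProduct.add_tmul, map_add, ha, hb]
    | tmul p q => simp

lemma colDef_eq : ∃ G : H ⊗[K] (M ⊗[K] (Cot K H M ⊗[K] Cot K H M)) →ₗ[K]
      H ⊗[K] (Cot K H M ⊗[K] Cot K H M),
    colDef K H M = G ∘ₗ (tensorCoact _ ∘ₗ uncDef K H M
      - (uncDef K H M).lTensor H ∘ₗ lam K H M) := by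
  refine ⟨((ret K H M).rTensor _).lTensor H ∘ₗ
    (TensorProduct.assoc K M _ _).symm.toLinearMap.lTensor H, LinearMap.ext fun x => ?_⟩
  have h1 : ((prH K H M).rTensor _).lTensor H (colDef K H M x) = 0 := by
    simp only [colDef, LinearMap.sub_apply, map_sub, LinearMap.comp_apply, LinearEquiv.coe_coe]
    rw [assoc_prH_lam, rTensor_prH_dlt, lam_coassoc,
      lTensor_lTensor_comp (h := lam K H M) (fun _ => rTensor_prH_dlt _), sub_self]
  have h2 : (TensorProduct.assoc K M _ _).toLinearMap.lTensor H (((unc K H M).rTensor _).lTensor H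
      (colDef K H M x)) = tensorCoact _ (uncDef K H M x)
        - (uncDef K H M).lTensor H (lam K H M x) := by
    have e : ∀ w : H ⊗[K] Cot K H M, (TensorProduct.assoc K M _ _).toLinearMap.lTensor H
        (((unc K H M).rTensor _).lTensor H ((dlt K H M).lTensor H w))
        = (uncDef K H M).lTensor H w
          + ((dlt K H M).lTensor M).lTensor H ((unc K H M).lTensor H w) := by
      intro w
      induction w with
      | zero => simp
      | add a b ha hb => simp only [map_add, ha, hb]; abel
      | tmul a b => simp [uncDef]
    simp only [colDef, LinearMap.sub_apply, map_sub, LinearMap.comp_apply, LinearEquiv.coe_coe]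
    rw [assoc_unc_lam, e, lTensor_unc_lam, ← tensorCoact_lTensor]
    simp only [uncDef, LinearMap.sub_apply, map_sub, LinearMap.comp_apply, LinearEquiv.coe_coe]
    abel
  have e4 : ∀ w : H ⊗[K] (Cot K H M ⊗[K] Cot K H M),
      ((inH K H M).rTensor _).lTensor H (((prH K H M).rTensor _).lTensor H w)
      + ((ret K H M).rTensor _).lTensor H (((unc K H M).rTensor _).lTensor H w) = w := by
    intro w
    induction w with
    | zero => simp
    | add a b ha hb => conv_rhs => rw [← ha, ← hb]
                       simp only [map_add]; abel
    | tmul a b => simp only [LinearMap.lTensor_tmul, ← TensorProduct.tmul_add, rTensor_ret_unc]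
  have h4 := e4 (colDef K H M x)
  rw [h1, map_zero, zero_add] at h4
  simp only [LinearMap.comp_apply, LinearMap.sub_apply]
  rw [← h2, lTensor_lTensor_comp (h := LinearMap.id) (fun _ => by simp)]
  simp [h4]

lemma kills_uncDef : ∀ n, Kills n (uncDef K H M) := by
  obtain ⟨G, hG⟩ := uncDef_eq (K := K) (H := H) (M := M)
  obtain ⟨G', hG'⟩ := colDef_eq (K := K) (H := H) (M := M)
  intro n
  induction n with
  | zero => rw [hG, ← LinearMap.comp_assoc]; exact kills_zero_unc _
  | succ n ih =>
    rw [hG]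
    refine (Kills.unc ?_).comp G
    rw [hG']
    exact ((ih.comp _).sub ih.lam).comp G'

lemma uncDef_eq_zero : uncDef K H M = 0 := eq_zero_of_kills kills_uncDef

lemma colDef_eq_zero : colDef K H M = 0 := by
  obtain ⟨G, hG⟩ := colDef_eq (K := K) (H := H) (M := M)
  refine eq_zero_of_kills fun n => ?_
  rw [hG]
  exact (((kills_uncDef n).comp _).sub (kills_uncDef n).lam).comp G

lemma rTensor_unc_dlt (x : Cot K H M) : TensorProduct.assoc K M _ _ ((unc K H M).rTensor _
    (dlt K H M x)) = (dlt K H M).lTensor M (unc K H M x) :=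
  sub_eq_zero.1 congr($uncDef_eq_zero x)

lemma rTensor_lam_dlt (x : Cot K H M) : TensorProduct.assoc K H _ _ ((lam K H M).rTensor _
    (dlt K H M x)) = (dlt K H M).lTensor H (lam K H M x) :=
  sub_eq_zero.1 congr($colDef_eq_zero x)

lemma assoc_rTensor_rTensor {A A' B C : Type*} [AddCommMonoid A] [Module K A] [AddCommMonoid A']
    [Module K A'] [AddCommMonoid B] [Module K B] [AddCommMonoid C] [Module K C] (f : A →ₗ[K] A')
    (z : (A ⊗[K] B) ⊗[K] C) : f.rTensor _ (TensorProduct.assoc K A B C z)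
      = TensorProduct.assoc K A' B C ((f.rTensor B).rTensor C z) := by
  refine congr($(show f.rTensor _ ∘ₗ (TensorProduct.assoc K A B C).toLinearMap =
    (TensorProduct.assoc K A' B C).toLinearMap ∘ₗ (f.rTensor B).rTensor C by ext; simp) z)

lemma rTensor_lTensor_swap {A A' B B' : Type*} [AddCommMonoid A] [Module K A] [AddCommMonoid A']
    [Module K A'] [AddCommMonoid B] [Module K B] [AddCommMonoid B'] [Module K B'] (f : A →ₗ[K] A')
    (g : B →ₗ[K] B') (z : A ⊗[K] B) : f.rTensor B' (g.lTensor A z) = g.lTensor A' (f.rTensor B z) := by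
  rw [← LinearMap.comp_apply, ← LinearMap.comp_apply, LinearMap.rTensor_comp_lTensor,
    LinearMap.lTensor_comp_rTensor]

lemma assoc_dlt_dlt (x : Cot K H M) : TensorProduct.assoc K _ _ _ ((dlt K H M).rTensor _
    (dlt K H M x)) = (dlt K H M).lTensor _ (dlt K H M x) := by
  let F : Cot K H M →ₗ[K] Cot K H M ⊗[K] (Cot K H M ⊗[K] Cot K H M) :=
    (TensorProduct.assoc K _ _ _).toLinearMap ∘ₗ (dlt K H M).rTensor _ ∘ₗ dlt K H M
      - (dlt K H M).lTensor _ ∘ₗ dlt K H M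
  suffices h : F = 0 from sub_eq_zero.1 congr($h x)
  refine eq_zero_of_fix ((ret K H M).rTensor _ ∘ₗ (TensorProduct.assoc K M _ _).symm.toLinearMap)
    fun x => ?_
  have h1 : (prH K H M).rTensor _ (F x) = 0 := by
    simp only [F, LinearMap.sub_apply, map_sub, LinearMap.comp_apply, LinearEquiv.coe_coe]
    rw [assoc_rTensor_rTensor, rTensor_rTensor_comp (h := lam K H M) (fun _ => rTensor_prH_dlt _),
      rTensor_lTensor_swap, rTensor_prH_dlt, rTensor_lam_dlt, sub_self]
  have h2 : TensorProduct.assoc K M _ _ ((unc K H M).rTensor _ (F x))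
      = F.lTensor M (unc K H M x) := by
    have e1 : ∀ y : Cot K H M ⊗[K] Cot K H M, TensorProduct.assoc K M _ _
        ((unc K H M).rTensor _ (TensorProduct.assoc K _ _ _ ((dlt K H M).rTensor _ y)))
        = ((TensorProduct.assoc K _ _ _).toLinearMap ∘ₗ (dlt K H M).rTensor _).lTensor M
          (TensorProduct.assoc K M _ _ ((unc K H M).rTensor _ y)) := by
      intro y
      induction y with
      | zero => simp
      | add a b ha hb => simp only [map_add, ha, hb]
      | tmul x y =>
        have h1 : ∀ z : Cot K H M ⊗[K] Cot K H M, TensorProduct.assoc K M _ _ ((unc K H M).rTensor _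
            (TensorProduct.assoc K _ _ (Cot K H M) (z ⊗ₜ y)))
            = (TensorProduct.assoc K _ _ _).toLinearMap.lTensor M (TensorProduct.assoc K M _ _
              (TensorProduct.assoc K M _ _ ((unc K H M).rTensor _ z) ⊗ₜ y)) := by
          intro z
          induction z with
          | zero => simp
          | add a b ha hb => simp only [TensorProduct.add_tmul, map_add, ha, hb]
          | tmul p q =>
            simp only [LinearMap.rTensor_tmul, TensorProduct.assoc_tmul]
            induction unc K H M p with
            | zero => simp
            | add a b ha hb => simp only [TensorProduct.add_tmul, map_add, ha, hb]
            | tmul p q => simp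
        simp only [LinearMap.rTensor_tmul]
        rw [h1, rTensor_unc_dlt]
        induction unc K H M x with
        | zero => simp
        | add a b ha hb => simp only [TensorProduct.add_tmul, map_add, ha, hb]
        | tmul p q => simp
    have e2 : ∀ y : Cot K H M ⊗[K] Cot K H M, TensorProduct.assoc K M _ _
        ((unc K H M).rTensor _ ((dlt K H M).lTensor _ y))
        = ((dlt K H M).lTensor _).lTensor M (TensorProduct.assoc K M _ _
          ((unc K H M).rTensor _ y)) := by
      intro y
      rw [rTensor_lTensor_swap]
      generalize (unc K H M).rTensor _ y = w
      refine congr($(show (TensorProduct.assoc K M _ _).toLinearMap ∘ₗ (dlt K H M).lTensor _ =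
        ((dlt K H M).lTensor _).lTensor M ∘ₗ (TensorProduct.assoc K M _ _).toLinearMap by
          ext; simp) w)
    have e3 : ∀ z : M ⊗[K] Cot K H M, F.lTensor M z =
        ((TensorProduct.assoc K _ _ _).toLinearMap ∘ₗ (dlt K H M).rTensor _).lTensor M
          ((dlt K H M).lTensor M z) - ((dlt K H M).lTensor _).lTensor M ((dlt K H M).lTensor M z) := by
      intro z
      rw [← LinearMap.sub_apply, ← LinearMap.lTensor_sub, lTensor_lTensor_comp (h := F)
        (fun _ => rfl)]
    rw [e3, ← rTensor_unc_dlt, ← e1, ← e2]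
    simp [F]
  have h3 := rTensor_ret_unc (F x)
  rw [h1, map_zero, zero_add] at h3
  rw [← h2]
  simp [h3]

lemma counit_dlt_left (x : Cot K H M) :
    TensorProduct.lid K _ ((eps K H M).rTensor _ (dlt K H M x)) = x := by
  rw [eps, ← rTensor_rTensor_comp (f := prH K H M) (g := counit) (fun _ => rfl), rTensor_prH_dlt,
    lam_counit]

lemma rid_lTensor_rTensor {A X Y : Type*} [AddCommMonoid A] [Module K A] [AddCommMonoid X]
    [Module K X] [AddCommMonoid Y] [Module K Y] (e : A →ₗ[K] K) (f : X →ₗ[K] Y) (w : X ⊗[K] A) :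
    f (TensorProduct.rid K X (e.lTensor X w))
      = TensorProduct.rid K Y (e.lTensor Y (f.rTensor A w)) := by
  induction w with
  | zero => simp
  | add a b ha hb => simp only [map_add, ha, hb]
  | tmul a b => simp

lemma counit_dlt_right (x : Cot K H M) :
    TensorProduct.rid K _ ((eps K H M).lTensor _ (dlt K H M x)) = x := by
  let F : Cot K H M →ₗ[K] Cot K H M :=
    (TensorProduct.rid K _).toLinearMap ∘ₗ (eps K H M).lTensor _ ∘ₗ dlt K H M - LinearMap.id
  suffices h : F = 0 from sub_eq_zero.1 congr($h x)
  refine eq_zero_of_fix (ret K H M) fun x => ?_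
  have h1 : prH K H M (F x) = 0 := by
    simp only [F, LinearMap.sub_apply, map_sub, LinearMap.comp_apply, LinearEquiv.coe_coe]
    rw [rid_lTensor_rTensor, rTensor_prH_dlt, eps, ← lTensor_lTensor_comp (f := prH K H M)
      (g := counit) (fun _ => rfl), lTensor_prH_lam]
    simp
  have h2 : unc K H M (F x) = F.lTensor M (unc K H M x) := by
    have e : ∀ w : (M ⊗[K] Cot K H M) ⊗[K] Cot K H M,
        TensorProduct.rid K _ ((eps K H M).lTensor _ w) =
        ((TensorProduct.rid K _).toLinearMap ∘ₗ (eps K H M).lTensor _).lTensor M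
          (TensorProduct.assoc K M _ _ w) := by
      intro w
      refine congr($(show (TensorProduct.rid K _).toLinearMap ∘ₗ (eps K H M).lTensor _ =
        ((TensorProduct.rid K _).toLinearMap ∘ₗ (eps K H M).lTensor _).lTensor M ∘ₗ
          (TensorProduct.assoc K M _ _).toLinearMap by ext; simp) w)
    have e' : unc K H M (F x) = TensorProduct.rid K _ ((eps K H M).lTensor _
        ((unc K H M).rTensor _ (dlt K H M x))) - unc K H M x := by
      simp only [F, LinearMap.sub_apply, map_sub, LinearMap.comp_apply, LinearEquiv.coe_coe]
      rw [rid_lTensor_rTensor]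
      simp
    rw [e', e, rTensor_unc_dlt]
    simp only [F, LinearMap.lTensor_sub, LinearMap.sub_apply, LinearMap.lTensor_id,
      LinearMap.lTensor_comp, LinearMap.comp_apply, LinearMap.id_apply]
  have h3 := ret_unc (F x)
  rw [h1, map_zero, zero_add] at h3
  rw [← h2, h3]

instance : Coalgebra K (Cot K H M) where
  comul := dlt K H M
  counit := eps K H M
  coassoc := LinearMap.ext assoc_dlt_dlt
  rTensor_counit_comp_comul := LinearMap.ext fun x => by
    apply (TensorProduct.lid K _).injective
    simpa using counit_dlt_left x
  lTensor_counit_comp_comul := LinearMap.ext fun x => by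
    apply (TensorProduct.rid K _).injective
    simpa using counit_dlt_right x

lemma comul_eq (x : Cot K H M) : comul x = dlt K H M x := rfl
lemma counit_eq (x : Cot K H M) : counit x = eps K H M x := rfl

end Cot

/-! ### The universal property and the multiplication -/

namespace Cot

lemma eps_lTensor_unc (x : Cot K H M) :
    TensorProduct.rid K M ((eps K H M).lTensor M (unc K H M x)) = prM K H M x := by
  rw [eps, ← lTensor_lTensor_comp (f := prH K H M) (g := counit) (fun _ => rfl), lTensor_prH_unc,
    rid_coactR]

/-- The degree one part of the comultiplication in the first factor is `unc`. -/
lemma rTensor_prM_dlt (x : Cot K H M) : (prM K H M).rTensor _ (dlt K H M x) = unc K H M x := by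
  rw [← rTensor_rTensor_comp (f := unc K H M) (g := (TensorProduct.rid K M).toLinearMap ∘ₗ
    (eps K H M).lTensor M) eps_lTensor_unc]
  have e : ∀ w : (M ⊗[K] Cot K H M) ⊗[K] Cot K H M,
      ((TensorProduct.rid K M).toLinearMap ∘ₗ (eps K H M).lTensor M).rTensor _ w
      = ((TensorProduct.lid K _).toLinearMap ∘ₗ (eps K H M).rTensor _).lTensor M
        (TensorProduct.assoc K M _ _ w) := by
    intro w
    refine congr($(show ((TensorProduct.rid K M).toLinearMap ∘ₗ (eps K H M).lTensor M).rTensor _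
      = ((TensorProduct.lid K _).toLinearMap ∘ₗ (eps K H M).rTensor _).lTensor M ∘ₗ
        (TensorProduct.assoc K M _ _).toLinearMap by
          ext; simp [TensorProduct.smul_tmul']) w)
  rw [e, rTensor_unc_dlt, lTensor_lTensor_comp (h := LinearMap.id) (fun x => counit_dlt_left x)]
  simp

lemma map_prH_prH_dlt (x : Cot K H M) :
    TensorProduct.map (prH K H M) (prH K H M) (dlt K H M x) = comul (prH K H M x) := by
  rw [map_eq_rTensor_lTensor, rTensor_lTensor_swap, rTensor_prH_dlt, lTensor_prH_lam]

lemma lTensor_prM_lam (x : Cot K H M) :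
    (prM K H M).lTensor H (lam K H M x) = coactL (prM K H M x) := by
  exact lTensor_prP_lam 0 x

lemma map_prH_prM_dlt (x : Cot K H M) :
    TensorProduct.map (prH K H M) (prM K H M) (dlt K H M x) = coactL (prM K H M x) := by
  rw [map_eq_rTensor_lTensor, rTensor_lTensor_swap, rTensor_prH_dlt, lTensor_prM_lam]

lemma map_prM_prH_dlt (x : Cot K H M) :
    TensorProduct.map (prM K H M) (prH K H M) (dlt K H M x) = coactR (prM K H M x) := by
  rw [map_eq_rTensor_lTensor, rTensor_lTensor_swap, rTensor_prM_dlt, lTensor_prH_unc]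

lemma cotIncl_injective (n : ℕ) : Function.Injective (cotIncl K H M n) :=
  Function.LeftInverse.injective (cotRetr_cotIncl n)

section Lift

variable {C : Type*} [AddCommGroup C] [Module K C] [Coalgebra K C]

/-- A linear map into `Cot` with given components. -/
def ofComponents (f₀ : C →ₗ[K] H) (g : ∀ n, C →ₗ[K] CotPow K H M n)
    (hg : ∀ c, ∃ N, ∀ n, N ≤ n → g n c = 0) : C →ₗ[K] Cot K H M :=
  have hP : ∀ c n, prP K H M n (inH K H M (f₀ c)
      + ∑ k ∈ Finset.range (hg c).choose, inP K H M k (g k c)) = g n c := by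
    intro c n
    simp only [map_add, map_sum, prP_inH, zero_add]
    by_cases hn : n < (hg c).choose
    · rw [Finset.sum_eq_single n (fun j _ hj => prP_inP_ne hj.symm _)
        (fun h => absurd (Finset.mem_range.2 hn) h), prP_inP]
    · rw [Finset.sum_eq_zero fun j hj => prP_inP_ne (by rw [Finset.mem_range] at hj; omega) _,
        (hg c).choose_spec n (by omega)]
  { toFun := fun c => inH K H M (f₀ c)
      + ∑ k ∈ Finset.range (hg c).choose, inP K H M k (g k c)
    map_add' := fun a b => by
      refine ext' (by simp) fun n => (hP _ n).trans ?_
      rw [map_add (prP K H M n), hP, hP, map_add]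
    map_smul' := fun a b => by
      refine ext' (by simp) fun n => (hP _ n).trans ?_
      rw [map_smul (prP K H M n), hP, map_smul, RingHom.id_apply] }

lemma prH_ofComponents (f₀ : C →ₗ[K] H) (g : ∀ n, C →ₗ[K] CotPow K H M n)
    (hg : ∀ c, ∃ N, ∀ n, N ≤ n → g n c = 0) (c : C) :
    prH K H M (ofComponents f₀ g hg c) = f₀ c := by
  simp [ofComponents]

lemma prP_ofComponents (f₀ : C →ₗ[K] H) (g : ∀ n, C →ₗ[K] CotPow K H M n)
    (hg : ∀ c, ∃ N, ∀ n, N ≤ n → g n c = 0) (n : ℕ) (c : C) :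
    prP K H M n (ofComponents f₀ g hg c) = g n c := by
  simp only [ofComponents, LinearMap.coe_mk, AddHom.coe_mk, map_add, map_sum, prP_inH, zero_add]
  by_cases hn : n < (hg c).choose
  · rw [Finset.sum_eq_single n (fun j _ hj => prP_inP_ne hj.symm _)
      (fun h => absurd (Finset.mem_range.2 hn) h), prP_inP]
  · rw [Finset.sum_eq_zero fun j hj => prP_inP_ne (by rw [Finset.mem_range] at hj; omega) _,
      (hg c).choose_spec n (by omega)]

/-- The components `C → C^{⊗(n+1)} → M^{□(n+1)}` of the map to the cotensor coalgebra induced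
by `f₁ : C → M`; see `cotIncl_liftP`. -/
def liftP (f₁ : C →ₗ[K] M) : ∀ n, C →ₗ[K] CotPow K H M n
  | 0 => (cotOne K H M).toLinearMap ∘ₗ f₁
  | n + 1 => cotRetr K H M n ∘ₗ TensorProduct.map f₁ (liftP f₁ n) ∘ₗ comul

/-- `f₀` is a morphism of coalgebras and `f₁` a morphism of bicomodules along `f₀`. -/
structure IsBicomoduleMap (f₀ : C →ₗ[K] H) (f₁ : C →ₗ[K] M) : Prop where
  comul_map : ∀ c, comul (f₀ c) = TensorProduct.map f₀ f₀ (comul (R := K) c)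
  counit_map : ∀ c, counit (R := K) (f₀ c) = counit (R := K) c
  coactL_map : ∀ c, coactL (f₁ c) = TensorProduct.map f₀ f₁ (comul (R := K) c)
  coactR_map : ∀ c, coactR (f₁ c) = TensorProduct.map f₁ f₀ (comul (R := K) c)

variable {f₀ : C →ₗ[K] H} {f₁ : C →ₗ[K] M}

lemma map_map_comul {A B D : Type*} [AddCommGroup A] [Module K A] [AddCommGroup B] [Module K B]
    [AddCommGroup D] [Module K D] (f : C →ₗ[K] A) (g : C →ₗ[K] B) (h : C →ₗ[K] D) (c : C) :
    TensorProduct.assoc K A B D (TensorProduct.map (TensorProduct.map f g ∘ₗ comul) h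
      (comul (R := K) c)) = TensorProduct.map f (TensorProduct.map g h ∘ₗ comul) (comul (R := K) c) := by
  have h1 : ∀ z : C ⊗[K] C, TensorProduct.assoc K A B D
      (TensorProduct.map (TensorProduct.map f g ∘ₗ comul) h z)
      = TensorProduct.map f (TensorProduct.map g h)
        (TensorProduct.assoc K C C C ((comul (R := K)).rTensor C z)) := by
    intro z
    induction z with
    | zero => simp
    | add a b ha hb => simp only [map_add, ha, hb]
    | tmul x y =>
      simp only [TensorProduct.map_tmul, LinearMap.comp_apply, LinearMap.rTensor_tmul]
      induction comul (R := K) x with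
      | zero => simp
      | add a b ha hb => simp only [TensorProduct.add_tmul, map_add, ha, hb]
      | tmul p q => simp
  have h2 : ∀ z : C ⊗[K] C, TensorProduct.map f (TensorProduct.map g h ∘ₗ comul) z
      = TensorProduct.map f (TensorProduct.map g h) ((comul (R := K)).lTensor C z) := by
    intro z
    induction z with
    | zero => simp
    | add a b ha hb => simp only [map_add, ha, hb]
    | tmul x y => simp
  rw [h1, h2, Coalgebra.coassoc_apply]

lemma lTensor_map {A A' B B' : Type*} [AddCommMonoid A] [Module K A] [AddCommMonoid A']
    [Module K A'] [AddCommMonoid B] [Module K B] [AddCommMonoid B'] [Module K B']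
    {D : Type*} [AddCommMonoid D] [Module K D] {g : A →ₗ[K] A'}
    {f : B →ₗ[K] A} {h : B →ₗ[K] A'} (e : ∀ b, g (f b) = h b) (p : D →ₗ[K] B') (z : D ⊗[K] B) :
    g.lTensor B' (TensorProduct.map p f z) = TensorProduct.map p h z := by
  rw [map_eq_rTensor_lTensor, ← rTensor_lTensor_swap, lTensor_lTensor_comp e,
    ← map_eq_rTensor_lTensor]

lemma rTensor_map {A A' B B' : Type*} [AddCommMonoid A] [Module K A] [AddCommMonoid A']
    [Module K A'] [AddCommMonoid B] [Module K B] [AddCommMonoid B'] [Module K B']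
    {D : Type*} [AddCommMonoid D] [Module K D] {g : A →ₗ[K] A'}
    {f : B →ₗ[K] A} {h : B →ₗ[K] A'} (e : ∀ b, g (f b) = h b) (p : D →ₗ[K] B') (z : B ⊗[K] D) :
    g.rTensor B' (TensorProduct.map f p z) = TensorProduct.map h p z := by
  rw [map_eq_rTensor_lTensor, rTensor_rTensor_comp e, ← map_eq_rTensor_lTensor]

lemma tensorCoact_map (hf : IsBicomoduleMap f₀ f₁) {X : Type*} [AddCommGroup X] [Module K X]
    (g : C →ₗ[K] X) (c : C) : tensorCoact X (TensorProduct.map f₁ g (comul (R := K) c))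
      = TensorProduct.map f₀ (TensorProduct.map f₁ g ∘ₗ comul) (comul (R := K) c) := by
  rw [← map_map_comul]
  simp only [tensorCoact, LinearMap.comp_apply, LinearEquiv.coe_coe]
  rw [rTensor_map (h := TensorProduct.map f₀ f₁ ∘ₗ comul) (fun c => hf.coactL_map c)]

lemma cotensorMap_map (hf : IsBicomoduleMap f₀ f₁) {X : Type*} [AddCommGroup X] [Module K X]
    (g : C →ₗ[K] X) (l : X →ₗ[K] H ⊗[K] X)
    (hl : ∀ c, l (g c) = TensorProduct.map f₀ g (comul (R := K) c)) (c : C) :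
    cotensorMap K H M l (TensorProduct.map f₁ g (comul (R := K) c)) = 0 := by
  simp only [cotensorMap, LinearMap.sub_apply, LinearMap.comp_apply, LinearEquiv.coe_coe]
  rw [rTensor_map (h := TensorProduct.map f₁ f₀ ∘ₗ comul) (fun c => hf.coactR_map c),
    lTensor_map (h := TensorProduct.map f₀ g ∘ₗ comul) (fun c => hl c), map_map_comul, sub_self]

lemma liftP_spec (hf : IsBicomoduleMap f₀ f₁) (n : ℕ) :
    (∀ c, (cotPow K H M n).coact (liftP f₁ n c)
      = TensorProduct.map f₀ (liftP f₁ n) (comul (R := K) c)) ∧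
    (∀ c, cotIncl K H M n (liftP f₁ (n + 1) c)
      = TensorProduct.map f₁ (liftP f₁ n) (comul (R := K) c)) := by
  have aux : ∀ n, (∀ c, (cotPow K H M n).coact (liftP f₁ n c)
      = TensorProduct.map f₀ (liftP f₁ n) (comul (R := K) c)) →
      (∀ c, cotIncl K H M n (liftP f₁ (n + 1) c)
      = TensorProduct.map f₁ (liftP f₁ n) (comul (R := K) c)) := by
    intro n h c
    have h0 := cotensorMap_map hf (liftP f₁ n) (cotPow K H M n).coact h c
    have h1 := cotRetr_cotIncl n ⟨TensorProduct.map f₁ (liftP f₁ n) (comul (R := K) c), h0⟩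
    have h2 : liftP f₁ (n + 1) c = ⟨TensorProduct.map f₁ (liftP f₁ n) (comul (R := K) c), h0⟩ := h1
    rw [h2]
    rfl
  have main : ∀ n, (∀ c, (cotPow K H M n).coact (liftP f₁ n c)
      = TensorProduct.map f₀ (liftP f₁ n) (comul (R := K) c)) := by
    intro n
    induction n with
    | zero => exact fun c => hf.coactL_map c
    | succ n ih =>
      intro c
      have h1 := aux n ih
      have h2 : (cotIncl K H M n).lTensor H ((cotPow K H M (n + 1)).coact (liftP f₁ (n + 1) c))
          = tensorCoact _ (cotIncl K H M n (liftP f₁ (n + 1) c)) :=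
        congr($(subtype_cotensorCoact (cotPow K H M n).coact) (liftP f₁ (n + 1) c))
      have h3 := congrArg ((cotRetr K H M n).lTensor H) h2
      rw [lTensor_lTensor_comp (h := LinearMap.id) (fun x => cotRetr_cotIncl n x), h1,
        tensorCoact_map hf, lTensor_map (h := liftP f₁ (n + 1)) (fun _ => rfl)] at h3
      simpa using h3
  exact ⟨main n, aux n (main n)⟩

/-- The map to the cotensor coalgebra induced by `f₀` and `f₁`. -/
def lift (f₀ : C →ₗ[K] H) (f₁ : C →ₗ[K] M)
    (hfin : ∀ c, ∃ N, ∀ n, N ≤ n → liftP (H := H) f₁ n c = 0) : C →ₗ[K] Cot K H M :=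
  ofComponents f₀ (liftP f₁) hfin

section

variable (hf : IsBicomoduleMap f₀ f₁)
  (hfin : ∀ c, ∃ N, ∀ n, N ≤ n → liftP (H := H) f₁ n c = 0)

lemma prH_lift (c : C) : prH K H M (lift f₀ f₁ hfin c) = f₀ c := prH_ofComponents ..

lemma prP_lift (n : ℕ) (c : C) : prP K H M n (lift f₀ f₁ hfin c) = liftP f₁ n c :=
  prP_ofComponents ..

lemma prM_lift (c : C) : prM K H M (lift f₀ f₁ hfin c) = f₁ c := by
  simp [prM, prP_lift, liftP]

lemma lam_lift (hf : IsBicomoduleMap f₀ f₁)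
    (hfin : ∀ c, ∃ N, ∀ n, N ≤ n → liftP (H := H) f₁ n c = 0) (c : C) : lam K H M (lift f₀ f₁ hfin c)
    = TensorProduct.map f₀ (lift f₀ f₁ hfin) (comul (R := K) c) := by
  refine lTensor_ext ?_ fun n => ?_
  · rw [lTensor_prH_lam, prH_lift, lTensor_map (fun _ => prH_lift hfin _), hf.comul_map]
  · rw [lTensor_prP_lam, prP_lift, lTensor_map (fun _ => prP_lift hfin n _), (liftP_spec hf n).1]

lemma unc_lift (hf : IsBicomoduleMap f₀ f₁)
    (hfin : ∀ c, ∃ N, ∀ n, N ≤ n → liftP (H := H) f₁ n c = 0) (c : C) : unc K H M (lift f₀ f₁ hfin c)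
    = TensorProduct.map f₁ (lift f₀ f₁ hfin) (comul (R := K) c) := by
  refine lTensor_ext ?_ fun n => ?_
  · rw [lTensor_prH_unc, prM_lift, lTensor_map (fun _ => prH_lift hfin _), hf.coactR_map]
  · rw [lTensor_prP_unc, prP_lift, lTensor_map (fun _ => prP_lift hfin n _), (liftP_spec hf n).2]

lemma dlt_lift (hf : IsBicomoduleMap f₀ f₁)
    (hfin : ∀ c, ∃ N, ∀ n, N ≤ n → liftP (H := H) f₁ n c = 0) (c : C) : dlt K H M (lift f₀ f₁ hfin c)
    = TensorProduct.map (lift f₀ f₁ hfin) (lift f₀ f₁ hfin) (comul (R := K) c) := by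
  set g := lift f₀ f₁ hfin with hg
  let E : C →ₗ[K] Cot K H M ⊗[K] Cot K H M := dlt K H M ∘ₗ g - TensorProduct.map g g ∘ₗ comul
  have hE0 : ∀ c, (prH K H M).rTensor _ (E c) = 0 := fun c => by
    simp only [E, LinearMap.sub_apply, LinearMap.comp_apply, map_sub]
    rw [rTensor_prH_dlt, rTensor_map (fun _ => prH_lift hfin _), lam_lift hf, sub_self]
  have hE1 : ∀ c, TensorProduct.assoc K M _ _ ((unc K H M).rTensor _ (E c))
      = TensorProduct.map f₁ E (comul (R := K) c) := fun c => by
    have h1 : TensorProduct.map f₁ E (comul (R := K) c)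
        = TensorProduct.map f₁ (dlt K H M ∘ₗ g) (comul (R := K) c)
        - TensorProduct.map f₁ (TensorProduct.map g g ∘ₗ comul) (comul (R := K) c) := by
      have h0 := (TensorProduct.mapBilinear (RingHom.id K) C C M (Cot K H M ⊗[K] Cot K H M) f₁).map_sub
        (dlt K H M ∘ₗ g) (TensorProduct.map g g ∘ₗ comul)
      exact LinearMap.congr_fun h0 _
    rw [h1, ← map_map_comul]
    simp only [E, LinearMap.sub_apply, LinearMap.comp_apply, map_sub]
    rw [rTensor_unc_dlt, unc_lift hf, lTensor_map (h := dlt K H M ∘ₗ g) (fun _ => rfl),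
      rTensor_map (h := TensorProduct.map f₁ g ∘ₗ comul) (fun c => unc_lift hf hfin c)]
  have hE2 : ∀ n c, (prP K H M n).rTensor _ (E c) = 0 := by
    intro n
    induction n with
    | zero =>
      intro c
      have h2 : ∀ w : M ⊗[K] (Cot K H M ⊗[K] Cot K H M),
          ((cotOne K H M).toLinearMap ∘ₗ (TensorProduct.rid K M).toLinearMap ∘ₗ
            (counit (R := K)).lTensor M ∘ₗ (prH K H M).lTensor M).rTensor (Cot K H M)
            ((TensorProduct.assoc K M _ _).symm w)
          = ((cotOne K H M).toLinearMap ∘ₗ (TensorProduct.rid K M).toLinearMap ∘ₗ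
            (counit (R := K)).lTensor M).rTensor (Cot K H M) ((TensorProduct.assoc K M _ _).symm
              (((prH K H M).rTensor _).lTensor M w)) := by
        intro w
        refine congr($(show ((cotOne K H M).toLinearMap ∘ₗ (TensorProduct.rid K M).toLinearMap ∘ₗ
            (counit (R := K)).lTensor M ∘ₗ (prH K H M).lTensor M).rTensor (Cot K H M) ∘ₗ
            (TensorProduct.assoc K M _ _).symm.toLinearMap
          = ((cotOne K H M).toLinearMap ∘ₗ (TensorProduct.rid K M).toLinearMap ∘ₗ
            (counit (R := K)).lTensor M).rTensor (Cot K H M) ∘ₗ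
            (TensorProduct.assoc K M _ _).symm.toLinearMap ∘ₗ
              (((prH K H M).rTensor _).lTensor M) by ext; simp) w)
      have h3 := h2 (TensorProduct.assoc K M _ _ ((unc K H M).rTensor _ (E c)))
      rw [LinearEquiv.symm_apply_apply, hE1, lTensor_map (h := 0) hE0,
        rTensor_rTensor_comp (h := prP K H M 0) (fun x => by
          simp [lTensor_prH_unc, rid_coactR, prM])] at h3
      simpa using h3
    | succ n ih =>
      intro c
      have h2 : ∀ w : M ⊗[K] (Cot K H M ⊗[K] Cot K H M),
          (cotRetr K H M n ∘ₗ (prP K H M n).lTensor M).rTensor (Cot K H M)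
            ((TensorProduct.assoc K M _ _).symm w)
          = (cotRetr K H M n).rTensor (Cot K H M) ((TensorProduct.assoc K M _ _).symm
              (((prP K H M n).rTensor _).lTensor M w)) := by
        intro w
        refine congr($(show (cotRetr K H M n ∘ₗ (prP K H M n).lTensor M).rTensor (Cot K H M) ∘ₗ
            (TensorProduct.assoc K M _ _).symm.toLinearMap
          = (cotRetr K H M n).rTensor (Cot K H M) ∘ₗ (TensorProduct.assoc K M _ _).symm.toLinearMap
              ∘ₗ (((prP K H M n).rTensor _).lTensor M) by ext; simp) w)
      have h3 := h2 (TensorProduct.assoc K M _ _ ((unc K H M).rTensor _ (E c)))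
      rw [LinearEquiv.symm_apply_apply, hE1, lTensor_map (h := 0) ih,
        rTensor_rTensor_comp (h := prP K H M (n + 1)) (fun x => by
          rw [LinearMap.comp_apply, lTensor_prP_unc, cotRetr_cotIncl])] at h3
      simpa using h3
  have hE : E c = 0 := rTensor_ext (by rw [hE0, map_zero]) fun n => by rw [hE2, map_zero]
  exact sub_eq_zero.1 hE

/-- The morphism of coalgebras to the cotensor coalgebra induced by `f₀` and `f₁`. -/
def liftHom : C →ₗc[K] Cot K H M :=
  { lift f₀ f₁ hfin with
    counit_comp := LinearMap.ext fun c => by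
      simp only [LinearMap.comp_apply]
      rw [counit_eq, eps, LinearMap.comp_apply]
      erw [prH_lift]
      exact hf.counit_map c
    map_comp_comul := LinearMap.ext fun c => (dlt_lift hf hfin c).symm }

end

/-- A morphism of coalgebras to the cotensor coalgebra is determined by its components of degree
zero and one. -/
lemma coalgHom_ext {F G : C →ₗc[K] Cot K H M} (h0 : ∀ c, prH K H M (F c) = prH K H M (G c))
    (h1 : ∀ c, prM K H M (F c) = prM K H M (G c)) : F = G := by
  have hunc : ∀ (F : C →ₗc[K] Cot K H M) c, unc K H M (F c)
      = TensorProduct.map (prM K H M ∘ₗ F.toLinearMap) F.toLinearMap (comul (R := K) c) := by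
    intro F c
    rw [← rTensor_prM_dlt, ← comul_eq, ← CoalgHomClass.map_comp_comul_apply]
    exact rTensor_map (fun _ => rfl) _ _
  have h2 : ∀ n c, prP K H M n (F c) = prP K H M n (G c) := by
    intro n
    induction n with
    | zero => exact fun c => (cotOne K H M).symm.injective (h1 c)
    | succ n ih =>
      intro c
      refine cotIncl_injective n ?_
      rw [← lTensor_prP_unc, ← lTensor_prP_unc, hunc, hunc,
        lTensor_map (h := prP K H M n ∘ₗ F.toLinearMap) (fun _ => rfl),
        lTensor_map (h := prP K H M n ∘ₗ G.toLinearMap) (fun _ => rfl)]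
      congr 2
      · exact LinearMap.ext h1
      · exact LinearMap.ext ih
  exact CoalgHom.ext fun c => ext' (h0 c) fun n => h2 n c

end Lift

end Cot

namespace Cot

variable (K H M)

/-- The degree zero part `x ⊗ y ↦ x₀ y₀` of the multiplication. -/
def mul₀ : Cot K H M ⊗[K] Cot K H M →ₗ[K] H :=
  LinearMap.mul' K H ∘ₗ TensorProduct.map (prH K H M) (prH K H M)

/-- The degree one part `x ⊗ y ↦ x₀.y₁ + x₁.y₀` of the multiplication. -/
def mul₁ : Cot K H M ⊗[K] Cot K H M →ₗ[K] M :=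
  TensorProduct.lift ((actL K H M).compl₁₂ (prH K H M) (prM K H M)
    + (actR K H M).flip.compl₁₂ (prM K H M) (prH K H M))

variable {K H M}

@[simp] lemma mul₀_tmul (x y : Cot K H M) : mul₀ K H M (x ⊗ₜ y) = prH K H M x * prH K H M y := rfl

@[simp] lemma mul₁_tmul (x y : Cot K H M) : mul₁ K H M (x ⊗ₜ y)
    = prH K H M x • prM K H M y + MulOpposite.op (prH K H M y) • prM K H M x := rfl

variable (K H M) in
/-- The projection to degree zero as a morphism of coalgebras. -/
def prHHom : Cot K H M →ₗc[K] H :=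
  { prH K H M with
    counit_comp := rfl
    map_comp_comul := LinearMap.ext fun x => map_prH_prH_dlt x }

lemma comul_tmul (x y : Cot K H M) : comul (R := K) (x ⊗ₜ[K] y)
    = TensorProduct.tensorTensorTensorComm K _ _ _ _ (dlt K H M x ⊗ₜ dlt K H M y) := rfl

lemma isBicomoduleMap_mul : IsBicomoduleMap (mul₀ K H M) (mul₁ K H M) where
  comul_map c := (CoalgHomClass.map_comp_comul_apply
    ((Bialgebra.mulCoalgHom K H).comp (Coalgebra.TensorProduct.map (prHHom K H M) (prHHom K H M)))
    c).symm
  counit_map c := CoalgHomClass.counit_comp_apply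
    ((Bialgebra.mulCoalgHom K H).comp (Coalgebra.TensorProduct.map (prHHom K H M) (prHHom K H M))) c
  coactL_map c := by
    induction c with
    | zero => simp
    | add a b ha hb => simp only [map_add, ha, hb]
    | tmul x y =>
      have key : ∀ a b : Cot K H M ⊗[K] Cot K H M,
          TensorProduct.map (mul₀ K H M) (mul₁ K H M)
            (TensorProduct.tensorTensorTensorComm K _ _ _ _ (a ⊗ₜ b))
          = TensorProduct.map₂ (LinearMap.mul K H) (actL K H M)
              (TensorProduct.map (prH K H M) (prH K H M) a)
              (TensorProduct.map (prH K H M) (prM K H M) b)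
            + TensorProduct.map₂ (LinearMap.mul K H).flip (actR K H M)
              (TensorProduct.map (prH K H M) (prH K H M) b)
              (TensorProduct.map (prH K H M) (prM K H M) a) := by
        intro a b
        induction a with
        | zero => simp
        | add a a' ha ha' =>
          simp only [TensorProduct.add_tmul, map_add, ha, ha', LinearMap.add_apply]; abel
        | tmul a₁ a₂ =>
          induction b with
          | zero => simp
          | add b b' hb hb' =>
            simp only [TensorProduct.tmul_add, map_add, hb, hb', LinearMap.add_apply]; abel
          | tmul b₁ b₂ => simp [TensorProduct.tmul_add]
      rw [comul_tmul, key, mul₁_tmul, map_add, coactL_smul, coactL_op_smul, map_prH_prH_dlt,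
        map_prH_prH_dlt, map_prH_prM_dlt, map_prH_prM_dlt]
  coactR_map c := by
    induction c with
    | zero => simp
    | add a b ha hb => simp only [map_add, ha, hb]
    | tmul x y =>
      have key : ∀ a b : Cot K H M ⊗[K] Cot K H M,
          TensorProduct.map (mul₁ K H M) (mul₀ K H M)
            (TensorProduct.tensorTensorTensorComm K _ _ _ _ (a ⊗ₜ b))
          = TensorProduct.map₂ (actL K H M) (LinearMap.mul K H)
              (TensorProduct.map (prH K H M) (prH K H M) a)
              (TensorProduct.map (prM K H M) (prH K H M) b)
            + TensorProduct.map₂ (actR K H M) (LinearMap.mul K H).flip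
              (TensorProduct.map (prH K H M) (prH K H M) b)
              (TensorProduct.map (prM K H M) (prH K H M) a) := by
        intro a b
        induction a with
        | zero => simp
        | add a a' ha ha' =>
          simp only [TensorProduct.add_tmul, map_add, ha, ha', LinearMap.add_apply]; abel
        | tmul a₁ a₂ =>
          induction b with
          | zero => simp
          | add b b' hb hb' =>
            simp only [TensorProduct.tmul_add, map_add, hb, hb', LinearMap.add_apply]; abel
          | tmul b₁ b₂ => simp [TensorProduct.add_tmul]
      rw [comul_tmul, key, mul₁_tmul, map_add, coactR_smul, coactR_op_smul, map_prH_prH_dlt,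
        map_prH_prH_dlt, map_prM_prH_dlt, map_prM_prH_dlt]

/-- The shuffle-type recursion for maps out of `Cot ⊗ Cot`. -/
lemma map_mul₁_comul {P : Type*} [AddCommGroup P] [Module K P]
    (g : Cot K H M ⊗[K] Cot K H M →ₗ[K] P) (x y : Cot K H M) :
    TensorProduct.map (mul₁ K H M) g (comul (R := K) (x ⊗ₜ[K] y))
      = TensorProduct.map₂ (actL K H M) (TensorProduct.curry g) (lam K H M x) (unc K H M y)
        + TensorProduct.map₂ (actR K H M).flip (TensorProduct.curry g)
          (unc K H M x) (lam K H M y) := by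
  have key : ∀ a b : Cot K H M ⊗[K] Cot K H M,
      TensorProduct.map (mul₁ K H M) g (TensorProduct.tensorTensorTensorComm K _ _ _ _ (a ⊗ₜ b))
      = TensorProduct.map₂ (actL K H M) (TensorProduct.curry g)
          ((prH K H M).rTensor _ a) ((prM K H M).rTensor _ b)
        + TensorProduct.map₂ (actR K H M).flip (TensorProduct.curry g)
          ((prM K H M).rTensor _ a) ((prH K H M).rTensor _ b) := by
    intro a b
    induction a with
    | zero => simp
    | add a a' ha ha' =>
      simp only [TensorProduct.add_tmul, map_add, ha, ha', LinearMap.add_apply]; abel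
    | tmul a₁ a₂ =>
      induction b with
      | zero => simp
      | add b b' hb hb' =>
        simp only [TensorProduct.tmul_add, map_add, hb, hb']; abel
      | tmul b₁ b₂ => simp [TensorProduct.add_tmul]
  rw [comul_tmul, key, rTensor_prH_dlt, rTensor_prH_dlt, rTensor_prM_dlt, rTensor_prM_dlt]

variable (K H M) in
/-- The homogeneous component of degree `d` of `Cot`. -/
def deg : ℕ → Submodule K (Cot K H M)
  | 0 => LinearMap.range (inH K H M)
  | d + 1 => LinearMap.range (inP K H M d)

lemma lam_mem {d : ℕ} {x : Cot K H M} (hx : x ∈ deg K H M d) :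
    lam K H M x ∈ LinearMap.range ((deg K H M d).subtype.lTensor H) := by
  cases d with
  | zero =>
    obtain ⟨h, rfl⟩ := hx
    refine ⟨(inH K H M).rangeRestrict.lTensor H (comul h), ?_⟩
    rw [lam_inH]
    exact lTensor_lTensor_comp (fun _ => rfl) _
  | succ d =>
    obtain ⟨h, rfl⟩ := hx
    refine ⟨(inP K H M d).rangeRestrict.lTensor H ((cotPow K H M d).coact h), ?_⟩
    rw [lam_inP]
    exact lTensor_lTensor_comp (fun _ => rfl) _

lemma unc_mem {d : ℕ} {x : Cot K H M} (hx : x ∈ deg K H M (d + 1)) :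
    unc K H M x ∈ LinearMap.range ((deg K H M d).subtype.lTensor M) := by
  obtain ⟨h, rfl⟩ := hx
  cases d with
  | zero =>
    refine ⟨(inH K H M).rangeRestrict.lTensor M (coactR ((cotOne K H M).symm h)), ?_⟩
    rw [unc_inP_zero]
    exact lTensor_lTensor_comp (fun _ => rfl) _
  | succ d =>
    refine ⟨(inP K H M d).rangeRestrict.lTensor M (cotIncl K H M d h), ?_⟩
    rw [unc_inP_succ]
    exact lTensor_lTensor_comp (fun _ => rfl) _

lemma map₂_eq_zero {A B D P : Type*} [AddCommGroup A] [Module K A] [AddCommGroup B] [Module K B]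
    [AddCommGroup D] [Module K D] [AddCommGroup P] [Module K P] (f : A →ₗ[K] B →ₗ[K] D)
    (g : Cot K H M →ₗ[K] Cot K H M →ₗ[K] P) (p q : Submodule K (Cot K H M))
    (hg : ∀ x ∈ p, ∀ y ∈ q, g x y = 0) {a : A ⊗[K] Cot K H M} {b : B ⊗[K] Cot K H M}
    (ha : a ∈ LinearMap.range (p.subtype.lTensor A))
    (hb : b ∈ LinearMap.range (q.subtype.lTensor B)) : TensorProduct.map₂ f g a b = 0 := by
  obtain ⟨a, rfl⟩ := ha
  obtain ⟨b, rfl⟩ := hb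
  induction a with
  | zero => simp
  | add a a' ha ha' => simp only [map_add, LinearMap.add_apply, ha, ha', add_zero]
  | tmul a x =>
    induction b with
    | zero => simp
    | add b b' hb hb' => simp only [map_add, hb, hb', add_zero]
    | tmul b y => simp [hg x.1 x.2 y.1 y.2]

lemma liftP_mul_eq_zero (n : ℕ) : ∀ d e : ℕ, d + e ≠ n + 1 → ∀ x ∈ deg K H M d,
    ∀ y ∈ deg K H M e, liftP (H := H) (mul₁ K H M) n (x ⊗ₜ y) = 0 := by
  have prM_zero : ∀ d, d ≠ 1 → ∀ x ∈ deg K H M d, prM K H M x = 0 := by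
    intro d hd x hx
    cases d with
    | zero => obtain ⟨h, rfl⟩ := hx; simp [prM]
    | succ d => obtain ⟨h, rfl⟩ := hx; simp [prM, prP_inP_ne (show 0 ≠ d by omega)]
  have prH_zero : ∀ d, d ≠ 0 → ∀ x ∈ deg K H M d, prH K H M x = 0 := by
    intro d hd x hx
    cases d with
    | zero => exact absurd rfl hd
    | succ d => obtain ⟨h, rfl⟩ := hx; simp
  induction n with
  | zero =>
    intro d e h x hx y hy
    have h1 : prH K H M x • prM K H M y = 0 := by
      by_cases hd : d = 0
      · rw [prM_zero e (by omega) y hy, smul_zero]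
      · rw [prH_zero d hd x hx, zero_smul]
    have h2 : MulOpposite.op (prH K H M y) • prM K H M x = 0 := by
      by_cases he : e = 0
      · rw [prM_zero d (by omega) x hx, smul_zero]
      · rw [prH_zero e he y hy, MulOpposite.op_zero, zero_smul]
    simp [liftP, h1, h2]
  | succ n ih =>
    intro d e h x hx y hy
    have h1 : TensorProduct.map₂ (actL K H M) (TensorProduct.curry (liftP (H := H) (mul₁ K H M) n))
        (lam K H M x) (unc K H M y) = 0 := by
      cases e with
      | zero => obtain ⟨y, rfl⟩ := hy; simp
      | succ e =>
        exact map₂_eq_zero _ _ _ _ (fun x hx y hy => ih d e (by omega) x hx y hy)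
          (lam_mem hx) (unc_mem hy)
    have h2 : TensorProduct.map₂ (actR K H M).flip
        (TensorProduct.curry (liftP (H := H) (mul₁ K H M) n)) (unc K H M x) (lam K H M y) = 0 := by
      cases d with
      | zero => obtain ⟨x, rfl⟩ := hx; simp
      | succ d =>
        exact map₂_eq_zero _ _ _ _ (fun x hx y hy => ih d e (by omega) x hx y hy)
          (unc_mem hx) (lam_mem hy)
    rw [liftP, LinearMap.comp_apply, LinearMap.comp_apply, map_mul₁_comul, h1, h2, add_zero,
      map_zero]

lemma mul_finite (c : Cot K H M ⊗[K] Cot K H M) :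
    ∃ N, ∀ n, N ≤ n → liftP (H := H) (mul₁ K H M) n c = 0 := by
  induction c with
  | zero => exact ⟨0, by simp⟩
  | add a b ha hb =>
    obtain ⟨N, hN⟩ := ha
    obtain ⟨N', hN'⟩ := hb
    refine ⟨max N N', fun n hn => ?_⟩
    rw [map_add, hN n (le_trans (le_max_left _ _) hn), hN' n (le_trans (le_max_right _ _) hn),
      add_zero]
  | tmul x y =>
    obtain ⟨a, ha⟩ := exists_sum x
    obtain ⟨b, hb⟩ := exists_sum y
    refine ⟨a + b, fun n hn => ?_⟩
    rw [ha a le_rfl, hb b le_rfl]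
    have h0 : ∀ h, inH K H M h ∈ deg K H M 0 := fun h => ⟨h, rfl⟩
    have h1 : ∀ k p, inP K H M k p ∈ deg K H M (k + 1) := fun k p => ⟨p, rfl⟩
    simp only [TensorProduct.add_tmul, TensorProduct.tmul_add, TensorProduct.sum_tmul,
      TensorProduct.tmul_sum, map_add, map_sum]
    rw [liftP_mul_eq_zero n 0 0 (by omega) _ (h0 _) _ (h0 _),
      Finset.sum_eq_zero fun k hk => liftP_mul_eq_zero n (k + 1) 0
        (by rw [Finset.mem_range] at hk; omega) _ (h1 _ _) _ (h0 _), zero_add, zero_add]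
    refine Finset.sum_eq_zero fun l hl => ?_
    rw [Finset.mem_range] at hl
    rw [liftP_mul_eq_zero n 0 (l + 1) (by omega) _ (h0 _) _ (h1 _ _), zero_add]
    refine Finset.sum_eq_zero fun k hk => ?_
    rw [Finset.mem_range] at hk
    exact liftP_mul_eq_zero n (k + 1) (l + 1) (by omega) _ (h1 _ _) _ (h1 _ _)

variable (K H M) in
/-- The multiplication of `Cot`: the morphism of coalgebras `Cot ⊗ Cot → Cot` given in degree zero
by the multiplication of `H` and in degree one by the two actions of `H` on `M`. -/
def mulHom : Cot K H M ⊗[K] Cot K H M →ₗc[K] Cot K H M := liftHom isBicomoduleMap_mul mul_finite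

lemma prH_mulHom (c : Cot K H M ⊗[K] Cot K H M) : prH K H M (mulHom K H M c) = mul₀ K H M c :=
  prH_lift ..

lemma prM_mulHom (c : Cot K H M ⊗[K] Cot K H M) : prM K H M (mulHom K H M c) = mul₁ K H M c :=
  prM_lift ..

variable (K H M) in
/-- The inclusion of `H` as a morphism of coalgebras. -/
def inHHom : H →ₗc[K] Cot K H M :=
  { inH K H M with
    counit_comp := LinearMap.ext fun h => by
      change counit (prH K H M (inH K H M h)) = _
      rw [prH_inH]
    map_comp_comul := LinearMap.ext fun h => (dlt_inH h).symm }

instance : Mul (Cot K H M) := ⟨fun x y => mulHom K H M (x ⊗ₜ y)⟩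
instance : One (Cot K H M) := ⟨inH K H M 1⟩

lemma mul_def (x y : Cot K H M) : x * y = mulHom K H M (x ⊗ₜ y) := rfl
lemma one_def : (1 : Cot K H M) = inH K H M 1 := rfl

lemma prH_mul (x y : Cot K H M) : prH K H M (x * y) = prH K H M x * prH K H M y :=
  prH_mulHom _

lemma prM_mul (x y : Cot K H M) : prM K H M (x * y)
    = prH K H M x • prM K H M y + MulOpposite.op (prH K H M y) • prM K H M x := prM_mulHom _

@[simp] lemma prM_inH (h : H) : prM K H M (inH K H M h) = 0 := by simp [prM]

lemma mul_assoc' (x y z : Cot K H M) : x * y * z = x * (y * z) := by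
  have h : (mulHom K H M).comp (Coalgebra.TensorProduct.map (mulHom K H M) (CoalgHom.id K _))
      = ((mulHom K H M).comp (Coalgebra.TensorProduct.map (CoalgHom.id K _) (mulHom K H M))).comp
        (Coalgebra.TensorProduct.assoc K K (Cot K H M) (Cot K H M) (Cot K H M)).toCoalgHom := by
    refine coalgHom_ext (fun c => ?_) (fun c => ?_)
    · induction c with
      | zero => simp
      | add a b ha hb => simp only [map_add, ha, hb]
      | tmul c z =>
        induction c with
        | zero => simp
        | add a b ha hb => simp only [TensorProduct.add_tmul, map_add, ha, hb]
        | tmul x y => exact (by simp only [prH_mul, mul_assoc] :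
            prH K H M (x * y * z) = prH K H M (x * (y * z)))
    · induction c with
      | zero => simp
      | add a b ha hb => simp only [map_add, ha, hb]
      | tmul c z =>
        induction c with
        | zero => simp
        | add a b ha hb => simp only [TensorProduct.add_tmul, map_add, ha, hb]
        | tmul x y =>
          have : prM K H M (x * y * z) = prM K H M (x * (y * z)) := by
            simp only [prM_mul, prH_mul, smul_add, mul_smul, MulOpposite.op_mul, add_assoc]
            rw [smul_comm (prH K H M x) (MulOpposite.op (prH K H M z))]
          exact this
  exact congr($h ((x ⊗ₜ y) ⊗ₜ z))

lemma comul_one' : comul (R := K) (1 : Cot K H M) = 1 ⊗ₜ 1 := by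
  rw [comul_eq, one_def, dlt_inH, Bialgebra.comul_one, Algebra.TensorProduct.one_def,
    TensorProduct.map_tmul]

lemma counit_one' : counit (R := K) (1 : Cot K H M) = 1 := by
  change counit (prH K H M (inH K H M 1)) = _
  rw [prH_inH, Bialgebra.counit_one]

variable (K H M) in
/-- The unit as a morphism of coalgebras. -/
def oneHom : K →ₗc[K] Cot K H M :=
  { LinearMap.toSpanSingleton K (Cot K H M) 1 with
    counit_comp := by ext; simp [counit_one']
    map_comp_comul := by ext; simp [comul_one'] }

lemma oneHom_one : oneHom K H M 1 = 1 := by simp [oneHom]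

lemma one_mul' (x : Cot K H M) : 1 * x = x := by
  have h : ((mulHom K H M).comp (Coalgebra.TensorProduct.map (oneHom K H M) (CoalgHom.id K _))).comp
      (Coalgebra.TensorProduct.lid K (Cot K H M)).symm.toCoalgHom = CoalgHom.id K _ := by
    refine coalgHom_ext (fun x => ?_) (fun x => ?_)
    · change prH K H M (oneHom K H M 1 * x) = prH K H M x
      rw [oneHom_one, prH_mul, one_def, prH_inH, one_mul]
    · change prM K H M (oneHom K H M 1 * x) = prM K H M x
      rw [oneHom_one, prM_mul, one_def, prH_inH, prM_inH, one_smul, smul_zero, add_zero]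
  have := congr($h x)
  change oneHom K H M 1 * x = x at this
  rwa [oneHom_one] at this

lemma mul_one' (x : Cot K H M) : x * 1 = x := by
  have h : ((mulHom K H M).comp (Coalgebra.TensorProduct.map (CoalgHom.id K _) (oneHom K H M))).comp
      (Coalgebra.TensorProduct.rid K K (Cot K H M)).symm.toCoalgHom = CoalgHom.id K _ := by
    refine coalgHom_ext (fun x => ?_) (fun x => ?_)
    · change prH K H M (x * oneHom K H M 1) = prH K H M x
      rw [oneHom_one, prH_mul, one_def, prH_inH, mul_one]
    · change prM K H M (x * oneHom K H M 1) = prM K H M x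
      rw [oneHom_one, prM_mul, one_def, prH_inH, prM_inH, MulOpposite.op_one, one_smul, smul_zero,
        zero_add]
  have := congr($h x)
  change x * oneHom K H M 1 = x at this
  rwa [oneHom_one] at this

instance instRing : Ring (Cot K H M) :=
  { (inferInstance : AddCommGroup (Cot K H M)) with
    left_distrib := fun a b c => by simp only [mul_def, TensorProduct.tmul_add, map_add]
    right_distrib := fun a b c => by simp only [mul_def, TensorProduct.add_tmul, map_add]
    zero_mul := fun a => by simp only [mul_def, TensorProduct.zero_tmul, map_zero]
    mul_zero := fun a => by simp only [mul_def, TensorProduct.tmul_zero, map_zero]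
    mul_assoc := mul_assoc'
    one_mul := one_mul'
    mul_one := mul_one' }

instance : Algebra K (Cot K H M) := Algebra.ofModule
  (fun r x y => by simp only [mul_def, ← TensorProduct.smul_tmul', map_smul])
  (fun r x y => by simp only [mul_def, TensorProduct.tmul_smul, map_smul])

/-- The cotensor bialgebra. -/
instance : Bialgebra K (Cot K H M) := Bialgebra.mk' K (Cot K H M) counit_one'
  (fun {a b} => by
    have := CoalgHomClass.counit_comp_apply (mulHom K H M) (a ⊗ₜ b)
    rw [mul_def]
    refine this.trans ?_
    rw [TensorProduct.counit_tmul, smul_eq_mul, mul_comm])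
  comul_one'
  (fun {a b} => by
    have := CoalgHomClass.map_comp_comul_apply (mulHom K H M) (a ⊗ₜ b)
    rw [mul_def]
    refine this.symm.trans ?_
    rw [comul_tmul, comul_eq, comul_eq]
    induction dlt K H M a with
    | zero => simp
    | add a a' ha ha' => simp only [TensorProduct.add_tmul, map_add, ha, ha', add_mul]
    | tmul a₁ a₂ =>
      induction dlt K H M b with
      | zero => simp
      | add b b' hb hb' => simp only [TensorProduct.tmul_add, map_add, hb, hb', mul_add]
      | tmul b₁ b₂ =>
        rw [TensorProduct.tensorTensorTensorComm_tmul, TensorProduct.map_tmul,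
          Algebra.TensorProduct.tmul_mul_tmul, mul_def, mul_def]
        rfl)

end Cot

/-! ### The antipode -/

namespace Cot

section Antipode

open WithConv

lemma Kills.lTensor_dlt {n : ℕ} {Y : Type*} [AddCommGroup Y] [Module K Y] {F : Cot K H M →ₗ[K] Y}
    (h : Kills n F) : Kills n (F.lTensor _ ∘ₗ dlt K H M) := by
  have e : F.lTensor (Cot K H M) ∘ₗ dlt K H M = (inH K H M).rTensor Y ∘ₗ (F.lTensor H ∘ₗ Cot.lam K H M)
      + ((ret K H M).rTensor Y ∘ₗ (TensorProduct.assoc K M (Cot K H M) Y).symm.toLinearMap) ∘ₗ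
        ((F.lTensor (Cot K H M) ∘ₗ dlt K H M).lTensor M ∘ₗ Cot.unc K H M) := by
    refine LinearMap.ext fun x => ?_
    have e1 : ∀ z : M ⊗[K] (Cot K H M ⊗[K] Cot K H M),
        F.lTensor (Cot K H M) ((ret K H M).rTensor _ ((TensorProduct.assoc K M _ _).symm z))
        = (ret K H M).rTensor Y ((TensorProduct.assoc K M (Cot K H M) Y).symm
          ((F.lTensor (Cot K H M)).lTensor M z)) := fun z =>
      congr($(show F.lTensor (Cot K H M) ∘ₗ (ret K H M).rTensor _ ∘ₗ
          (TensorProduct.assoc K M _ _).symm.toLinearMap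
        = (ret K H M).rTensor Y ∘ₗ (TensorProduct.assoc K M (Cot K H M) Y).symm.toLinearMap ∘ₗ
          (F.lTensor (Cot K H M)).lTensor M by ext; simp) z)
    simp only [LinearMap.comp_apply, LinearMap.add_apply, LinearEquiv.coe_coe]
    rw [dlt_eq, map_add, e1, ← rTensor_lTensor_swap, LinearMap.lTensor_comp, LinearMap.comp_apply]
  induction n with
  | zero =>
    rw [e]
    refine ⟨fun x => ?_, fun k hk => by omega⟩
    have h1 := h.lam.1 x
    rw [LinearMap.add_apply, LinearMap.comp_apply, h1]
    simp
  | succ n ih =>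
    have h' : Kills n F := ⟨h.1, fun k hk x => h.2 k (by omega) x⟩
    have h1 := h.lam
    have h2 := (ih h').unc
    rw [e]
    exact ⟨fun x => by rw [LinearMap.add_apply, (h1.comp _).1, (h2.comp _).1, add_zero],
      fun k hk x => by rw [LinearMap.add_apply, (h1.comp _).2 k hk, (h2.comp _).2 k hk, add_zero]⟩

lemma Kills.mul {n : ℕ} {f g : WithConv (Cot K H M →ₗ[K] Cot K H M)} (h : Kills n g.ofConv) :
    Kills n (f * g).ofConv := by
  have e : (f * g).ofConv = (LinearMap.mul' K (Cot K H M) ∘ₗ f.ofConv.rTensor _) ∘ₗ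
      g.ofConv.lTensor _ ∘ₗ dlt K H M := by
    refine LinearMap.ext fun x => ?_
    simp only [LinearMap.comp_apply]
    rw [← map_eq_rTensor_lTensor]
    rfl
  rw [e]
  exact h.lTensor_dlt.comp _

lemma Kills.mul_succ {n : ℕ} {f g : WithConv (Cot K H M →ₗ[K] Cot K H M)}
    (hf : ∀ h, f.ofConv (inH K H M h) = 0) (h : Kills n g.ofConv) :
    Kills (n + 1) (f * g).ofConv := by
  have hf' : f.ofConv = (f.ofConv ∘ₗ ret K H M) ∘ₗ Cot.unc K H M := by
    refine LinearMap.ext fun x => ?_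
    conv_lhs => rw [← ret_unc x, map_add, hf, zero_add]
    rfl
  have e : (f * g).ofConv = (LinearMap.mul' K (Cot K H M) ∘ₗ
      (f.ofConv ∘ₗ ret K H M).rTensor _ ∘ₗ (TensorProduct.assoc K M _ _).symm.toLinearMap) ∘ₗ
      (g.ofConv.lTensor _ ∘ₗ dlt K H M).lTensor M ∘ₗ Cot.unc K H M := by
    refine LinearMap.ext fun x => ?_
    have e1 : ∀ z : Cot K H M ⊗[K] Cot K H M, (TensorProduct.assoc K M _ _).symm
        ((g.ofConv.lTensor (Cot K H M)).lTensor M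
          (TensorProduct.assoc K M _ _ ((Cot.unc K H M).rTensor _ z)))
        = (Cot.unc K H M).rTensor _ (g.ofConv.lTensor _ z) := by
      intro z
      rw [LinearEquiv.symm_apply_eq, rTensor_lTensor_swap]
      generalize (Cot.unc K H M).rTensor _ z = w
      exact congr($(show (g.ofConv.lTensor (Cot K H M)).lTensor M ∘ₗ
          (TensorProduct.assoc K M _ _).toLinearMap
        = (TensorProduct.assoc K M _ _).toLinearMap ∘ₗ g.ofConv.lTensor _ by ext; simp) w)
    simp only [LinearMap.comp_apply, LinearEquiv.coe_coe, LinearMap.lTensor_comp]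
    rw [← rTensor_unc_dlt, e1, rTensor_rTensor_comp (h := f.ofConv) (fun x => (congr($hf' x)).symm),
      ← map_eq_rTensor_lTensor]
    rfl
  rw [e]
  exact h.lTensor_dlt.unc.comp _

lemma Kills.neg {n : ℕ} {Y : Type*} [AddCommGroup Y] [Module K Y] {F : Cot K H M →ₗ[K] Y}
    (h : Kills n F) : Kills n (-F) :=
  ⟨fun x => by simp [h.1], fun k hk x => by simp [h.2 k hk]⟩

lemma kills_pow {f : WithConv (Cot K H M →ₗ[K] Cot K H M)}
    (hf : ∀ h, f.ofConv (inH K H M h) = 0) : ∀ n, Kills n (f ^ (n + 1)).ofConv := by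
  intro n
  induction n with
  | zero =>
    rw [zero_add, pow_one]
    exact ⟨hf, fun k hk => by omega⟩
  | succ n ih =>
    rw [pow_succ']
    exact Kills.mul_succ hf ih

/-- The sum of the Neumann series `∑ fᵏ`. -/
def neumann (f : WithConv (Cot K H M →ₗ[K] Cot K H M)) :
    WithConv (Cot K H M →ₗ[K] Cot K H M) :=
  toConv (desc K H M ((1 : WithConv (Cot K H M →ₗ[K] Cot K H M)).ofConv ∘ₗ inH K H M)
    fun n => (∑ k ∈ Finset.range (n + 2), f ^ k).ofConv ∘ₗ inP K H M n)

lemma ofConv_sum_apply {ι : Type*} (s : Finset ι) (f : ι → WithConv (Cot K H M →ₗ[K] Cot K H M))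
    (x : Cot K H M) : (∑ k ∈ s, f k).ofConv x = ∑ k ∈ s, (f k).ofConv x := by
  classical
  induction s using Finset.induction_on with
  | empty => simp
  | insert a s ha ih => rw [Finset.sum_insert ha, Finset.sum_insert ha, ← ih]; rfl

lemma kills_neumann_sub {f : WithConv (Cot K H M →ₗ[K] Cot K H M)}
    (hf : ∀ h, f.ofConv (inH K H M h) = 0) (N : ℕ) :
    Kills (N + 1) (neumann f - ∑ k ∈ Finset.range (N + 2), f ^ k).ofConv := by
  refine ⟨fun x => ?_, fun n hn x => ?_⟩
  · have h1 : (neumann f).ofConv (inH K H M x)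
        = (1 : WithConv (Cot K H M →ₗ[K] Cot K H M)).ofConv (inH K H M x) := desc_inH ..
    change (neumann f).ofConv _ - (∑ k ∈ Finset.range (N + 2), f ^ k).ofConv _ = 0
    rw [h1, ofConv_sum_apply, Finset.sum_range_succ', Finset.sum_eq_zero fun k _ =>
      (kills_pow hf k).1 x, zero_add, pow_zero, sub_self]
  · have h1 : (neumann f).ofConv (inP K H M n x)
        = (∑ k ∈ Finset.range (n + 2), f ^ k).ofConv (inP K H M n x) := desc_inP ..
    change (neumann f).ofConv _ - (∑ k ∈ Finset.range (N + 2), f ^ k).ofConv _ = 0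
    rw [h1, ofConv_sum_apply, ofConv_sum_apply, sub_eq_zero]
    refine Finset.sum_subset (Finset.range_mono (by omega)) fun k hk hk' => ?_
    rw [Finset.mem_range] at hk hk'
    obtain ⟨j, rfl⟩ : ∃ j, k = j + 1 := ⟨k - 1, by omega⟩
    exact (kills_pow hf j).2 n (by omega) x

lemma one_sub_mul_neumann {f : WithConv (Cot K H M →ₗ[K] Cot K H M)}
    (hf : ∀ h, f.ofConv (inH K H M h) = 0) : (1 - f) * neumann f = 1 := by
  refine sub_eq_zero.1 (WithConv.ofConv_injective (eq_zero_of_kills fun N => ?_))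
  have e : (1 - f) * neumann f - 1
      = (1 - f) * (neumann f - ∑ k ∈ Finset.range (N + 2), f ^ k) - f ^ (N + 2) := by
    rw [mul_sub, mul_neg_geom_sum]; abel
  rw [e]
  have h1 := Kills.mul (f := 1 - f) (kills_neumann_sub hf N)
  have h2 : Kills N ((1 - f) * (neumann f - ∑ k ∈ Finset.range (N + 2), f ^ k)).ofConv :=
    ⟨h1.1, fun k hk => h1.2 k (by omega)⟩
  have h3 := kills_pow hf (N + 1)
  have h4 : Kills N (f ^ (N + 2)).ofConv := ⟨h3.1, fun k hk => h3.2 k (by omega)⟩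
  exact h2.sub h4

lemma isUnit_one_sub {f : WithConv (Cot K H M →ₗ[K] Cot K H M)}
    (hf : ∀ h, f.ofConv (inH K H M h) = 0) : IsUnit (1 - f) := by
  have h1 := one_sub_mul_neumann hf
  have h2 : (1 - (1 - neumann f)) * neumann (1 - neumann f) = 1 :=
    one_sub_mul_neumann fun h => by
      change (1 : WithConv (Cot K H M →ₗ[K] Cot K H M)).ofConv _ - (neumann f).ofConv _ = 0
      rw [show (neumann f).ofConv (inH K H M h)
        = (1 : WithConv (Cot K H M →ₗ[K] Cot K H M)).ofConv (inH K H M h) from desc_inH ..,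
        sub_self]
  rw [sub_sub_cancel] at h2
  have h3 : neumann (1 - neumann f) = 1 - f := by
    calc _ = ((1 - f) * neumann f) * neumann (1 - neumann f) := by rw [h1, one_mul]
      _ = _ := by rw [mul_assoc, h2, mul_one]
  exact ⟨⟨1 - f, neumann f, h1, h3 ▸ h2⟩, rfl⟩

lemma inH_mul (g h : H) : inH K H M (g * h) = inH K H M g * inH K H M h := by
  have e : (inHHom K H M).comp (Bialgebra.mulCoalgHom K H)
      = (mulHom K H M).comp (Coalgebra.TensorProduct.map (inHHom K H M) (inHHom K H M)) := by
    refine coalgHom_ext (fun c => ?_) (fun c => ?_)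
    · induction c with
      | zero => simp
      | add a b ha hb => simp only [map_add, ha, hb]
      | tmul x y =>
        change prH K H M (inH K H M (x * y)) = prH K H M (inH K H M x * inH K H M y)
        simp [prH_mul]
    · induction c with
      | zero => simp
      | add a b ha hb => simp only [map_add, ha, hb]
      | tmul x y =>
        change prM K H M (inH K H M (x * y)) = prM K H M (inH K H M x * inH K H M y)
        simp [prM_mul]
  exact congr($e (g ⊗ₜ h))

variable (K H M) in
/-- The inclusion of `H` as a homomorphism of algebras. -/
def inHAlgHom : H →ₐ[K] Cot K H M := AlgHom.ofLinearMap (inH K H M) rfl inH_mul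

/-- The identity of `Cot` is invertible with respect to the convolution. -/
lemma isUnit_id : IsUnit (toConv (LinearMap.id : Cot K H M →ₗ[K] Cot K H M)) := by
  have h1 : toConv (inH K H M ∘ₗ prH K H M)
      * toConv (inH K H M ∘ₗ HopfAlgebra.antipode K ∘ₗ prH K H M) = 1 := by
    have a1 := LinearMap.algHom_comp_convMul_distrib (inHAlgHom K H M)
      (toConv (LinearMap.id : H →ₗ[K] H)) (toConv (HopfAlgebra.antipode K))
    rw [LinearMap.id_mul_antipode] at a1
    have a2 := LinearMap.convMul_comp_coalgHom_distrib
      (toConv ((inHAlgHom K H M).toLinearMap ∘ₗ LinearMap.id))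
      (toConv ((inHAlgHom K H M).toLinearMap ∘ₗ HopfAlgebra.antipode K)) (prHHom K H M)
    refine WithConv.ofConv_injective (a2.symm.trans ?_)
    refine (congr($(a1.symm) ∘ₗ (prHHom K H M).toLinearMap)).trans ?_
    refine LinearMap.ext fun x => ?_
    change inHAlgHom K H M (algebraMap K H (counit (prH K H M x))) = _
    rw [AlgHom.commutes]
    rfl
  have h2 : toConv (inH K H M ∘ₗ HopfAlgebra.antipode K ∘ₗ prH K H M)
      * toConv (inH K H M ∘ₗ prH K H M) = 1 := by
    have a1 := LinearMap.algHom_comp_convMul_distrib (inHAlgHom K H M)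
      (toConv (HopfAlgebra.antipode K)) (toConv (LinearMap.id : H →ₗ[K] H))
    rw [LinearMap.antipode_mul_id] at a1
    have a2 := LinearMap.convMul_comp_coalgHom_distrib
      (toConv ((inHAlgHom K H M).toLinearMap ∘ₗ HopfAlgebra.antipode K))
      (toConv ((inHAlgHom K H M).toLinearMap ∘ₗ LinearMap.id)) (prHHom K H M)
    refine WithConv.ofConv_injective (a2.symm.trans ?_)
    refine (congr($(a1.symm) ∘ₗ (prHHom K H M).toLinearMap)).trans ?_
    refine LinearMap.ext fun x => ?_
    change inHAlgHom K H M (algebraMap K H (counit (prH K H M x))) = _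
    rw [AlgHom.commutes]
    rfl
  set j := toConv (inH K H M ∘ₗ HopfAlgebra.antipode K ∘ₗ prH K H M)
  set e := toConv (inH K H M ∘ₗ prH K H M) with he
  have h3 : IsUnit (j * toConv LinearMap.id) := by
    have : IsUnit (1 - (1 - j * toConv LinearMap.id)) := isUnit_one_sub fun h => by
      have a1 : (j * toConv LinearMap.id).ofConv (inH K H M h) = (j * e).ofConv (inH K H M h) := by
        change LinearMap.mul' K _ (TensorProduct.map j.ofConv LinearMap.id (dlt K H M _))
          = LinearMap.mul' K _ (TensorProduct.map j.ofConv (inH K H M ∘ₗ prH K H M) (dlt K H M _))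
        rw [dlt_inH]
        congr 1
        generalize comul (R := K) h = w
        induction w with
        | zero => simp
        | add a b ha hb => simp only [map_add, ha, hb]
        | tmul a b => simp
      change (1 : WithConv (Cot K H M →ₗ[K] Cot K H M)).ofConv _
        - (j * toConv LinearMap.id).ofConv _ = 0
      rw [a1, h2, sub_self]
    rwa [sub_sub_cancel] at this
  have h4 : toConv LinearMap.id = e * (j * toConv LinearMap.id) := by
    rw [← mul_assoc, h1, one_mul]
  rw [h4]
  exact IsUnit.mul ⟨⟨e, j, h1, h2⟩, rfl⟩ h3

/-- The cotensor Hopf algebra. -/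
instance : HopfAlgebra K (Cot K H M) :=
  HopfAlgebra.ofConvInverse ((↑(isUnit_id (K := K) (H := H) (M := M)).unit⁻¹ :
    WithConv (Cot K H M →ₗ[K] Cot K H M)).ofConv)
    (isUnit_id (K := K) (H := H) (M := M)).val_inv_mul
    (isUnit_id (K := K) (H := H) (M := M)).mul_val_inv

end Antipode

end Cot

end Cotensor

/-! ### Hopf subalgebras -/

section HopfSub

section

variable {K S A : Type*} [Field K] [AddCommGroup S] [Module K S] [AddCommGroup A] [Module K A]
    {v : S →ₗ[K] A} {d : S →ₗ[K] S ⊗[K] S} {D : A →ₗ[K] A ⊗[K] A}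

lemma map_assoc_rTensor (h : ∀ x, TensorProduct.map v v (d x) = D (v x)) (z : S ⊗[K] S) :
    TensorProduct.map v (TensorProduct.map v v) (TensorProduct.assoc K S S S (d.rTensor S z))
      = TensorProduct.assoc K A A A (D.rTensor A (TensorProduct.map v v z)) := by
  rw [TensorProduct.map_map_assoc]
  congr 1
  induction z with
  | zero => simp only [map_zero]
  | add a b ha hb => simp only [map_add, ha, hb]
  | tmul a b => simp only [LinearMap.rTensor_tmul, TensorProduct.map_tmul, h]

lemma map_lTensor_comul (h : ∀ x, TensorProduct.map v v (d x) = D (v x)) (z : S ⊗[K] S) :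
    TensorProduct.map v (TensorProduct.map v v) (d.lTensor S z)
      = D.lTensor A (TensorProduct.map v v z) := by
  induction z with
  | zero => simp only [map_zero]
  | add a b ha hb => simp only [map_add, ha, hb]
  | tmul a b => simp only [LinearMap.lTensor_tmul, TensorProduct.map_tmul, h]

end

variable {K S A : Type*} [Field K] [Ring S] [Algebra K S] [Ring A] [HopfAlgebra K A]

/-- The image of the injective algebra homomorphism `v` is a Hopf subalgebra. -/
structure IsHopfSub (v : S →ₐ[K] A) : Prop where
  injective : Function.Injective v
  comul_mem (x : S) : comul (v x) ∈
    LinearMap.range (TensorProduct.map v.toLinearMap v.toLinearMap)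
  antipode_mem (x : S) : HopfAlgebra.antipode K (v x) ∈ v.range

/-- A linear left inverse of an injective homomorphism. -/
def subRetr (v : S →ₐ[K] A) : A →ₗ[K] S := v.toLinearMap.leftInverse

/-- The comultiplication induced on a Hopf subalgebra (see `IsHopfSub.map_comulSub`). -/
def comulSub (v : S →ₐ[K] A) : S →ₗ[K] S ⊗[K] S :=
  TensorProduct.map (subRetr v) (subRetr v) ∘ₗ comul ∘ₗ v.toLinearMap

/-- The antipode induced on a Hopf subalgebra (see `IsHopfSub.val_antipodeSub`). -/
def antipodeSub (v : S →ₐ[K] A) : S →ₗ[K] S :=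
  subRetr v ∘ₗ HopfAlgebra.antipode K ∘ₗ v.toLinearMap

namespace IsHopfSub

variable {v : S →ₐ[K] A}

lemma subRetr_val (hv : IsHopfSub v) (x : S) : subRetr v (v x) = x :=
  LinearMap.leftInverse_apply_of_inj (f := v.toLinearMap) (LinearMap.ker_eq_bot.2 hv.injective) x

lemma retr_comp (hv : IsHopfSub v) : subRetr v ∘ₗ v.toLinearMap = LinearMap.id := LinearMap.ext hv.subRetr_val

lemma map_retr (hv : IsHopfSub v) (z : S ⊗[K] S) : TensorProduct.map (subRetr v) (subRetr v)
    (TensorProduct.map v.toLinearMap v.toLinearMap z) = z := by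
  rw [← LinearMap.comp_apply, ← TensorProduct.map_comp, hv.retr_comp, TensorProduct.map_id]
  rfl

lemma map_injective (hv : IsHopfSub v) :
    Function.Injective (TensorProduct.map v.toLinearMap v.toLinearMap) :=
  Function.LeftInverse.injective hv.map_retr

lemma map_map_injective (hv : IsHopfSub v) : Function.Injective (TensorProduct.map v.toLinearMap
      (TensorProduct.map v.toLinearMap v.toLinearMap)) := by
  refine Function.LeftInverse.injective
    (g := TensorProduct.map (subRetr v) (TensorProduct.map (subRetr v) (subRetr v))) fun z => ?_
  rw [← LinearMap.comp_apply, ← TensorProduct.map_comp, ← TensorProduct.map_comp, hv.retr_comp,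
    TensorProduct.map_id, TensorProduct.map_id]
  rfl

lemma map_comulSub (hv : IsHopfSub v) (x : S) :
    TensorProduct.map v.toLinearMap v.toLinearMap (comulSub v x) = comul (v x) := by
  obtain ⟨z, hz⟩ := hv.comul_mem x
  have : comulSub v x = z := by
    change TensorProduct.map (subRetr v) (subRetr v) (comul (v x)) = z
    rw [← hz, hv.map_retr]
  rw [this, hz]

lemma val_antipodeSub (hv : IsHopfSub v) (x : S) : v (antipodeSub v x) = HopfAlgebra.antipode K (v x) := by
  obtain ⟨z, hz⟩ := hv.antipode_mem x
  have : antipodeSub v x = z := by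
    change subRetr v (HopfAlgebra.antipode K (v x)) = z
    rw [← hz]
    exact hv.subRetr_val z
  rw [this]
  exact hz

/-- The coalgebra structure on a Hopf subalgebra. -/
abbrev coalgebra (hv : IsHopfSub v) : Coalgebra K S where
  comul := comulSub v
  counit := counit ∘ₗ v.toLinearMap
  coassoc := by
    refine LinearMap.ext fun x => hv.map_map_injective ?_
    simp only [LinearMap.comp_apply, LinearEquiv.coe_coe]
    rw [map_assoc_rTensor hv.map_comulSub, map_lTensor_comul hv.map_comulSub,
      hv.map_comulSub, Coalgebra.coassoc_apply]
  rTensor_counit_comp_comul := by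
    refine LinearMap.ext fun x => (TensorProduct.lid K S).injective (hv.injective ?_)
    have e1 : ∀ z : S ⊗[K] S, v (TensorProduct.lid K S ((counit ∘ₗ v.toLinearMap).rTensor S z))
        = TensorProduct.lid K A ((counit (R := K)).rTensor A
          (TensorProduct.map v.toLinearMap v.toLinearMap z)) := by
      intro z
      induction z with
      | zero => simp
      | add a b ha hb => simp only [map_add, ha, hb]
      | tmul a b => simp
    rw [LinearMap.comp_apply, e1, hv.map_comulSub]
    simp
  lTensor_counit_comp_comul := by
    refine LinearMap.ext fun x => (TensorProduct.rid K S).injective (hv.injective ?_)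
    have e1 : ∀ z : S ⊗[K] S, v (TensorProduct.rid K S ((counit ∘ₗ v.toLinearMap).lTensor S z))
        = TensorProduct.rid K A ((counit (R := K)).lTensor A
          (TensorProduct.map v.toLinearMap v.toLinearMap z)) := by
      intro z
      induction z with
      | zero => simp
      | add a b ha hb => simp only [map_add, ha, hb]
      | tmul a b => simp
    rw [LinearMap.comp_apply, e1, hv.map_comulSub]
    simp

/-- The bialgebra structure on a Hopf subalgebra. -/
abbrev bialgebra (hv : IsHopfSub v) : Bialgebra K S :=
  letI := hv.coalgebra
  Bialgebra.mk' K S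
    (by
      change counit (v 1) = 1
      rw [map_one, Bialgebra.counit_one])
    (fun {a b} => by
      change counit (v (a * b)) = counit (v a) * counit (v b)
      rw [map_mul, Bialgebra.counit_mul])
    (hv.map_injective (by
      refine (hv.map_comulSub 1).trans ?_
      rw [map_one, Bialgebra.comul_one]
      exact (map_one (Algebra.TensorProduct.map v v)).symm))
    (fun {a b} => hv.map_injective (by
      refine (hv.map_comulSub (a * b)).trans ?_
      rw [map_mul, Bialgebra.comul_mul, ← hv.map_comulSub, ← hv.map_comulSub]
      exact (map_mul (Algebra.TensorProduct.map v v) _ _).symm))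

/-- The Hopf algebra structure on a Hopf subalgebra. -/
abbrev hopfAlgebra (hv : IsHopfSub v) : HopfAlgebra K S :=
  letI := hv.bialgebra
  { antipode := antipodeSub v
    mul_antipode_rTensor_comul := by
      refine LinearMap.ext fun x => hv.injective ?_
      have e1 : ∀ z : S ⊗[K] S, v (LinearMap.mul' K S ((antipodeSub v).rTensor S z))
          = LinearMap.mul' K A ((HopfAlgebra.antipode K).rTensor A
            (TensorProduct.map v.toLinearMap v.toLinearMap z)) := by
        intro z
        induction z with
        | zero => simp
        | add a b ha hb => simp only [map_add, ha, hb]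
        | tmul a b => simp [hv.val_antipodeSub]
      refine (e1 (comulSub v x)).trans ?_
      rw [hv.map_comulSub, HopfAlgebra.mul_antipode_rTensor_comul_apply]
      exact (AlgHom.commutes v _).symm
    mul_antipode_lTensor_comul := by
      refine LinearMap.ext fun x => hv.injective ?_
      have e1 : ∀ z : S ⊗[K] S, v (LinearMap.mul' K S ((antipodeSub v).lTensor S z))
          = LinearMap.mul' K A ((HopfAlgebra.antipode K).lTensor A
            (TensorProduct.map v.toLinearMap v.toLinearMap z)) := by
        intro z
        induction z with
        | zero => simp
        | add a b ha hb => simp only [map_add, ha, hb]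
        | tmul a b => simp [hv.val_antipodeSub]
      refine (e1 (comulSub v x)).trans ?_
      rw [hv.map_comulSub, HopfAlgebra.mul_antipode_lTensor_comul_apply]
      exact (AlgHom.commutes v _).symm }

end IsHopfSub

end HopfSub

lemma map_map_eq {K A B C A' B' C' : Type*} [Field K] [AddCommGroup A] [Module K A]
    [AddCommGroup B] [Module K B] [AddCommGroup C] [Module K C] [AddCommGroup A'] [Module K A']
    [AddCommGroup B'] [Module K B'] [AddCommGroup C'] [Module K C']
    {f : A →ₗ[K] B} {f' : B →ₗ[K] C} {h : A →ₗ[K] C} {g : A' →ₗ[K] B'} {g' : B' →ₗ[K] C'}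
    {k : A' →ₗ[K] C'} (e : ∀ a, f' (f a) = h a) (e' : ∀ a, g' (g a) = k a) (z : A ⊗[K] A') :
    TensorProduct.map f' g' (TensorProduct.map f g z) = TensorProduct.map h k z := by
  rw [← LinearMap.comp_apply, ← TensorProduct.map_comp, show f' ∘ₗ f = h from LinearMap.ext e,
    show g' ∘ₗ g = k from LinearMap.ext e']

/-! ### The quantum symmetric algebra -/

section QuantumSymmetric

variable (K : Type*) (H : Type u) (M : Type v) [Field K] [Ring H] [HopfAlgebra K H]
    [AddCommGroup M] [Module K M] [Module H M] [Module Hᵐᵒᵖ M] [IsScalarTower K H M]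
    [IsScalarTower K Hᵐᵒᵖ M] [SMulCommClass H Hᵐᵒᵖ M] [HopfBimodule K H M]
open HopfBimodule

/-- The quantum symmetric algebra `S_H(M)`: the subalgebra of the cotensor Hopf algebra `Cot_H(M)`
generated by `H` and `M`. -/
def QSA : Subalgebra K (Cot K H M) :=
  Algebra.adjoin K (Set.range (Cot.inH K H M) ∪ Set.range (Cot.inM K H M))

namespace QSA

variable {K H M}

lemma inH_mem (h : H) : Cot.inH K H M h ∈ QSA K H M :=
  Algebra.subset_adjoin (Or.inl ⟨h, rfl⟩)

lemma inM_mem (m : M) : Cot.inM K H M m ∈ QSA K H M :=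
  Algebra.subset_adjoin (Or.inr ⟨m, rfl⟩)

variable (K H M) in
/-- The inclusion of `H` into `S_H(M)`. -/
def inH : H →ₗ[K] QSA K H M :=
  (Cot.inH K H M).codRestrict (Subalgebra.toSubmodule (QSA K H M)) inH_mem

variable (K H M) in
/-- The inclusion of `M` into `S_H(M)`. -/
def inM : M →ₗ[K] QSA K H M :=
  (Cot.inM K H M).codRestrict (Subalgebra.toSubmodule (QSA K H M)) inM_mem

lemma comul_mem (x : QSA K H M) : comul ((QSA K H M).val x) ∈ LinearMap.range
    (TensorProduct.map (QSA K H M).val.toLinearMap (QSA K H M).val.toLinearMap) := by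
  have h : QSA K H M ≤ (Algebra.TensorProduct.map (QSA K H M).val (QSA K H M).val).range.comap
      (Bialgebra.comulAlgHom K (Cot K H M)) := by
    refine Algebra.adjoin_le ?_
    rintro _ (⟨h, rfl⟩ | ⟨m, rfl⟩)
    · refine ⟨TensorProduct.map (inH K H M) (inH K H M) (comul h), ?_⟩
      refine Eq.trans ?_ (Cot.dlt_inH h).symm
      exact map_map_eq (fun _ => rfl) (fun _ => rfl) _
    · refine ⟨TensorProduct.map (inH K H M) (inM K H M) (coactL m)
        + TensorProduct.map (inM K H M) (inH K H M) (coactR m), ?_⟩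
      refine Eq.trans ?_ (Cot.dlt_inM m).symm
      refine (map_add (Algebra.TensorProduct.map (QSA K H M).val (QSA K H M).val) _ _).trans ?_
      exact congrArg₂ (· + ·) (map_map_eq (fun _ => rfl) (fun _ => rfl) _) (map_map_eq (fun _ => rfl) (fun _ => rfl) _)
  exact h x.2

lemma antipode_inH (h : H) : HopfAlgebra.antipode K (Cot.inH K H M h)
    = Cot.inH K H M (HopfAlgebra.antipode K h) := by
  have h1 : WithConv.toConv (HopfAlgebra.antipode K ∘ₗ Cot.inH K H M)
      * WithConv.toConv (Cot.inH K H M) = 1 := by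
    have a := LinearMap.convMul_comp_coalgHom_distrib
      (WithConv.toConv (HopfAlgebra.antipode K (A := Cot K H M)))
      (WithConv.toConv LinearMap.id) (Cot.inHHom K H M)
    rw [LinearMap.antipode_mul_id] at a
    refine WithConv.ofConv_injective (a.symm.trans ?_)
    refine LinearMap.ext fun x => ?_
    exact congr(algebraMap K (Cot K H M) $(CoalgHomClass.counit_comp_apply (Cot.inHHom K H M) x))
  have h2 : WithConv.toConv (Cot.inH K H M)
      * WithConv.toConv (Cot.inH K H M ∘ₗ HopfAlgebra.antipode K) = 1 := by
    have a := LinearMap.algHom_comp_convMul_distrib (Cot.inHAlgHom K H M)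
      (WithConv.toConv (LinearMap.id : H →ₗ[K] H)) (WithConv.toConv (HopfAlgebra.antipode K))
    rw [LinearMap.id_mul_antipode] at a
    refine WithConv.ofConv_injective (a.symm.trans ?_)
    refine LinearMap.ext fun x => ?_
    exact AlgHom.commutes (Cot.inHAlgHom K H M) _
  exact congr($(left_inv_eq_right_inv h1 h2).ofConv h)

lemma antipode_mem {x : Cot K H M} (hx : x ∈ QSA K H M) :
    HopfAlgebra.antipode K x ∈ QSA K H M := by
  induction hx using Algebra.adjoin_induction with
  | algebraMap r =>
    rw [Algebra.algebraMap_eq_smul_one, map_smul, HopfAlgebra.antipode_one]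
    exact Subalgebra.smul_mem _ (one_mem _) r
  | add x y _ _ hx hy => rw [map_add]; exact add_mem hx hy
  | mul x y _ _ hx hy => rw [HopfAlgebra.antipode_mul_antidistrib]; exact mul_mem hy hx
  | mem x hx =>
    rcases hx with ⟨h, rfl⟩ | ⟨m, rfl⟩
    · rw [antipode_inH]; exact inH_mem _
    · let F : M ⊗[K] H →ₗ[K] Cot K H M := LinearMap.mul' K (Cot K H M) ∘ₗ
        TensorProduct.map (HopfAlgebra.antipode K ∘ₗ Cot.inM K H M) (Cot.inH K H M)
      have hF : ∀ m, F (coactR m) ∈ QSA K H M := by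
        intro m
        have h1 := HopfAlgebra.mul_antipode_rTensor_comul_apply (R := K) (Cot.inM K H M m)
        rw [Cot.comul_eq, Cot.dlt_inM, map_add, map_add] at h1
        have h2 : ∀ w : H ⊗[K] M, LinearMap.mul' K (Cot K H M)
            ((HopfAlgebra.antipode K).rTensor _
              (TensorProduct.map (Cot.inH K H M) (Cot.inM K H M) w)) ∈ QSA K H M := by
          intro w
          induction w with
          | zero => simp
          | add a b ha hb => simp only [map_add]; exact add_mem ha hb
          | tmul h m =>
            simp only [TensorProduct.map_tmul, LinearMap.rTensor_tmul, LinearMap.mul'_apply,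
              antipode_inH]
            exact mul_mem (inH_mem _) (inM_mem _)
        have h3 : ∀ w : M ⊗[K] H, LinearMap.mul' K (Cot K H M)
            ((HopfAlgebra.antipode K).rTensor _
              (TensorProduct.map (Cot.inM K H M) (Cot.inH K H M) w)) = F w := by
          intro w
          induction w with
          | zero => simp
          | add a b ha hb => simp only [map_add, ha, hb]
          | tmul m h => rfl
        rw [h3] at h1
        rw [eq_sub_of_add_eq' h1]
        exact sub_mem (Subalgebra.algebraMap_mem _ _) (h2 _)
      have h4 : ∀ w : M ⊗[K] H, LinearMap.mul' K (Cot K H M) (TensorProduct.map (F ∘ₗ coactR)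
          (Cot.inH K H M ∘ₗ HopfAlgebra.antipode K) w) ∈ QSA K H M := by
        intro w
        induction w with
        | zero => simp
        | add a b ha hb => simp only [map_add]; exact add_mem ha hb
        | tmul m h => exact mul_mem (hF m) (inH_mem _)
      have h5 : ∀ w : (M ⊗[K] H) ⊗[K] H, LinearMap.mul' K (Cot K H M) (TensorProduct.map F
          (Cot.inH K H M ∘ₗ HopfAlgebra.antipode K) w) = LinearMap.mul' K (Cot K H M)
            (TensorProduct.map (HopfAlgebra.antipode K ∘ₗ Cot.inM K H M) (Cot.inH K H M ∘ₗ
              LinearMap.mul' K H ∘ₗ (HopfAlgebra.antipode K).lTensor H)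
              (TensorProduct.assoc K M H H w)) := by
        intro w
        refine congr($(show LinearMap.mul' K (Cot K H M) ∘ₗ (TensorProduct.map F
          (Cot.inH K H M ∘ₗ HopfAlgebra.antipode K)) = LinearMap.mul' K (Cot K H M) ∘ₗ
            (TensorProduct.map (HopfAlgebra.antipode K ∘ₗ Cot.inM K H M) (Cot.inH K H M ∘ₗ
              LinearMap.mul' K H ∘ₗ (HopfAlgebra.antipode K).lTensor H)) ∘ₗ
              (TensorProduct.assoc K M H H).toLinearMap from
                TensorProduct.ext_threefold fun m g h => ?_) w)
        simp [F, mul_assoc, Cot.inH_mul]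
      have h6 := h4 (coactR m)
      have h7 := congr($(coassocR (K := K) (H := H) (M := M)) m)
      simp only [LinearMap.comp_apply, LinearEquiv.coe_coe] at h7
      have h8 : TensorProduct.map (F ∘ₗ coactR) (Cot.inH K H M ∘ₗ HopfAlgebra.antipode K)
          (coactR m) = TensorProduct.map F (Cot.inH K H M ∘ₗ HopfAlgebra.antipode K)
            (coactR.rTensor H (coactR m)) := (map_map_eq (f := coactR)
            (g := LinearMap.id) (fun _ => rfl) (fun _ => rfl) _).symm
      have h9 : ∀ w : M ⊗[K] H, LinearMap.mul' K (Cot K H M)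
          (TensorProduct.map (HopfAlgebra.antipode K ∘ₗ Cot.inM K H M) (Cot.inH K H M ∘ₗ
              LinearMap.mul' K H ∘ₗ (HopfAlgebra.antipode K).lTensor H)
              ((comul (R := K)).lTensor M w))
          = HopfAlgebra.antipode K (Cot.inM K H M (TensorProduct.rid K M
              ((counit (R := K)).lTensor M w))) := by
        intro w
        induction w with
        | zero => simp
        | add a b ha hb => simp only [map_add, ha, hb]
        | tmul m h =>
          simp only [LinearMap.lTensor_tmul, TensorProduct.map_tmul, LinearMap.mul'_apply,
            LinearMap.comp_apply, HopfAlgebra.mul_antipode_lTensor_comul_apply,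
            TensorProduct.rid_tmul, map_smul]
          have := AlgHom.commutes (Cot.inHAlgHom K H M) (counit (R := K) h)
          change Cot.inH K H M _ = _ at this
          rw [this, ← Algebra.commutes, ← Algebra.smul_def]
      rw [h8, h5, h7, h9, Cot.rid_coactR] at h6
      exact h6

/-- The Hopf algebra structure of `S_H(M)`, restricted from that of `Cot_H(M)`. -/
instance : HopfAlgebra K (QSA K H M) :=
  IsHopfSub.hopfAlgebra (v := (QSA K H M).val)
    ⟨Subtype.val_injective, comul_mem, fun x => ⟨⟨_, antipode_mem x.2⟩, rfl⟩⟩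

/-- The inclusion of `S_H(M)` into `Cot_H(M)` is compatible with the comultiplications. -/
lemma map_val_comul (x : QSA K H M) :
    TensorProduct.map (QSA K H M).val.toLinearMap (QSA K H M).val.toLinearMap (comul x)
      = comul (x : Cot K H M) :=
  IsHopfSub.map_comulSub (v := (QSA K H M).val)
    ⟨Subtype.val_injective, comul_mem, fun x => ⟨⟨_, antipode_mem x.2⟩, rfl⟩⟩ x

lemma counit_val (x : QSA K H M) : counit (R := K) (x : Cot K H M) = counit x := rfl

lemma val_antipode (x : QSA K H M) :
    ((HopfAlgebra.antipode K x : QSA K H M) : Cot K H M)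
    = HopfAlgebra.antipode K (x : Cot K H M) :=
  IsHopfSub.val_antipodeSub (v := (QSA K H M).val)
    ⟨Subtype.val_injective, comul_mem, fun x => ⟨⟨_, antipode_mem x.2⟩, rfl⟩⟩ x

variable (K H M) in
/-- The homogeneous component of degree `d` of `S_H(M)`, its intersection with that of
`Cot_H(M)`. -/
def deg (d : ℕ) : Submodule K (QSA K H M) := (Cot.deg K H M d).comap (QSA K H M).val.toLinearMap

end QSA

end QuantumSymmetric

/-! ### Pairings -/

section Pairing

variable {K : Type*} [Field K]

/-- A Hopf pairing between two Hopf algebras. -/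
structure IsHopfPairing {A B : Type*} [Ring A] [HopfAlgebra K A] [Ring B] [HopfAlgebra K B]
    (φ : A →ₗ[K] B →ₗ[K] K) : Prop where
  one_left (b : B) : φ 1 b = counit b
  one_right (a : A) : φ a 1 = counit a
  /-- `φ(a, bc) = ∑ φ(a₁, b) φ(a₂, c)` -/
  mul_right (a : A) (b c : B) : φ a (b * c)
    = LinearMap.mul' K K (TensorProduct.map (φ.flip b) (φ.flip c) (comul a))
  /-- `φ(ac, b) = ∑ φ(a, b₁) φ(c, b₂)` -/
  mul_left (a c : A) (b : B) : φ (a * c) b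
    = LinearMap.mul' K K (TensorProduct.map (φ a) (φ c) (comul b))
  antipode (a : A) (b : B) : φ (HopfAlgebra.antipode K a) b = φ a (HopfAlgebra.antipode K b)

/-- The linear form `x ⊗ y ⊗ z ↦ f(x) g(y) h(z)`. -/
def tripleForm {X Y Z : Type*} [AddCommGroup X] [Module K X] [AddCommGroup Y] [Module K Y]
    [AddCommGroup Z] [Module K Z] (f : X →ₗ[K] K) (g : Y →ₗ[K] K) (h : Z →ₗ[K] K) :
    X ⊗[K] (Y ⊗[K] Z) →ₗ[K] K :=
  LinearMap.mul' K K ∘ₗ TensorProduct.map f (LinearMap.mul' K K ∘ₗ TensorProduct.map g h)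

/-- The two-sided coaction `m ↦ ∑ m₋₁ ⊗ m₀ ⊗ m₁` of a Hopf bimodule. -/
def coactLR (K : Type*) (H : Type u) (M : Type v) [Field K] [Ring H] [HopfAlgebra K H]
    [AddCommGroup M] [Module K M] [Module H M] [Module Hᵐᵒᵖ M] [IsScalarTower K H M]
    [IsScalarTower K Hᵐᵒᵖ M] [SMulCommClass H Hᵐᵒᵖ M] [HopfBimodule K H M] :
    M →ₗ[K] H ⊗[K] (M ⊗[K] H) :=
  HopfBimodule.coactR.lTensor H ∘ₗ HopfBimodule.coactL

variable {H : Type*} {M : Type*} [Ring H] [HopfAlgebra K H]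
    [AddCommGroup M] [Module K M] [Module H M] [Module Hᵐᵒᵖ M] [IsScalarTower K H M]
    [IsScalarTower K Hᵐᵒᵖ M] [SMulCommClass H Hᵐᵒᵖ M] [HopfBimodule K H M]
    {B : Type*} {N : Type*} [Ring B] [HopfAlgebra K B]
    [AddCommGroup N] [Module K N] [Module B N] [Module Bᵐᵒᵖ N] [IsScalarTower K B N]
    [IsScalarTower K Bᵐᵒᵖ N] [SMulCommClass B Bᵐᵒᵖ N] [HopfBimodule K B N]

/-- A pairing of the couples `(H, M)` and `(B, N)`. -/
structure IsCouplePairing (φ₀ : H →ₗ[K] B →ₗ[K] K) (φ₁ : M →ₗ[K] N →ₗ[K] K) : Prop where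
  hopf : IsHopfPairing φ₀
  /-- `φ₁(h.m.g, n) = ∑ φ₀(h, n₋₁) φ₁(m, n₀) φ₀(g, n₁)` -/
  left (h g : H) (m : M) (n : N) : φ₁ (h • MulOpposite.op g • m) n
    = tripleForm (φ₀ h) (φ₁ m) (φ₀ g) (coactLR K B N n)
  /-- `φ₁(m, b.n.c) = ∑ φ₀(m₋₁, b) φ₁(m₀, n) φ₀(m₁, c)` -/
  right (b c : B) (m : M) (n : N) : φ₁ m (b • MulOpposite.op c • n)
    = tripleForm (φ₀.flip b) (φ₁.flip n) (φ₀.flip c) (coactLR K H M m)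

/-- A graded Hopf pairing between the quantum symmetric algebras `S_H(M)` and `S_B(N)`. -/
structure IsGradedHopfPairing (φ : QSA K H M →ₗ[K] QSA K B N →ₗ[K] K) : Prop
    extends IsHopfPairing φ where
  graded (i j : ℕ) (hij : i ≠ j) (x : QSA K H M) (y : QSA K B N) (hx : x ∈ QSA.deg K H M i)
    (hy : y ∈ QSA.deg K B N j) : φ x y = 0

/-- The pairing `φ` of the quantum symmetric algebras extends the pairings `φ₀` and `φ₁`. -/
structure Extends (φ : QSA K H M →ₗ[K] QSA K B N →ₗ[K] K) (φ₀ : H →ₗ[K] B →ₗ[K] K)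
    (φ₁ : M →ₗ[K] N →ₗ[K] K) : Prop where
  zero (h : H) (b : B) : φ (QSA.inH K H M h) (QSA.inH K B N b) = φ₀ h b
  one (m : M) (n : N) : φ (QSA.inM K H M m) (QSA.inM K B N n) = φ₁ m n

end Pairing

end QSym

end

/-!
Write `S = S_H(M)` and `T = S_B(N)`. A Hopf pairing `S × T → K` is the same as an algebra
homomorphism from `S` to the convolution algebra `T^*` which is also compatible with the
multiplication of `T`. On the generators it has to be `h ↦ φ₀(h, -)` and `m ↦ φ₁(m, -)`, extended by
zero to the other degrees; what has to be shown is that this assignment respects the relations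
of `S`. Let `Γ = dualGraph φ₀ φ₁` be the algebra generated by the pairs `(h, φ₀(h, -))` and
`(m, φ₁(m, -))` in `Cot_H(M) × Cot_B(N)^*`, and let `Γ'` be the algebra obtained in the same way with
the roles of the two couples exchanged. The first projections of `Γ` and `Γ'` are `S` and `T`.

The heart of the proof is the reciprocity law `f(y) = g(x)` for `(x, f) ∈ Γ` and `(y, g) ∈ Γ'`
(`dualGraph_reciprocity`). It is an induction on `(y, g)`. On products it uses that the
comultiplication of `Cot_H(M)` corresponds under `Γ` to the dual of the multiplication
of `Cot_B(N)` (`exists_comul_dualGraph`), which by multiplicativity need only be checked on `H`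
and `M`, where it is the definition of a pairing of couples. By reciprocity, `f` restricted to `T`
depends only on `x`, so `Γ` restricts to the graph of a linear map `S → T^*`, and the resulting
pairing is described both by `Γ` and by `Γ'`. The first description gives its multiplicativity
in `S`, the second that in `T`. Compatibility with the antipodes is automatic (`pairing_antipode`),
and the pairing is graded because `Γ` is (`mem_iSup_dualGraphDeg`).

If `φ₀` and `φ₁` are non-degenerate, the forms in `Γ'` separate all elements of `Cot_H(M)`, not only
those of `S` (`eq_zero_of_dualGraph`): convolution with `φ₁(-, n)` corresponds to splitting off the
first tensor factor of an element of `M^{□k}`, and one argues by induction on `k`. Conversely, the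
pairing of `H` or `M` with `T` only sees the components of degrees zero and one, so a non-degenerate
pairing restricts to non-degenerate ones.
-/

open scoped TensorProduct DirectSum
open Coalgebra

noncomputable section

namespace QSym

attribute [local instance] linearMap_zeroHomClass linearMap_addHomClass
  linearMap_addMonoidHomClass linearEquiv_zeroHomClass linearEquiv_addHomClass
  linearEquiv_addMonoidHomClass SMulZeroClass.toSMul DistribSMul.toSMulZeroClass
  DistribMulAction.toDistribSMul Module.toDistribMulAction AddMonoid.toAddZeroClass
  AddCommMonoid.toAddMonoid AddCommGroup.toAddCommMonoid

open HopfBimodule WithConv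

/-! ### Linear forms on tensor products -/

section LinearForms

variable {K A C : Type*} [Field K]

lemma eq_zero_of_slices {V W : Type*} [AddCommGroup V] [Module K V] [AddCommGroup W] [Module K W]
    {z : V ⊗[K] W} (h : ∀ l : V →ₗ[K] K, TensorProduct.lid K W (l.rTensor W z) = 0) : z = 0 := by
  classical
  let b := Module.Basis.ofVectorSpace K V
  refine (TensorProduct.equivFinsuppOfBasisLeft b).injective (Finsupp.ext fun i => ?_)
  rw [TensorProduct.equivFinsuppOfBasisLeft_apply, h, map_zero, Finsupp.zero_apply]

lemma mul'_map_map_congr {X Y : Type*} [AddCommGroup X] [Module K X] [AddCommGroup Y]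
    [Module K Y] [AddCommGroup A] [Module K A] [AddCommGroup C] [Module K C] {f : X →ₗ[K] A}
    {g : Y →ₗ[K] C} {F F' : A →ₗ[K] K} {G G' : C →ₗ[K] K} (hF : ∀ x, F (f x) = F' (f x))
    (hG : ∀ x, G (g x) = G' (g x)) (w : X ⊗[K] Y) :
    LinearMap.mul' K K (TensorProduct.map F G (TensorProduct.map f g w))
      = LinearMap.mul' K K (TensorProduct.map F' G' (TensorProduct.map f g w)) := by
  induction w with
  | zero => simp
  | add a b ha hb => simp only [map_add, ha, hb]
  | tmul a b => simp [hF, hG]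

lemma mul'_map_lift_left [AddCommGroup A] [Module K A] [AddCommGroup C] [Module K C]
    (α β : A →ₗ[K] C →ₗ[K] K) (a a' : A) (v : C ⊗[K] C) :
    LinearMap.mul' K K (TensorProduct.map (TensorProduct.lift α) (TensorProduct.lift β)
      (TensorProduct.tensorTensorTensorComm K A A C C ((a ⊗ₜ a') ⊗ₜ v)))
      = LinearMap.mul' K K (TensorProduct.map (α a) (β a') v) := by
  induction v with
  | zero => simp
  | add x y hx hy => simp only [TensorProduct.tmul_add, map_add, hx, hy]
  | tmul x y => simp

lemma mul'_map_lift_right [AddCommGroup A] [Module K A] [AddCommGroup C] [Module K C]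
    (α β : A →ₗ[K] C →ₗ[K] K) (u : A ⊗[K] A) (c c' : C) :
    LinearMap.mul' K K (TensorProduct.map (TensorProduct.lift α) (TensorProduct.lift β)
      (TensorProduct.tensorTensorTensorComm K A A C C (u ⊗ₜ (c ⊗ₜ c'))))
      = LinearMap.mul' K K (TensorProduct.map (α.flip c) (β.flip c') u) := by
  induction u with
  | zero => simp
  | add x y hx hy => simp only [TensorProduct.add_tmul, map_add, hx, hy]
  | tmul x y => simp

end LinearForms

/-! ### Hopf pairings and antipodes -/

section HopfPairing

variable {K A C : Type*} [Field K] [Ring A] [HopfAlgebra K A] [Ring C] [HopfAlgebra K C]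

/-- A pairing of bialgebras between Hopf algebras is compatible with the antipodes: both
`φ(S(a), c)` and `φ(a, S(c))` are inverse to `φ` with respect to the convolution of linear forms on
`A ⊗ C`. -/
lemma pairing_antipode {φ : A →ₗ[K] C →ₗ[K] K} (one_left : ∀ c, φ 1 c = counit (R := K) c)
    (one_right : ∀ a, φ a 1 = counit (R := K) a)
    (mul_right : ∀ a b c, φ a (b * c)
      = LinearMap.mul' K K (TensorProduct.map (φ.flip b) (φ.flip c) (comul (R := K) a)))
    (mul_left : ∀ a c b, φ (a * c) b
      = LinearMap.mul' K K (TensorProduct.map (φ a) (φ c) (comul (R := K) b))) (a : A) (c : C) :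
    φ (HopfAlgebra.antipode K a) c = φ a (HopfAlgebra.antipode K c) := by
  have h1 : toConv (TensorProduct.lift (φ ∘ₗ HopfAlgebra.antipode K))
      * toConv (TensorProduct.lift φ) = 1 := by
    refine ofConv_injective (TensorProduct.ext' fun a c => ?_)
    have e : ∀ u : A ⊗[K] A, LinearMap.mul' K K (TensorProduct.map
        (TensorProduct.lift (φ ∘ₗ HopfAlgebra.antipode K)) (TensorProduct.lift φ)
        (TensorProduct.tensorTensorTensorComm K A A C C (u ⊗ₜ comul (R := K) c)))
        = φ (LinearMap.mul' K A ((HopfAlgebra.antipode K).rTensor A u)) c := by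
      intro u
      induction u with
      | zero => simp
      | add x y hx hy => simp only [TensorProduct.add_tmul, map_add, hx, hy, LinearMap.add_apply]
      | tmul x y =>
        rw [mul'_map_lift_left, LinearMap.rTensor_tmul, LinearMap.mul'_apply, mul_left,
          LinearMap.comp_apply]
    refine (e (comul a)).trans ?_
    rw [HopfAlgebra.mul_antipode_rTensor_comul_apply, Algebra.algebraMap_eq_smul_one, map_smul,
      LinearMap.smul_apply, one_left, LinearMap.convOne_apply, TensorProduct.counit_tmul]
    simp [mul_comm]
  have h2 : toConv (TensorProduct.lift φ)
      * toConv (TensorProduct.lift (φ.compl₂ (HopfAlgebra.antipode K))) = 1 := by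
    refine ofConv_injective (TensorProduct.ext' fun a c => ?_)
    have e : ∀ v : C ⊗[K] C, LinearMap.mul' K K (TensorProduct.map
        (TensorProduct.lift φ) (TensorProduct.lift (φ.compl₂ (HopfAlgebra.antipode K)))
        (TensorProduct.tensorTensorTensorComm K A A C C (comul (R := K) a ⊗ₜ v)))
        = φ a (LinearMap.mul' K C ((HopfAlgebra.antipode K).lTensor C v)) := by
      intro v
      induction v with
      | zero => simp
      | add x y hx hy => simp only [TensorProduct.tmul_add, map_add, hx, hy]
      | tmul x y =>
        rw [mul'_map_lift_right, LinearMap.lTensor_tmul, LinearMap.mul'_apply, mul_right]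
        rfl
    refine (e (comul c)).trans ?_
    rw [HopfAlgebra.mul_antipode_lTensor_comul_apply, Algebra.algebraMap_eq_smul_one, map_smul,
      one_right, LinearMap.convOne_apply, TensorProduct.counit_tmul]
    simp
  exact congr($(left_inv_eq_right_inv h1 h2).ofConv (a ⊗ₜ c))

lemma IsHopfPairing.flip {φ : A →ₗ[K] C →ₗ[K] K} (h : IsHopfPairing φ) :
    IsHopfPairing φ.flip where
  one_left := h.one_right
  one_right := h.one_left
  mul_right a b c := h.mul_left b c a
  mul_left a b c := h.mul_right c a b
  antipode a b := (h.antipode b a).symm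

end HopfPairing

/-! ### Convolution algebras of linear forms -/

section ConvolutionDual

variable {K C D : Type*} [Field K]

/-- External products of linear forms, as a homomorphism from the tensor product of two
convolution algebras to the convolution algebra of the tensor product. -/
def tensorDual (K C D : Type*) [Field K] [AddCommGroup C] [Module K C] [Coalgebra K C]
    [AddCommGroup D] [Module K D] [Coalgebra K D] :
    WithConv (C →ₗ[K] K) ⊗[K] WithConv (D →ₗ[K] K) →ₐ[K] WithConv (C ⊗[K] D →ₗ[K] K) :=
  Algebra.TensorProduct.algHomOfLinearMapTensorProduct
    (TensorProduct.lift (LinearMap.mk₂ K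
      (fun f g => toConv (LinearMap.mul' K K ∘ₗ TensorProduct.map f.ofConv g.ofConv))
      (fun f f' g => by
        refine ofConv_injective (TensorProduct.ext' fun x y => ?_)
        simp [add_mul])
      (fun c f g => by
        refine ofConv_injective (TensorProduct.ext' fun x y => ?_)
        simp [mul_assoc])
      (fun f g g' => by
        refine ofConv_injective (TensorProduct.ext' fun x y => ?_)
        simp [mul_add])
      (fun c f g => by
        refine ofConv_injective (TensorProduct.ext' fun x y => ?_)
        simp [mul_left_comm])))
    (fun f f' g g' => by
      simp only [TensorProduct.lift.tmul, LinearMap.mk₂_apply]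
      have h := LinearMap.algHom_comp_convMul_distrib (Algebra.TensorProduct.lmul' K (S := K))
        (toConv (TensorProduct.map f.ofConv g.ofConv))
        (toConv (TensorProduct.map f'.ofConv g'.ofConv))
      rw [TensorProduct.map_convMul_map] at h
      exact ofConv_injective h)
    (by
      refine ofConv_injective (TensorProduct.ext' fun x y => ?_)
      simp [mul_comm])

@[simp] lemma tensorDual_tmul_tmul [AddCommGroup C] [Module K C] [Coalgebra K C]
    [AddCommGroup D] [Module K D] [Coalgebra K D] (f : WithConv (C →ₗ[K] K))
    (g : WithConv (D →ₗ[K] K)) (x : C) (y : D) :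
    (tensorDual K C D (f ⊗ₜ g)).ofConv (x ⊗ₜ y) = f.ofConv x * g.ofConv y := rfl

variable [Ring C] [Bialgebra K C]

/-- The comultiplication `f ↦ (x ⊗ y ↦ f(xy))` on the linear forms of a bialgebra, with values in
the linear forms on the tensor square. -/
def mulDual (K C : Type*) [Field K] [Ring C] [Bialgebra K C] :
    WithConv (C →ₗ[K] K) →ₐ[K] WithConv (C ⊗[K] C →ₗ[K] K) :=
  AlgHom.ofLinearMap
    { toFun := fun f => toConv (f.ofConv ∘ₗ LinearMap.mul' K C)
      map_add' := fun _ _ => rfl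
      map_smul' := fun _ _ => rfl }
    (ofConv_injective (TensorProduct.ext' fun x y =>
      (Bialgebra.counit_mul x y).trans (mul_comm _ _)))
    (fun f g => ofConv_injective (LinearMap.convMul_comp_coalgHom_distrib f g
      (Bialgebra.mulCoalgHom K C)))

@[simp] lemma mulDual_apply (f : WithConv (C →ₗ[K] K)) (x y : C) :
    (mulDual K C f).ofConv (x ⊗ₜ y) = f.ofConv (x * y) := rfl

end ConvolutionDual

section CouplePairing

variable {K : Type*} [Field K] {H : Type*} {M : Type*} [Ring H] [HopfAlgebra K H]
    [AddCommGroup M] [Module K M] [Module H M] [Module Hᵐᵒᵖ M] [IsScalarTower K H M]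
    [IsScalarTower K Hᵐᵒᵖ M] [SMulCommClass H Hᵐᵒᵖ M] [HopfBimodule K H M]
    {B : Type*} {N : Type*} [Ring B] [HopfAlgebra K B]
    [AddCommGroup N] [Module K N] [Module B N] [Module Bᵐᵒᵖ N] [IsScalarTower K B N]
    [IsScalarTower K Bᵐᵒᵖ N] [SMulCommClass B Bᵐᵒᵖ N] [HopfBimodule K B N]
    {φ₀ : H →ₗ[K] B →ₗ[K] K} {φ₁ : M →ₗ[K] N →ₗ[K] K}

/-! ### Pairings of couples -/

lemma IsCouplePairing.flip (h : IsCouplePairing φ₀ φ₁) : IsCouplePairing φ₀.flip φ₁.flip where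
  hopf := h.hopf.flip
  left b c n m := h.right b c m n
  right b c n m := h.left b c m n

lemma tripleForm_coactLR_counit_right (f : B →ₗ[K] K) (g : N →ₗ[K] K) (n : N) :
    tripleForm f g (counit (R := K)) (coactLR K B N n)
      = LinearMap.mul' K K (TensorProduct.map f g (coactL n)) := by
  have e : ∀ w : N ⊗[K] B, LinearMap.mul' K K (TensorProduct.map g (counit (R := K)) w)
      = g (TensorProduct.rid K N ((counit (R := K)).lTensor N w)) := by
    intro w
    induction w with
    | zero => simp
    | add a b ha hb => simp only [map_add, ha, hb]
    | tmul a b => simp [mul_comm]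
  rw [coactLR, LinearMap.comp_apply]
  induction coactL (K := K) (H := B) n with
  | zero => simp
  | add a b ha hb => simp only [map_add, ha, hb]
  | tmul a b => simp [tripleForm, e, Cot.rid_coactR]

lemma lid_coactL (n : N) : TensorProduct.lid K N ((counit (R := K)).rTensor N
    (coactL (H := B) n)) = n := congr($(counitL (K := K) (H := B) (M := N)) n)

lemma tripleForm_coactLR_counit_left (g : N →ₗ[K] K) (f : B →ₗ[K] K) (n : N) :
    tripleForm (counit (R := K)) g f (coactLR K B N n)
      = LinearMap.mul' K K (TensorProduct.map g f (coactR n)) := by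
  have e : ∀ w : B ⊗[K] N, tripleForm (counit (R := K)) g f (coactR.lTensor B w)
      = LinearMap.mul' K K (TensorProduct.map g f (coactR
        (TensorProduct.lid K N ((counit (R := K)).rTensor N w)))) := by
    intro w
    induction w with
    | zero => simp
    | add a b ha hb => simp only [map_add, ha, hb]
    | tmul a b => simp [tripleForm]
  rw [coactLR, LinearMap.comp_apply, e, lid_coactL]

/-- `φ₁(h.m, n) = ∑ φ₀(h, n₋₁) φ₁(m, n₀)` -/
lemma IsCouplePairing.smul (hφ : IsCouplePairing φ₀ φ₁) (h : H) (m : M) (n : N) :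
    φ₁ (h • m) n = LinearMap.mul' K K (TensorProduct.map (φ₀ h) (φ₁ m) (coactL n)) := by
  have h1 : φ₀ 1 = counit := LinearMap.ext hφ.hopf.one_left
  simpa [h1, tripleForm_coactLR_counit_right] using hφ.left h 1 m n

/-- `φ₁(m.h, n) = ∑ φ₁(m, n₀) φ₀(h, n₁)` -/
lemma IsCouplePairing.op_smul (hφ : IsCouplePairing φ₀ φ₁) (h : H) (m : M) (n : N) :
    φ₁ (MulOpposite.op h • m) n
      = LinearMap.mul' K K (TensorProduct.map (φ₁ m) (φ₀ h) (coactR n)) := by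
  have h1 : φ₀ 1 = counit := LinearMap.ext hφ.hopf.one_left
  simpa [h1, tripleForm_coactLR_counit_left] using hφ.left 1 h m n

/-! ### The algebra of pairs of dual elements -/

/-- The linear form `φ₀(h, -)` on `B`, extended by zero to `Cot_B(N)`. -/
def formH (N : Type*) [AddCommGroup N] [Module K N] [Module B N] [Module Bᵐᵒᵖ N]
    [IsScalarTower K B N] [IsScalarTower K Bᵐᵒᵖ N] [SMulCommClass B Bᵐᵒᵖ N] [HopfBimodule K B N]
    (φ₀ : H →ₗ[K] B →ₗ[K] K) (h : H) : WithConv (Cot K B N →ₗ[K] K) :=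
  toConv (φ₀ h ∘ₗ Cot.prH K B N)

/-- The linear form `φ₁(m, -)` on `N`, extended by zero to `Cot_B(N)`. -/
def formM (B : Type*) [Ring B] [HopfAlgebra K B] [Module B N] [Module Bᵐᵒᵖ N]
    [IsScalarTower K B N] [IsScalarTower K Bᵐᵒᵖ N] [SMulCommClass B Bᵐᵒᵖ N] [HopfBimodule K B N]
    (φ₁ : M →ₗ[K] N →ₗ[K] K) (m : M) : WithConv (Cot K B N →ₗ[K] K) :=
  toConv (φ₁ m ∘ₗ Cot.prM K B N)

/-- The algebra of pairs `(x, f)`, where `x ∈ Cot_H(M)` is a polynomial in elements of `H` and `M`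
and `f` is the same polynomial in the corresponding linear forms on `Cot_B(N)`, multiplied by
convolution. Over a couple pairing, its restriction to `S_B(N)` is the graph of the pairing. -/
def dualGraph (φ₀ : H →ₗ[K] B →ₗ[K] K) (φ₁ : M →ₗ[K] N →ₗ[K] K) :
    Subalgebra K (Cot K H M × WithConv (Cot K B N →ₗ[K] K)) :=
  Algebra.adjoin K (Set.range (fun h => (Cot.inH K H M h, formH N φ₀ h))
    ∪ Set.range (fun m => (Cot.inM K H M m, formM B φ₁ m)))

lemma inH_mem_dualGraph (h : H) : (Cot.inH K H M h, formH N φ₀ h) ∈ dualGraph φ₀ φ₁ :=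
  Algebra.subset_adjoin (Or.inl ⟨h, rfl⟩)

lemma inM_mem_dualGraph (m : M) : (Cot.inM K H M m, formM B φ₁ m) ∈ dualGraph φ₀ φ₁ :=
  Algebra.subset_adjoin (Or.inr ⟨m, rfl⟩)

/-- Evaluation at `B` of the forms in `dualGraph`. -/
lemma dualGraph_inH (hφ : IsCouplePairing φ₀ φ₁) {z : Cot K H M × WithConv (Cot K B N →ₗ[K] K)}
    (hz : z ∈ dualGraph φ₀ φ₁) (b : B) :
    z.2.ofConv (Cot.inH K B N b) = φ₀ (Cot.prH K H M z.1) b := by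
  induction hz using Algebra.adjoin_induction generalizing b with
  | mem z hz =>
    rcases hz with ⟨h, rfl⟩ | ⟨m, rfl⟩
    · simp [formH]
    · simp [formM, Cot.inM]
  | algebraMap r =>
    change (algebraMap K (WithConv (Cot K B N →ₗ[K] K)) r).ofConv _
      = φ₀ (Cot.prH K H M (algebraMap K (Cot K H M) r)) b
    rw [Algebra.algebraMap_eq_smul_one (A := Cot K H M), map_smul, Cot.one_def, Cot.prH_inH,
      map_smul, LinearMap.smul_apply, hφ.hopf.one_left]
    change r • counit (R := K) (Cot.prH K B N (Cot.inH K B N b)) = _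
    rw [Cot.prH_inH]
  | add x y _ _ hx hy => simp [hx, hy]
  | mul x y _ _ hx hy =>
    rw [Prod.snd_mul, Prod.fst_mul, LinearMap.convMul_apply, Cot.comul_eq, Cot.dlt_inH,
      map_map_eq (h := φ₀ (Cot.prH K H M x.1)) (k := φ₀ (Cot.prH K H M y.1)) hx hy,
      Cot.prH_mul, hφ.hopf.mul_left]

/-- Evaluation at `N` of the forms in `dualGraph`. -/
lemma dualGraph_inM (hφ : IsCouplePairing φ₀ φ₁) {z : Cot K H M × WithConv (Cot K B N →ₗ[K] K)}
    (hz : z ∈ dualGraph φ₀ φ₁) (n : N) :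
    z.2.ofConv (Cot.inM K B N n) = φ₁ (Cot.prM K H M z.1) n := by
  induction hz using Algebra.adjoin_induction generalizing n with
  | mem z hz =>
    rcases hz with ⟨h, rfl⟩ | ⟨m, rfl⟩
    · simp [formH, Cot.inM]
    · simp [formM, Cot.inM, Cot.prM]
  | algebraMap r =>
    change (algebraMap K (WithConv (Cot K B N →ₗ[K] K)) r).ofConv _
      = φ₁ (Cot.prM K H M (algebraMap K (Cot K H M) r)) n
    rw [Algebra.algebraMap_eq_smul_one (A := Cot K H M), map_smul, Cot.one_def, Cot.prM_inH]
    change r • counit (R := K) (Cot.prH K B N (Cot.inM K B N n)) = _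
    simp [Cot.inM]
  | add x y _ _ hx hy => simp [hx, hy]
  | mul x y hxm hym hx hy =>
    rw [Prod.snd_mul, Prod.fst_mul, LinearMap.convMul_apply, Cot.comul_eq, Cot.dlt_inM, map_add,
      map_add, map_map_eq (h := φ₀ (Cot.prH K H M x.1)) (k := φ₁ (Cot.prM K H M y.1))
        (dualGraph_inH hφ hxm) hy,
      map_map_eq (h := φ₁ (Cot.prM K H M x.1)) (k := φ₀ (Cot.prH K H M y.1)) hx
        (dualGraph_inH hφ hym),
      Cot.prM_mul, map_add, LinearMap.add_apply, hφ.smul, hφ.op_smul]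

variable (φ₀ φ₁) in
/-- The projection `(x, f) ↦ x`. -/
def graphFst : dualGraph φ₀ φ₁ →ₐ[K] Cot K H M := (AlgHom.fst K _ _).comp (dualGraph φ₀ φ₁).val

variable (φ₀ φ₁) in
/-- The projection `(x, f) ↦ f`. -/
def graphSnd : dualGraph φ₀ φ₁ →ₐ[K] WithConv (Cot K B N →ₗ[K] K) :=
  (AlgHom.snd K _ _).comp (dualGraph φ₀ φ₁).val

variable (φ₀ φ₁) in
/-- The generators of `dualGraph` coming from `H`. -/
def graphH : H →ₗ[K] dualGraph φ₀ φ₁ where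
  toFun := fun h => ⟨_, inH_mem_dualGraph h⟩
  map_add' := fun a b => Subtype.ext (Prod.ext (map_add _ _ _)
    (ofConv_injective (LinearMap.ext fun y => by simp [formH])))
  map_smul' := fun a b => Subtype.ext (Prod.ext (map_smul _ _ _)
    (ofConv_injective (LinearMap.ext fun y => by simp [formH])))

variable (φ₀ φ₁) in
/-- The generators of `dualGraph` coming from `M`. -/
def graphM : M →ₗ[K] dualGraph φ₀ φ₁ where
  toFun := fun h => ⟨_, inM_mem_dualGraph h⟩
  map_add' := fun a b => Subtype.ext (Prod.ext (map_add _ _ _)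
    (ofConv_injective (LinearMap.ext fun y => by simp [formM])))
  map_smul' := fun a b => Subtype.ext (Prod.ext (map_smul _ _ _)
    (ofConv_injective (LinearMap.ext fun y => by simp [formM])))

lemma graphFst_graphH (h : H) : graphFst φ₀ φ₁ (graphH φ₀ φ₁ h) = Cot.inH K H M h := rfl

lemma graphFst_graphM (m : M) : graphFst φ₀ φ₁ (graphM φ₀ φ₁ m) = Cot.inM K H M m := rfl

lemma map_graphFst_map {X Y : Type*} [AddCommGroup X] [Module K X] [AddCommGroup Y]
    [Module K Y] (f : X →ₗ[K] dualGraph φ₀ φ₁) (g : Y →ₗ[K] dualGraph φ₀ φ₁)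
    (F : X →ₗ[K] Cot K H M) (G : Y →ₗ[K] Cot K H M)
    (hF : ∀ x, graphFst φ₀ φ₁ (f x) = F x) (hG : ∀ x, graphFst φ₀ φ₁ (g x) = G x) (w : X ⊗[K] Y) :
    TensorProduct.map (graphFst φ₀ φ₁).toLinearMap (graphFst φ₀ φ₁).toLinearMap
      (TensorProduct.map f g w) = TensorProduct.map F G w := by
  induction w with
  | zero => simp only [map_zero]
  | add a b ha hb => simp only [map_add, ha, hb]
  | tmul a b => simp only [TensorProduct.map_tmul, AlgHom.toLinearMap_apply, hF, hG]

lemma tensorDual_graphSnd_map {X Y : Type*} [AddCommGroup X] [Module K X] [AddCommGroup Y]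
    [Module K Y] (f : X →ₗ[K] dualGraph φ₀ φ₁) (g : Y →ₗ[K] dualGraph φ₀ φ₁) (w : X ⊗[K] Y)
    (y y' : Cot K B N) (F : X →ₗ[K] K) (G : Y →ₗ[K] K)
    (hF : ∀ x, (graphSnd φ₀ φ₁ (f x)).ofConv y = F x)
    (hG : ∀ x, (graphSnd φ₀ φ₁ (g x)).ofConv y' = G x) :
    (tensorDual K _ _ (TensorProduct.map (graphSnd φ₀ φ₁).toLinearMap
        (graphSnd φ₀ φ₁).toLinearMap (TensorProduct.map f g w))).ofConv (y ⊗ₜ y')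
      = LinearMap.mul' K K (TensorProduct.map F G w) := by
  induction w with
  | zero => simp only [map_zero, ofConv_zero, LinearMap.zero_apply]
  | add a b ha hb => simp only [map_add, ofConv_add, LinearMap.add_apply, ha, hb]
  | tmul a b =>
    simp only [TensorProduct.map_tmul, tensorDual_tmul_tmul, LinearMap.mul'_apply,
      AlgHom.toLinearMap_apply, hF, hG]

variable (φ₀ φ₁) in
/-- The homomorphism `(x, f) ⊗ (x', f') ↦ (x ⊗ x', f ⊗ f')`. -/
def graphTensor : dualGraph φ₀ φ₁ ⊗[K] dualGraph φ₀ φ₁ →ₐ[K]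
    (Cot K H M ⊗[K] Cot K H M) × WithConv (Cot K B N ⊗[K] Cot K B N →ₗ[K] K) :=
  (Algebra.TensorProduct.map (graphFst φ₀ φ₁) (graphFst φ₀ φ₁)).prod
    ((tensorDual K _ _).comp (Algebra.TensorProduct.map (graphSnd φ₀ φ₁) (graphSnd φ₀ φ₁)))

variable (K H M B N) in
/-- The homomorphism `(x, f) ↦ (∑ x₁ ⊗ x₂, y ⊗ y' ↦ f(yy'))`. -/
def graphComul : Cot K H M × WithConv (Cot K B N →ₗ[K] K) →ₐ[K]
    (Cot K H M ⊗[K] Cot K H M) × WithConv (Cot K B N ⊗[K] Cot K B N →ₗ[K] K) :=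
  ((Bialgebra.comulAlgHom K (Cot K H M)).comp (AlgHom.fst K _ _)).prod
    ((mulDual K _).comp (AlgHom.snd K _ _))

lemma graphTensor_fst (w : dualGraph φ₀ φ₁ ⊗[K] dualGraph φ₀ φ₁) : (graphTensor φ₀ φ₁ w).1
    = TensorProduct.map (graphFst φ₀ φ₁).toLinearMap (graphFst φ₀ φ₁).toLinearMap w := rfl

lemma graphTensor_snd (w : dualGraph φ₀ φ₁ ⊗[K] dualGraph φ₀ φ₁) : (graphTensor φ₀ φ₁ w).2
    = tensorDual K _ _ (TensorProduct.map (graphSnd φ₀ φ₁).toLinearMap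
        (graphSnd φ₀ φ₁).toLinearMap w) := rfl

lemma graphComul_fst (z : Cot K H M × WithConv (Cot K B N →ₗ[K] K)) :
    (graphComul K H M B N z).1 = comul (R := K) z.1 := rfl

lemma graphComul_snd (z : Cot K H M × WithConv (Cot K B N →ₗ[K] K)) :
    (graphComul K H M B N z).2 = mulDual K _ z.2 := rfl

lemma graphComul_inH (hφ : IsCouplePairing φ₀ φ₁) (h : H) :
    graphTensor φ₀ φ₁ (TensorProduct.map (graphH φ₀ φ₁) (graphH φ₀ φ₁) (comul h))
      = graphComul K H M B N (Cot.inH K H M h, formH N φ₀ h) := by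
  refine Prod.ext ?_ ?_
  · rw [graphTensor_fst, graphComul_fst, Cot.comul_eq, Cot.dlt_inH]
    exact map_graphFst_map _ _ _ _ graphFst_graphH graphFst_graphH _
  · refine ofConv_injective (TensorProduct.ext' fun y y' => ?_)
    rw [graphTensor_snd, graphComul_snd, mulDual_apply]
    refine (tensorDual_graphSnd_map _ _ _ y y' (φ₀.flip (Cot.prH K B N y))
      (φ₀.flip (Cot.prH K B N y')) (fun _ => rfl) (fun _ => rfl)).trans ?_
    change _ = φ₀ h (Cot.prH K B N (y * y'))
    rw [Cot.prH_mul, hφ.hopf.mul_right]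

lemma graphComul_inM (hφ : IsCouplePairing φ₀ φ₁) (m : M) :
    graphTensor φ₀ φ₁ (TensorProduct.map (graphH φ₀ φ₁) (graphM φ₀ φ₁) (coactL m)
        + TensorProduct.map (graphM φ₀ φ₁) (graphH φ₀ φ₁) (coactR m))
      = graphComul K H M B N (Cot.inM K H M m, formM B φ₁ m) := by
  refine Prod.ext ?_ ?_
  · rw [graphTensor_fst, graphComul_fst, Cot.comul_eq, Cot.dlt_inM, map_add]
    exact congrArg₂ (· + ·) (map_graphFst_map _ _ _ _ graphFst_graphH graphFst_graphM _)
      (map_graphFst_map _ _ _ _ graphFst_graphM graphFst_graphH _)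
  · refine ofConv_injective (TensorProduct.ext' fun y y' => ?_)
    rw [graphTensor_snd, graphComul_snd, mulDual_apply, map_add, map_add, ofConv_add,
      LinearMap.add_apply]
    refine (congrArg₂ (· + ·)
      (tensorDual_graphSnd_map _ _ _ y y' (φ₀.flip (Cot.prH K B N y))
        (φ₁.flip (Cot.prM K B N y')) (fun _ => rfl) (fun _ => rfl))
      (tensorDual_graphSnd_map _ _ _ y y' (φ₁.flip (Cot.prM K B N y))
        (φ₀.flip (Cot.prH K B N y')) (fun _ => rfl) (fun _ => rfl))).trans ?_
    have h1 := hφ.flip.smul (Cot.prH K B N y) (Cot.prM K B N y') m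
    have h2 := hφ.flip.op_smul (Cot.prH K B N y') (Cot.prM K B N y) m
    simp only [LinearMap.flip_apply] at h1 h2
    change _ = φ₁ m (Cot.prM K B N (y * y'))
    rw [Cot.prM_mul, map_add, h1, h2]

/-- The comultiplication of `Cot_H(M)` is dual to the multiplication of `Cot_B(N)` under the
correspondence `dualGraph`. Both sides being multiplicative, this is a statement about generators,
where it says that `φ₀` and `φ₁` turn the multiplication of `B` and its actions on `N` into the
comultiplication of `H` and its coactions on `M`. -/
lemma exists_comul_dualGraph (hφ : IsCouplePairing φ₀ φ₁)
    {z : Cot K H M × WithConv (Cot K B N →ₗ[K] K)} (hz : z ∈ dualGraph φ₀ φ₁) :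
    ∃ w : dualGraph φ₀ φ₁ ⊗[K] dualGraph φ₀ φ₁,
      TensorProduct.map (graphFst φ₀ φ₁).toLinearMap (graphFst φ₀ φ₁).toLinearMap w
        = comul (R := K) z.1 ∧
      tensorDual K _ _ (TensorProduct.map (graphSnd φ₀ φ₁).toLinearMap
        (graphSnd φ₀ φ₁).toLinearMap w) = mulDual K _ z.2 := by
  have key : dualGraph φ₀ φ₁ ≤ (graphTensor φ₀ φ₁).range.comap (graphComul K H M B N) := by
    refine Algebra.adjoin_le ?_
    rintro _ (⟨h, rfl⟩ | ⟨m, rfl⟩)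
    · exact ⟨_, graphComul_inH hφ h⟩
    · exact ⟨_, graphComul_inM hφ m⟩
  obtain ⟨w, hw⟩ := key hz
  exact ⟨w, congrArg Prod.fst hw, congrArg Prod.snd hw⟩

/-- Reciprocity: a form attached to `x ∈ Cot_H(M)` takes at `y ∈ Cot_B(N)` the same value as a form
attached to `y` takes at `x`. -/
lemma dualGraph_reciprocity (hφ : IsCouplePairing φ₀ φ₁)
    {z : Cot K H M × WithConv (Cot K B N →ₗ[K] K)} (hz : z ∈ dualGraph φ₀ φ₁)
    {z' : Cot K B N × WithConv (Cot K H M →ₗ[K] K)} (hz' : z' ∈ dualGraph φ₀.flip φ₁.flip) :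
    z.2.ofConv z'.1 = z'.2.ofConv z.1 := by
  induction hz' using Algebra.adjoin_induction generalizing z with
  | mem z' hz' =>
    rcases hz' with ⟨b, rfl⟩ | ⟨n, rfl⟩
    · exact dualGraph_inH hφ hz b
    · exact dualGraph_inM hφ hz n
  | algebraMap r =>
    change z.2.ofConv (algebraMap K (Cot K B N) r) = r • counit (Cot.prH K H M z.1)
    rw [Algebra.algebraMap_eq_smul_one (A := Cot K B N), map_smul, Cot.one_def,
      dualGraph_inH hφ hz, hφ.hopf.one_right]
  | add x y _ _ hx hy =>
    rw [Prod.fst_add, Prod.snd_add, map_add, hx hz, hy hz, ofConv_add, LinearMap.add_apply]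
  | mul x y hxm hym hx hy =>
    obtain ⟨w, hw1, hw2⟩ := exists_comul_dualGraph hφ hz
    rw [Prod.snd_mul, Prod.fst_mul, LinearMap.convMul_apply, ← hw1, ← mulDual_apply, ← hw2]
    clear hw1 hw2
    induction w with
    | zero => simp
    | add a b ha hb => simp only [map_add, ofConv_add, LinearMap.add_apply, ha, hb]
    | tmul a b =>
      simp only [TensorProduct.map_tmul, tensorDual_tmul_tmul, LinearMap.mul'_apply]
      exact congrArg₂ (· * ·) (hx a.2) (hy b.2)

/-! ### Gradings -/

namespace Cot

lemma inH_mem_deg (h : H) : inH K H M h ∈ deg K H M 0 := ⟨h, rfl⟩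

lemma inM_mem_deg (m : M) : inM K H M m ∈ deg K H M 1 := ⟨_, rfl⟩

lemma mem_deg_zero {x : Cot K H M} (h : ∀ n, prP K H M n x = 0) : x ∈ deg K H M 0 :=
  ⟨prH K H M x, ext' (by simp) fun n => by simp [h]⟩

lemma mem_deg_succ {d : ℕ} {x : Cot K H M} (h0 : prH K H M x = 0)
    (h : ∀ n, n ≠ d → prP K H M n x = 0) : x ∈ deg K H M (d + 1) := by
  refine ⟨prP K H M d x, ext' (by simp [h0]) fun n => ?_⟩
  by_cases hn : n = d
  · rw [hn, prP_inP]
  · rw [prP_inP_ne hn, h n hn]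

lemma prH_of_mem_deg {d : ℕ} (hd : d ≠ 0) {x : Cot K H M} (hx : x ∈ deg K H M d) :
    prH K H M x = 0 := by
  cases d with
  | zero => exact absurd rfl hd
  | succ d => obtain ⟨p, rfl⟩ := hx; simp

lemma prP_of_mem_deg {d n : ℕ} (hd : d ≠ n + 1) {x : Cot K H M} (hx : x ∈ deg K H M d) :
    prP K H M n x = 0 := by
  cases d with
  | zero => obtain ⟨h, rfl⟩ := hx; simp
  | succ d => obtain ⟨p, rfl⟩ := hx; exact prP_inP_ne (by omega) p

/-- A homogeneous sum of homogeneous elements has no components of other degrees. -/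
lemma eq_zero_of_sum_mem_deg {s : Finset ℕ} {x : ℕ → Cot K H M} (hx : ∀ k, x k ∈ deg K H M k)
    {i j : ℕ} (hij : i ≠ j) (hj : j ∈ s) (hs : ∑ k ∈ s, x k ∈ deg K H M i) : x j = 0 := by
  cases j with
  | zero =>
    have h := prH_of_mem_deg hij hs
    rw [map_sum, Finset.sum_eq_single_of_mem 0 hj fun k _ hk => prH_of_mem_deg hk (hx k)] at h
    exact ext' (by rw [h, map_zero])
      fun n => by rw [prP_of_mem_deg (by omega) (hx 0), map_zero]
  | succ j =>
    have h := prP_of_mem_deg hij hs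
    rw [map_sum, Finset.sum_eq_single_of_mem _ hj fun k _ hk => prP_of_mem_deg hk (hx k)] at h
    refine ext' (by rw [prH_of_mem_deg (by omega) (hx _), map_zero]) fun n => ?_
    by_cases hn : n = j
    · rw [hn, h, map_zero]
    · rw [prP_of_mem_deg (by omega) (hx _), map_zero]

lemma mul_mem_deg {d e : ℕ} {x y : Cot K H M} (hx : x ∈ deg K H M d) (hy : y ∈ deg K H M e) :
    x * y ∈ deg K H M (d + e) := by
  have hP : ∀ n, d + e ≠ n + 1 → prP K H M n (x * y) = 0 := fun n hn =>
    (prP_lift mul_finite n (x ⊗ₜ y)).trans (liftP_mul_eq_zero n d e hn x hx y hy)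
  by_cases h : d + e = 0
  · rw [h]
    exact mem_deg_zero fun n => hP n (by omega)
  · obtain ⟨k, hk⟩ := Nat.exists_eq_succ_of_ne_zero h
    rw [hk]
    refine mem_deg_succ ?_ fun n hn => hP n (by omega)
    rw [prH_mul]
    by_cases hd : d = 0
    · rw [prH_of_mem_deg (by omega) hy, mul_zero]
    · rw [prH_of_mem_deg hd hx, zero_mul]

/-- The linear form `f` is homogeneous of degree `i`: it vanishes in the other degrees. -/
def IsHomogeneousForm (i : ℕ) (f : Cot K H M →ₗ[K] K) : Prop :=
  ∀ j, j ≠ i → ∀ x ∈ deg K H M j, f x = 0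

lemma IsHomogeneousForm.comp_ret {i : ℕ} {f : Cot K H M →ₗ[K] K} (hf : IsHomogeneousForm (i + 1) f)
    (m : M) : IsHomogeneousForm i (f ∘ₗ ret K H M ∘ₗ TensorProduct.mk K M _ m) := by
  rintro (_ | j) hj _ ⟨p, rfl⟩
  · refine hf 1 (by omega) _ ?_
    have := ret_inH (K := K) (H := H) (M := M) (m ⊗ₜ p)
    rw [LinearMap.lTensor_tmul] at this
    simp only [LinearMap.comp_apply, TensorProduct.mk_apply, this]
    exact inM_mem_deg _
  · refine hf (j + 2) (by omega) _ ?_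
    have := ret_inP (K := K) (H := H) (M := M) j (m ⊗ₜ p)
    rw [LinearMap.lTensor_tmul] at this
    simp only [LinearMap.comp_apply, TensorProduct.mk_apply, this]
    exact ⟨_, rfl⟩

lemma IsHomogeneousForm.comp_ret_eq_zero {f : Cot K H M →ₗ[K] K} (hf : IsHomogeneousForm 0 f)
    (m : M) : f ∘ₗ ret K H M ∘ₗ TensorProduct.mk K M _ m = 0 := by
  refine hom_ext (fun h => ?_) fun n p => ?_
  · have := ret_inH (K := K) (H := H) (M := M) (m ⊗ₜ h)
    rw [LinearMap.lTensor_tmul] at this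
    simp only [LinearMap.comp_apply, TensorProduct.mk_apply, this, LinearMap.zero_apply]
    exact hf 1 (by omega) _ (inM_mem_deg _)
  · have := ret_inP (K := K) (H := H) (M := M) n (m ⊗ₜ p)
    rw [LinearMap.lTensor_tmul] at this
    simp only [LinearMap.comp_apply, TensorProduct.mk_apply, this, LinearMap.zero_apply]
    exact hf (n + 2) (by omega) _ ⟨_, rfl⟩

/-- The comultiplication is graded: the product of forms of degrees `i` and `j` vanishes outside
degree `i + j`. The induction on the degree of `x` splits off the first tensor factor of `x`, which
lowers the degree of `f` by one. -/
lemma mul'_map_dlt_eq_zero {j : ℕ} {g : Cot K H M →ₗ[K] K} (hg : IsHomogeneousForm j g) :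
    ∀ (n i : ℕ) (f : Cot K H M →ₗ[K] K), IsHomogeneousForm i f → n ≠ i + j →
      ∀ x ∈ deg K H M n, LinearMap.mul' K K (TensorProduct.map f g (dlt K H M x)) = 0 := by
  have hlam : ∀ (n i : ℕ) (f : Cot K H M →ₗ[K] K), IsHomogeneousForm i f → n ≠ i + j →
      ∀ x ∈ deg K H M n, LinearMap.mul' K K (TensorProduct.map f g
        ((inH K H M).rTensor _ (lam K H M x))) = 0 := by
    intro n i f hf hn x hx
    obtain ⟨w, hw⟩ := lam_mem hx
    rw [← hw]
    clear hw
    induction w with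
    | zero => simp
    | add a b ha hb => simp only [map_add, ha, hb, add_zero]
    | tmul h y =>
      simp only [LinearMap.lTensor_tmul, LinearMap.rTensor_tmul, TensorProduct.map_tmul,
        LinearMap.mul'_apply]
      by_cases hi : i = 0
      · rw [Submodule.subtype_apply, hg n (by omega) _ y.2, mul_zero]
      · rw [hf 0 (Ne.symm hi) _ (inH_mem_deg h), zero_mul]
  intro n
  induction n with
  | zero =>
    intro i f hf hn x hx
    rw [dlt_eq, map_add, map_add, hlam 0 i f hf hn x hx]
    obtain ⟨h, rfl⟩ := hx
    simp
  | succ n ih =>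
    intro i f hf hn x hx
    rw [dlt_eq, map_add, map_add, hlam _ i f hf hn x hx, zero_add]
    obtain ⟨w, hw⟩ := unc_mem hx
    rw [← hw]
    clear hw
    induction w with
    | zero => simp
    | add a b ha hb => simp only [map_add, ha, hb, add_zero]
    | tmul m y =>
      have e : ∀ u : Cot K H M ⊗[K] Cot K H M, LinearMap.mul' K K (TensorProduct.map f g
          ((ret K H M).rTensor _ ((TensorProduct.assoc K M _ _).symm (m ⊗ₜ u))))
          = LinearMap.mul' K K (TensorProduct.map
            (f ∘ₗ ret K H M ∘ₗ TensorProduct.mk K M _ m) g u) := by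
        intro u
        induction u with
        | zero => simp
        | add a b ha hb => simp only [TensorProduct.tmul_add, map_add, ha, hb]
        | tmul a b => simp
      rw [LinearMap.lTensor_tmul, LinearMap.lTensor_tmul, e]
      cases i with
      | zero => rw [hf.comp_ret_eq_zero]; simp
      | succ i => exact ih i _ (hf.comp_ret m) (by omega) _ y.2

lemma IsHomogeneousForm.mul {i j : ℕ} {f g : WithConv (Cot K H M →ₗ[K] K)}
    (hf : IsHomogeneousForm i f.ofConv) (hg : IsHomogeneousForm j g.ofConv) :
    IsHomogeneousForm (i + j) (f * g).ofConv := fun n hn x hx =>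
  mul'_map_dlt_eq_zero hg n i _ hf hn x hx

end Cot

variable (φ₀ φ₁) in
/-- The elements of degree `i` of `dualGraph`: both components are homogeneous of degree `i`. -/
def dualGraphDeg (i : ℕ) : Submodule K (Cot K H M × WithConv (Cot K B N →ₗ[K] K)) where
  carrier := {z | z ∈ dualGraph φ₀ φ₁ ∧ z.1 ∈ Cot.deg K H M i ∧ Cot.IsHomogeneousForm i z.2.ofConv}
  zero_mem' := ⟨zero_mem _, zero_mem _, fun _ _ _ _ => rfl⟩
  add_mem' := fun hx hy => ⟨add_mem hx.1 hy.1, add_mem hx.2.1 hy.2.1, fun j hj y hyj => by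
    rw [Prod.snd_add, ofConv_add, LinearMap.add_apply, hx.2.2 j hj y hyj, hy.2.2 j hj y hyj,
      add_zero]⟩
  smul_mem' := fun c x hx => ⟨Subalgebra.smul_mem _ hx.1 c, Submodule.smul_mem _ c hx.2.1,
    fun j hj y hyj => by
      rw [Prod.smul_snd, ofConv_smul, LinearMap.smul_apply, hx.2.2 j hj y hyj, smul_zero]⟩

lemma mul_mem_dualGraphDeg {i j : ℕ} {z z' : Cot K H M × WithConv (Cot K B N →ₗ[K] K)}
    (hz : z ∈ dualGraphDeg φ₀ φ₁ i) (hz' : z' ∈ dualGraphDeg φ₀ φ₁ j) :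
    z * z' ∈ dualGraphDeg φ₀ φ₁ (i + j) :=
  ⟨mul_mem hz.1 hz'.1, Cot.mul_mem_deg hz.2.1 hz'.2.1, hz.2.2.mul hz'.2.2⟩

lemma inH_mem_dualGraphDeg (h : H) :
    (Cot.inH K H M h, formH N φ₀ h) ∈ dualGraphDeg φ₀ φ₁ 0 := by
  refine ⟨inH_mem_dualGraph h, Cot.inH_mem_deg h, fun j hj y hy => ?_⟩
  change φ₀ h (Cot.prH K B N y) = 0
  rw [Cot.prH_of_mem_deg hj hy, map_zero]

lemma inM_mem_dualGraphDeg (m : M) :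
    (Cot.inM K H M m, formM B φ₁ m) ∈ dualGraphDeg φ₀ φ₁ 1 := by
  refine ⟨inM_mem_dualGraph m, Cot.inM_mem_deg m, fun j hj y hy => ?_⟩
  change φ₁ m (Cot.prP K B N 0 y) = 0
  rw [Cot.prP_of_mem_deg hj hy]
  exact map_zero (φ₁ m)

lemma formH_one (hφ : IsCouplePairing φ₀ φ₁) : formH N φ₀ 1 = 1 :=
  ofConv_injective (LinearMap.ext fun y => hφ.hopf.one_left (Cot.prH K B N y))

/-- The algebra `dualGraph` is graded. -/
lemma mem_iSup_dualGraphDeg (hφ : IsCouplePairing φ₀ φ₁)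
    {z : Cot K H M × WithConv (Cot K B N →ₗ[K] K)} (hz : z ∈ dualGraph φ₀ φ₁) :
    z ∈ ⨆ i, dualGraphDeg φ₀ φ₁ i := by
  induction hz using Algebra.adjoin_induction with
  | mem z hz =>
    rcases hz with ⟨h, rfl⟩ | ⟨m, rfl⟩
    · exact Submodule.mem_iSup_of_mem 0 (inH_mem_dualGraphDeg h)
    · exact Submodule.mem_iSup_of_mem 1 (inM_mem_dualGraphDeg m)
  | algebraMap r =>
    rw [Algebra.algebraMap_eq_smul_one]
    refine Submodule.smul_mem _ r (Submodule.mem_iSup_of_mem 0 ?_)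
    have := inH_mem_dualGraphDeg (φ₀ := φ₀) (φ₁ := φ₁) (1 : H)
    rwa [formH_one hφ] at this
  | add x y _ _ hx hy => exact add_mem hx hy
  | mul x y hxm hym hx hy =>
    clear hxm hym
    induction hx using Submodule.iSup_induction' with
    | zero => rw [zero_mul]; exact zero_mem _
    | add a b _ _ ha hb => rw [add_mul]; exact add_mem ha hb
    | mem i a ha =>
      induction hy using Submodule.iSup_induction' with
      | zero => rw [mul_zero]; exact zero_mem _
      | add b c _ _ hb hc => rw [mul_add]; exact add_mem hb hc
      | mem j b hb => exact Submodule.mem_iSup_of_mem _ (mul_mem_dualGraphDeg ha hb)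

/-! ### The pairing of the quantum symmetric algebras -/

lemma fst_mem_QSA {z : Cot K H M × WithConv (Cot K B N →ₗ[K] K)} (hz : z ∈ dualGraph φ₀ φ₁) :
    z.1 ∈ QSA K H M := by
  have h : dualGraph φ₀ φ₁ ≤ (QSA K H M).comap (AlgHom.fst K _ _) := by
    refine Algebra.adjoin_le ?_
    rintro _ (⟨h, rfl⟩ | ⟨m, rfl⟩)
    · exact QSA.inH_mem h
    · exact QSA.inM_mem m
  exact h hz

variable (φ₀ φ₁) in
lemma exists_mem_dualGraph {x : Cot K H M} (hx : x ∈ QSA K H M) :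
    ∃ f : WithConv (Cot K B N →ₗ[K] K), (x, f) ∈ dualGraph φ₀ φ₁ := by
  have h : QSA K H M ≤ (dualGraph φ₀ φ₁).map (AlgHom.fst K _ _) := by
    refine Algebra.adjoin_le ?_
    rintro _ (⟨h, rfl⟩ | ⟨m, rfl⟩)
    · exact ⟨_, inH_mem_dualGraph h, rfl⟩
    · exact ⟨_, inM_mem_dualGraph m, rfl⟩
  obtain ⟨⟨x, f⟩, hz, rfl⟩ := h hx
  exact ⟨f, hz⟩

variable (φ₀ φ₁) in
/-- The graph of `φ : S_H(M) → S_B(N)^*` is the restriction of `dualGraph`. -/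
def IsDualGraph (φ : QSA K H M →ₗ[K] QSA K B N →ₗ[K] K) : Prop :=
  ∀ (x : QSA K H M) (f : WithConv (Cot K B N →ₗ[K] K)), ((x : Cot K H M), f) ∈ dualGraph φ₀ φ₁ →
    ∀ y : QSA K B N, φ x y = f.ofConv y

/-- By reciprocity, the forms in `dualGraph` attached to the same element of `S_H(M)` agree
on `S_B(N)`. -/
lemma ofConv_eq_of_mem_dualGraph (hφ : IsCouplePairing φ₀ φ₁) {x : Cot K H M}
    {f f' : WithConv (Cot K B N →ₗ[K] K)} (hf : (x, f) ∈ dualGraph φ₀ φ₁)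
    (hf' : (x, f') ∈ dualGraph φ₀ φ₁) (y : QSA K B N) : f.ofConv y = f'.ofConv y := by
  obtain ⟨g, hg⟩ := exists_mem_dualGraph φ₀.flip φ₁.flip y.2
  exact (dualGraph_reciprocity hφ hf hg).trans (dualGraph_reciprocity hφ hf' hg).symm

lemma exists_isDualGraph (hφ : IsCouplePairing φ₀ φ₁) :
    ∃ φ : QSA K H M →ₗ[K] QSA K B N →ₗ[K] K, IsDualGraph φ₀ φ₁ φ := by
  choose F hF using fun x : QSA K H M => exists_mem_dualGraph φ₀ φ₁ x.2
  refine ⟨LinearMap.mk₂ K (fun x y => (F x).ofConv y) (fun x x' y => ?_) (fun c x y => ?_)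
    (fun x y y' => map_add (F x).ofConv _ _) (fun c x y => map_smul (F x).ofConv _ _),
    fun x f hf y => ofConv_eq_of_mem_dualGraph hφ (hF x) hf y⟩
  · exact ofConv_eq_of_mem_dualGraph hφ (hF (x + x')) (add_mem (hF x) (hF x')) y
  · exact ofConv_eq_of_mem_dualGraph hφ (hF (c • x)) (Subalgebra.smul_mem _ (hF x) c) y

namespace IsDualGraph

variable {φ : QSA K H M →ₗ[K] QSA K B N →ₗ[K] K}

lemma flip (hφ : IsCouplePairing φ₀ φ₁) (h : IsDualGraph φ₀ φ₁ φ) :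
    IsDualGraph φ₀.flip φ₁.flip φ.flip := by
  intro y g hg x
  obtain ⟨f, hf⟩ := exists_mem_dualGraph φ₀ φ₁ x.2
  rw [LinearMap.flip_apply, h x f hf y]
  exact dualGraph_reciprocity hφ hf hg

lemma inH_apply (h : IsDualGraph φ₀ φ₁ φ) (a : H) (y : QSA K B N) :
    φ (QSA.inH K H M a) y = φ₀ a (Cot.prH K B N y) :=
  h (QSA.inH K H M a) _ (inH_mem_dualGraph a) y

lemma inM_apply (h : IsDualGraph φ₀ φ₁ φ) (m : M) (y : QSA K B N) :
    φ (QSA.inM K H M m) y = φ₁ m (Cot.prM K B N y) :=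
  h (QSA.inM K H M m) _ (inM_mem_dualGraph m) y

lemma one_apply (hφ : IsCouplePairing φ₀ φ₁) (h : IsDualGraph φ₀ φ₁ φ) (y : QSA K B N) :
    φ 1 y = counit y :=
  (h.inH_apply 1 y).trans (hφ.hopf.one_left _)

lemma mul'_map_ofConv {a c : QSA K H M} {f g : WithConv (Cot K B N →ₗ[K] K)}
    (hf : ∀ y : QSA K B N, φ a y = f.ofConv y) (hg : ∀ y : QSA K B N, φ c y = g.ofConv y)
    (w : QSA K B N ⊗[K] QSA K B N) :
    LinearMap.mul' K K (TensorProduct.map f.ofConv g.ofConv (TensorProduct.map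
      (QSA K B N).val.toLinearMap (QSA K B N).val.toLinearMap w))
      = LinearMap.mul' K K (TensorProduct.map (φ a) (φ c) w) := by
  induction w with
  | zero => simp only [map_zero]
  | add x y hx hy => simp only [map_add, hx, hy]
  | tmul x y =>
    simp only [TensorProduct.map_tmul, LinearMap.mul'_apply, AlgHom.toLinearMap_apply,
      Subalgebra.coe_val, hf, hg]

lemma mul_apply (h : IsDualGraph φ₀ φ₁ φ) (a c : QSA K H M) (y : QSA K B N) :
    φ (a * c) y = LinearMap.mul' K K (TensorProduct.map (φ a) (φ c) (comul y)) := by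
  obtain ⟨f, hf⟩ := exists_mem_dualGraph φ₀ φ₁ a.2
  obtain ⟨g, hg⟩ := exists_mem_dualGraph φ₀ φ₁ c.2
  have hm := mul_mem hf hg
  have hfg : φ (a * c) y = (f * g).ofConv y := h (a * c) (f * g) hm y
  rw [hfg, ← mul'_map_ofConv (h a f hf) (h c g hg), QSA.map_val_comul,
    LinearMap.convMul_apply]

lemma isHopfPairing (hφ : IsCouplePairing φ₀ φ₁) (h : IsDualGraph φ₀ φ₁ φ) : IsHopfPairing φ :=
  have h' := h.flip hφ
  { one_left := h.one_apply hφ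
    one_right := h'.one_apply hφ.flip
    mul_left := h.mul_apply
    mul_right := fun a b c => h'.mul_apply b c a
    antipode := pairing_antipode (h.one_apply hφ) (h'.one_apply hφ.flip)
      (fun a b c => h'.mul_apply b c a) h.mul_apply }

lemma isGradedHopfPairing (hφ : IsCouplePairing φ₀ φ₁) (h : IsDualGraph φ₀ φ₁ φ) :
    IsGradedHopfPairing φ where
  toIsHopfPairing := h.isHopfPairing hφ
  graded i j hij x y hx hy := by
    obtain ⟨f, hf⟩ := exists_mem_dualGraph φ₀ φ₁ x.2
    obtain ⟨g, hg⟩ := exists_mem_dualGraph φ₀.flip φ₁.flip y.2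
    obtain ⟨z, hz, hsum⟩ := (Submodule.mem_iSup_iff_exists_finsupp _ _).1
      (mem_iSup_dualGraphDeg hφ hf)
    rw [h x f hf y]
    have h1 : x.1 = ∑ k ∈ z.support, (z k).1 := by
      have := congrArg Prod.fst hsum
      rw [Finsupp.sum, Prod.fst_sum] at this
      exact this.symm
    have h2 : f = ∑ k ∈ z.support, (z k).2 := by
      have := congrArg Prod.snd hsum
      rw [Finsupp.sum, Prod.snd_sum] at this
      exact this.symm
    -- Only the component of degree `j` of `(x, f)` contributes to `f(y)`, and as `x` has degree
    -- `i`, the first entry of this component is zero.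
    have hj : (z j).1 = 0 := by
      by_cases hjs : j ∈ z.support
      · exact Cot.eq_zero_of_sum_mem_deg (x := fun k => (z k).1) (fun k => (hz k).2.1) hij hjs
          (h1 ▸ hx)
      · rw [Finsupp.notMem_support_iff.1 hjs, Prod.fst_zero]
    have h3 : f.ofConv y = (z j).2.ofConv y := by
      rw [h2, ofConv_sum, LinearMap.sum_apply]
      refine Finset.sum_eq_single j (fun k _ hk => (hz k).2.2 j (Ne.symm hk) _ hy) fun hjs => ?_
      rw [Finsupp.notMem_support_iff.1 hjs]
      rfl
    rw [h3, dualGraph_reciprocity hφ (hz j).1 hg, hj, map_zero]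

lemma extends_pairing (h : IsDualGraph φ₀ φ₁ φ) : Extends φ φ₀ φ₁ where
  zero a b := by
    rw [h.inH_apply]
    exact congrArg (φ₀ a) (Cot.prH_inH b)
  one m n := by
    rw [h.inM_apply]
    exact congrArg (φ₁ m) (Cot.prP_inP 0 n)

end IsDualGraph

/-! ### Uniqueness -/

namespace QSA

lemma isHopfSub_val : IsHopfSub (QSA K H M).val :=
  ⟨Subtype.val_injective, comul_mem, fun x => ⟨⟨_, antipode_mem x.2⟩, rfl⟩⟩

lemma induction {p : QSA K H M → Prop} (hH : ∀ h, p (inH K H M h)) (hM : ∀ m, p (inM K H M m))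
    (hadd : ∀ x y, p x → p y → p (x + y)) (hmul : ∀ x y, p x → p y → p (x * y))
    (x : QSA K H M) : p x := by
  obtain ⟨x, hx⟩ := x
  induction hx using Algebra.adjoin_induction with
  | mem x hx =>
    rcases hx with ⟨h, rfl⟩ | ⟨m, rfl⟩
    · exact hH h
    · exact hM m
  | algebraMap r =>
    have : algebraMap K (Cot K H M) r = Cot.inH K H M (algebraMap K H r) :=
      (AlgHom.commutes (Cot.inHAlgHom K H M) r).symm
    simp only [this]
    exact hH _
  | add x y hx hy hpx hpy => exact hadd ⟨x, hx⟩ ⟨y, hy⟩ hpx hpy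
  | mul x y hx hy hpx hpy => exact hmul ⟨x, hx⟩ ⟨y, hy⟩ hpx hpy

lemma comul_inH (h : H) : comul (R := K) (inH K H M h)
    = TensorProduct.map (inH K H M) (inH K H M) (comul h) := by
  refine isHopfSub_val.map_injective ?_
  rw [map_val_comul]
  refine (Cot.dlt_inH h).trans ?_
  exact (map_map_eq (fun _ => rfl) (fun _ => rfl) _).symm

lemma comul_inM (m : M) : comul (R := K) (inM K H M m)
    = TensorProduct.map (inH K H M) (inM K H M) (coactL m)
      + TensorProduct.map (inM K H M) (inH K H M) (coactR m) := by
  refine isHopfSub_val.map_injective ?_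
  rw [map_val_comul, map_add]
  refine (Cot.dlt_inM m).trans ?_
  exact (congrArg₂ (· + ·) (map_map_eq (fun _ => rfl) (fun _ => rfl) _)
    (map_map_eq (fun _ => rfl) (fun _ => rfl) _)).symm

lemma inH_mem_deg (h : H) : inH K H M h ∈ deg K H M 0 := Cot.inH_mem_deg h

lemma inM_mem_deg (m : M) : inM K H M m ∈ deg K H M 1 := Cot.inM_mem_deg m

end QSA

/-- A graded Hopf pairing is determined by its restrictions to degrees zero and one: the
multiplicativity in the second variable determines it on the generators of `S_H(M)`, which span a
subcoalgebra, and the multiplicativity in the first variable on their products. -/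
lemma gradedHopfPairing_unique {φ ψ : QSA K H M →ₗ[K] QSA K B N →ₗ[K] K}
    (hφ : IsGradedHopfPairing φ) (hφ' : Extends φ φ₀ φ₁) (hψ : IsGradedHopfPairing ψ)
    (hψ' : Extends ψ φ₀ φ₁) : ψ = φ := by
  have h1 : ∀ y : QSA K B N, (∀ h, ψ (QSA.inH K H M h) y = φ (QSA.inH K H M h) y)
      ∧ ∀ m, ψ (QSA.inM K H M m) y = φ (QSA.inM K H M m) y := by
    intro y
    induction y using QSA.induction with
    | hH b =>
      refine ⟨fun h => by rw [hψ'.zero, hφ'.zero], fun m => ?_⟩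
      rw [hψ.graded 1 0 one_ne_zero _ _ (QSA.inM_mem_deg m) (QSA.inH_mem_deg b),
        hφ.graded 1 0 one_ne_zero _ _ (QSA.inM_mem_deg m) (QSA.inH_mem_deg b)]
    | hM n =>
      refine ⟨fun h => ?_, fun m => by rw [hψ'.one, hφ'.one]⟩
      rw [hψ.graded 0 1 zero_ne_one _ _ (QSA.inH_mem_deg h) (QSA.inM_mem_deg n),
        hφ.graded 0 1 zero_ne_one _ _ (QSA.inH_mem_deg h) (QSA.inM_mem_deg n)]
    | hadd y y' hy hy' =>
      exact ⟨fun h => by rw [map_add, map_add, hy.1, hy'.1],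
        fun m => by rw [map_add, map_add, hy.2, hy'.2]⟩
    | hmul y y' hy hy' =>
      refine ⟨fun h => ?_, fun m => ?_⟩
      · rw [hψ.mul_right, hφ.mul_right, QSA.comul_inH]
        exact mul'_map_map_congr hy.1 hy'.1 _
      · rw [hψ.mul_right, hφ.mul_right, QSA.comul_inM, map_add, map_add, map_add, map_add]
        exact congrArg₂ (· + ·) (mul'_map_map_congr hy.1 hy'.2 _)
          (mul'_map_map_congr hy.2 hy'.1 _)
  refine LinearMap.ext fun x => ?_
  induction x using QSA.induction with
  | hH h => exact LinearMap.ext fun y => (h1 y).1 h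
  | hM m => exact LinearMap.ext fun y => (h1 y).2 m
  | hadd x x' hx hx' => rw [map_add, map_add, hx, hx']
  | hmul x x' hx hx' =>
    refine LinearMap.ext fun y => ?_
    rw [hψ.mul_left, hφ.mul_left, hx, hx']

/-! ### Non-degeneracy -/

/-- If `φ₀` and `φ₁` are non-degenerate on the left, the forms in `dualGraph` separate the elements
of `Cot_H(M)`: as they are closed under convolution with `φ₁(-, n)`, which corresponds to splitting
off a tensor factor in `M`, this follows by induction on a bound `k` for the degree. -/
lemma eq_zero_of_dualGraph (h0 : φ₀.SeparatingLeft) (h1 : φ₁.SeparatingLeft) :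
    ∀ (k : ℕ) (x : Cot K H M), (∀ n, k ≤ n → Cot.prP K H M n x = 0) →
      (∀ z ∈ dualGraph φ₀.flip φ₁.flip, z.2.ofConv x = 0) → x = 0 := by
  have hH : ∀ x : Cot K H M, (∀ z ∈ dualGraph φ₀.flip φ₁.flip, z.2.ofConv x = 0) →
      Cot.prH K H M x = 0 := fun x hx => h0 _ fun b => hx _ (inH_mem_dualGraph b)
  intro k
  induction k with
  | zero =>
    intro x hk hx
    exact Cot.ext' (by rw [hH x hx, map_zero]) fun n => by rw [hk n (Nat.zero_le n), map_zero]
  | succ k ih =>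
    intro x hk hx
    have hunc : Cot.unc K H M x = 0 := by
      refine eq_zero_of_slices fun l => ih _ (fun n hn => ?_) fun z hz => ?_
      · rw [← Cot.lid_rTensor_lTensor, Cot.lTensor_prP_unc, hk (n + 1) (by omega)]
        simp
      · rw [← Cot.lid_rTensor_lTensor]
        -- The element `∑ g(x⁽²⁾) x⁽¹⁾` of `M`, where `∑ x⁽¹⁾ ⊗ x⁽²⁾` is the image of `x`
        -- under `unc`, is orthogonal to `N`.
        have hz0 : TensorProduct.rid K M (z.2.ofConv.lTensor M (Cot.unc K H M x)) = 0 := by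
          refine h1 _ fun n => ?_
          have h2 := hx _ (mul_mem (inM_mem_dualGraph n) hz)
          rw [Prod.snd_mul, LinearMap.convMul_apply, Cot.comul_eq] at h2
          rw [← Cot.rTensor_prM_dlt, ← h2]
          induction Cot.dlt K H M x with
          | zero => simp
          | add a b ha hb => simp only [map_add, LinearMap.add_apply, ha, hb]
          | tmul a b => simp [formM, mul_comm]
        rw [(TensorProduct.rid K M).map_eq_zero_iff] at hz0
        rw [hz0, map_zero, map_zero]
    rw [← Cot.ret_unc x, hunc, hH x hx, map_zero, map_zero, add_zero]

lemma IsDualGraph.separatingLeft {φ : QSA K H M →ₗ[K] QSA K B N →ₗ[K] K}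
    (hφ : IsCouplePairing φ₀ φ₁) (h : IsDualGraph φ₀ φ₁ φ) :
    φ.SeparatingLeft ↔ φ₀.SeparatingLeft ∧ φ₁.SeparatingLeft := by
  constructor
  · intro hs
    refine ⟨fun a ha => ?_, fun m hm => ?_⟩
    · have h0 : QSA.inH K H M a = 0 := hs _ fun y => (h.inH_apply a y).trans (ha _)
      have := congrArg (fun x : QSA K H M => Cot.prH K H M x) h0
      exact (Cot.prH_inH a).symm.trans (this.trans (map_zero _))
    · have h0 : QSA.inM K H M m = 0 := hs _ fun y => (h.inM_apply m y).trans (hm _)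
      have := congrArg (fun x : QSA K H M => Cot.prP K H M 0 x) h0
      exact (Cot.prP_inP 0 m).symm.trans (this.trans (map_zero _))
  · rintro ⟨h0, h1⟩ x hx
    obtain ⟨k, hk⟩ : ∃ k, ∀ n, k ≤ n → Cot.prP K H M n x = 0 := by
      obtain ⟨k, hk⟩ := Cot.exists_sum (x : Cot K H M)
      refine ⟨k, fun n hn => ?_⟩
      have h2 := congrArg (Cot.prP K H M n) (hk n hn)
      rw [map_add, Cot.prP_inH, zero_add, map_sum, Finset.sum_eq_zero] at h2
      · exact h2
      · exact fun j hj => Cot.prP_inP_ne (Finset.mem_range.1 hj).ne' _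
    refine Subtype.ext (eq_zero_of_dualGraph h0 h1 k x hk fun z hz => ?_)
    have := h.flip hφ ⟨z.1, fst_mem_QSA hz⟩ z.2 hz x
    rw [← this, LinearMap.flip_apply, hx]

lemma IsDualGraph.nondegenerate {φ : QSA K H M →ₗ[K] QSA K B N →ₗ[K] K}
    (hφ : IsCouplePairing φ₀ φ₁) (h : IsDualGraph φ₀ φ₁ φ) :
    φ.Nondegenerate ↔ φ₀.Nondegenerate ∧ φ₁.Nondegenerate := by
  have hl := h.separatingLeft hφ
  have hr := (h.flip hφ).separatingLeft hφ.flip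
  rw [LinearMap.flip_separatingLeft, LinearMap.flip_separatingLeft,
    LinearMap.flip_separatingLeft] at hr
  unfold LinearMap.Nondegenerate
  tauto

end CouplePairing

end QSym

end

theorem theorem3p1 {K : Type*} [Field K]
    {H : Type*} [Ring H] [HopfAlgebra K H]
    {M : Type*} [AddCommGroup M] [Module K M] [Module H M] [Module Hᵐᵒᵖ M] [IsScalarTower K H M]
    [IsScalarTower K Hᵐᵒᵖ M] [SMulCommClass H Hᵐᵒᵖ M] [QSym.HopfBimodule K H M]
    {B : Type*} [Ring B] [HopfAlgebra K B]
    {N : Type*} [AddCommGroup N] [Module K N] [Module B N] [Module Bᵐᵒᵖ N] [IsScalarTower K B N]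
    [IsScalarTower K Bᵐᵒᵖ N] [SMulCommClass B Bᵐᵒᵖ N] [QSym.HopfBimodule K B N]
    (φ₀ : H →ₗ[K] B →ₗ[K] K) (φ₁ : M →ₗ[K] N →ₗ[K] K) (hφ : QSym.IsCouplePairing φ₀ φ₁) :
    ∃ φ : QSym.QSA K H M →ₗ[K] QSym.QSA K B N →ₗ[K] K,
      (QSym.IsGradedHopfPairing φ ∧ QSym.Extends φ φ₀ φ₁) ∧
      (∀ ψ : QSym.QSA K H M →ₗ[K] QSym.QSA K B N →ₗ[K] K,
        QSym.IsGradedHopfPairing ψ ∧ QSym.Extends ψ φ₀ φ₁ → ψ = φ) ∧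
      (φ.Nondegenerate ↔ φ₀.Nondegenerate ∧ φ₁.Nondegenerate) := by
  obtain ⟨φ, h⟩ := QSym.exists_isDualGraph hφ
  exact ⟨φ, ⟨h.isGradedHopfPairing hφ, h.extends_pairing⟩,
    fun ψ hψ => QSym.gradedHopfPairing_unique (h.isGradedHopfPairing hφ) h.extends_pairing
      hψ.1 hψ.2, h.nondegenerate hφ⟩
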